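/- **Conventions.** Let $G$ be a group and $A$ a finite set of letters with a map $A\to G$ and a formal inversion $a\mapsto a^{-1}$, an involution of $A$ with $a^{-1}$ representing the inverse of the element represented by $a$; no letter represents the identity of $G$. The length of a word $w \in A^*$ is $l(w)$. For a 2-complex $Y$ with base vertex $y$, the coarse distance $\tilde d_Y(y,p)$ is the path-metric distance in the 1-skeleton $Y^{(1)}$ if $p$ is a vertex; it is $\frac12$ plus the smaller of the distances of the endpoints if $p$ is interior to an edge; and it is the maximum of the coarse distances of the open boundary edges minus $\frac14$ if $p$ is interior to a 2-cell. Let $\mathbb N[\frac14]=\{n/4 : n\in\mathbb N\}$. Let $\mathcal P=\langle A\mid \mathcal R\rangle$ be a finite presentation of $G$ with $\mathcal R\subset A^*\setminus\{1\}$ closed under inversion and cyclic conjugation, and let $X$ be its Cayley 2-complex. A nondecreasing function $f:\mathbb N[\frac14]\to\mathbb N[\frac14]$ is an *intrinsic* (respectively *extrinsic*) *tame filling function* for $G$ over $\mathcal P$ if every word $w\in A^*$ representing the identity has a van Kampen diagram $\Delta$ over $\mathcal P$ with basepoint $*$ and boundary label $w$, and a 1-combing $\Psi:\partial\Delta\times[0,1]\to\Delta$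 at $*$ (that is, $\Psi$ is continuous, $\Psi(p,0)=*$ and $\Psi(p,1)=p$ for all $p$, $\Psi(*,t)=*$ for all $t$, and $\Psi(v,t)\in\Delta^{(1)}$ for all vertices $v$ of $\partial\Delta$ and all $t$), such that for $\psi=\Psi$ and $Y=\Delta$ (respectively $\psi=\pi_\Delta\circ\Psi$ and $Y=X$, where $\pi_\Delta:\Delta\to X$ is the label-preserving cellular map sending $*$ to the identity vertex) we have, with $y$ the base vertex of $Y$, $$\tilde d_Y(y,\psi(p,s))\le f\bigl(\tilde d_Y(y,\psi(p,t))\bigr)\qquad\text{for all } p\in\partial\Delta,\ 0\le s<t\le 1 .$$ **Proposition.** Let $(A,R)$ be a finite complete rewriting system for $G$: $R\subset A^*\times A^*$ is finite, $G$ is presented as a monoid by the generators $A$ and the equations $u=v$ for $(u,v)\in R$, every element of $G$ is represented by exactly one word that cannot be rewritten by steps $xuy\to xvy$ with $(u,v)\in R$ and $x,y\in A^*$, and there is no infinite sequence of rewritings. Let $$\gamma(n)=\max\{\,l(x) : \text{some } w\in A^* \text{ with } l(w)\le n \text{ rewrites to } x \text{ in finitely many (possibly zero) steps}\,\}$$ be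 its string growth complexity, and let $m=\max_{(u,v)\in R}(l(u)+l(v))$ be the length of the longest rule ($m=0$ if there are no rules). Then $$n\mapsto \gamma(\lceil n\rceil+m+2)+1$$ is both an intrinsic and an extrinsic tame filling function for $G$ over the presentation $\langle A\mid \mathcal R\rangle$, where $\mathcal R$ consists of all cyclic conjugates of the words $uv^{-1}$, $(u,v)\in R$, and of their formal inverses. -/

import Mathlib

open scoped unitInterval

/-! ## Words and rewriting -/

/-- One rewriting `p u q → p v q` with a rule `(u, v)`. -/
def RewriteStep {A : Type*} (rules : Set (List A × List A)) (x y : List A) : Prop :=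
  ∃ p q u v, (u, v) ∈ rules ∧ x = p ++ u ++ q ∧ y = p ++ v ++ q

/-- A word that cannot be rewritten. -/
def IrreducibleWord {A : Type*} (rules : Set (List A × List A)) (x : List A) : Prop :=
  ∀ y, ¬ RewriteStep rules x y

/-- Letters for generators of `G`, closed under formal inversion, none of which represents `1`. -/
structure SymmetricAlphabet (A : Type*) (G : Type*) [Group G] where
  /-- the element represented by a letter -/
  rep : A → G
  /-- the formal inverse of a letter -/
  inv : A → A
  inv_inv : ∀ a, inv (inv a) = a
  rep_inv : ∀ a, rep (inv a) = (rep a)⁻¹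
  rep_ne_one : ∀ a, rep a ≠ 1

namespace SymmetricAlphabet

variable {A : Type*} {G : Type*} [Group G] (S : SymmetricAlphabet A G)

/-- The element of `G` represented by a word. -/
def eval (w : List A) : G := (w.map S.rep).prod

/-- The formal inverse of a word. -/
def wordInv (w : List A) : List A := (w.map S.inv).reverse

theorem eval_nil : S.eval [] = 1 := rfl

theorem eval_cons (a : A) (w : List A) : S.eval (a :: w) = S.rep a * S.eval w := by
  simp [eval]

theorem eval_append (v w : List A) : S.eval (v ++ w) = S.eval v * S.eval w := by
  simp [eval]

theorem wordInv_cons (a : A) (w : List A) :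
    S.wordInv (a :: w) = S.wordInv w ++ [S.inv a] := by
  simp [wordInv]

theorem eval_wordInv (w : List A) : S.eval (S.wordInv w) = (S.eval w)⁻¹ := by
  induction w with
  | nil => simp [wordInv, eval]
  | cons a w ih =>
    rw [wordInv_cons, eval_append, ih, eval_cons, eval_cons, eval_nil, S.rep_inv]
    simp

theorem wordInv_wordInv (w : List A) : S.wordInv (S.wordInv w) = w := by
  simp [wordInv, List.map_reverse, Function.comp_def, S.inv_inv]

end SymmetricAlphabet

/-- `(A, R)` is a finite complete rewriting system for `G`: `G` is the monoid presented by `A` and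
the equations `u = v` for `(u, v) ∈ R`, every element of `G` is represented by exactly one
irreducible word, and rewriting terminates. -/
structure IsFiniteCRS {A : Type*} {G : Type*} [Group G] (S : SymmetricAlphabet A G)
    (R : Finset (List A × List A)) : Prop where
  finite : Finite A
  generates : Function.Surjective S.eval
  presents : ∀ x y, S.eval x = S.eval y ↔ Relation.EqvGen (RewriteStep (R : Set (List A × List A))) x y
  normalForm : ∀ g : G, ∃! y, S.eval y = g ∧ IrreducibleWord (R : Set (List A × List A)) y
  terminates : WellFounded fun y x => Relation.TransGen (RewriteStep (R : Set (List A × List A))) x y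

/-- The string growth complexity: the maximal length of a word obtained by finitely many (possibly
no) rewritings from a word of length at most `n`. -/
noncomputable def stringGrowth {A : Type*} (R : Finset (List A × List A)) (n : ℕ) : ℕ :=
  sSup {l | ∃ w x : List A, w.length ≤ n ∧
    Relation.ReflTransGen (RewriteStep (R : Set (List A × List A))) w x ∧ x.length = l}

/-- The length of the longest rule, where the length of `u → v` is `l(u) + l(v)`. -/
def maxRuleLength {A : Type*} (R : Finset (List A × List A)) : ℕ :=
  R.sup fun r => r.1.length + r.2.length

/-- The maximum in the definition of `stringGrowth` exists. -/
theorem IsFiniteCRS.stringGrowth_isGreatest {A : Type*} {G : Type*} [Group G]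
    {S : SymmetricAlphabet A G} {R : Finset (List A × List A)} (h : IsFiniteCRS S R) (n : ℕ) :
    IsGreatest {l | ∃ w x : List A, w.length ≤ n ∧
      Relation.ReflTransGen (RewriteStep (R : Set (List A × List A))) w x ∧ x.length = l} (stringGrowth R n) := by
  have hfin := h.finite
  have hstep : ∀ x : List A, {y | RewriteStep (R : Set (List A × List A)) x y}.Finite := by
    intro x
    have hsub : {y | RewriteStep (R : Set (List A × List A)) x y} ⊆
        ⋃ k ∈ Set.Iic x.length, ⋃ r ∈ (R : Set (List A × List A)),
          {x.take k ++ r.2 ++ x.drop (k + r.1.length)} := by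
      rintro y ⟨p, q, u, v, hr, rfl, rfl⟩
      simp only [Set.mem_iUnion, Set.mem_singleton_iff]
      refine ⟨p.length, ?_, (u, v), hr, ?_⟩
      · simp
      · simp [List.drop_append]
    refine Set.Finite.subset ?_ hsub
    exact (Set.finite_Iic _).biUnion fun k _ => R.finite_toSet.biUnion fun r _ =>
      Set.finite_singleton _
  have hdesc : ∀ x : List A, {y | Relation.ReflTransGen (RewriteStep (R : Set (List A × List A))) x y}.Finite := by
    intro x
    induction x using h.terminates.induction with
    | _ x ih =>
      have hsub : {y | Relation.ReflTransGen (RewriteStep (R : Set (List A × List A))) x y} ⊆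
          {x} ∪ ⋃ z ∈ {z | RewriteStep (R : Set (List A × List A)) x z},
            {y | Relation.ReflTransGen (RewriteStep (R : Set (List A × List A))) z y} := by
        intro y hy
        rcases Relation.ReflTransGen.cases_head hy with rfl | ⟨z, hz, hzy⟩
        · simp
        · right
          simp only [Set.mem_iUnion]
          exact ⟨z, hz, hzy⟩
      refine Set.Finite.subset ?_ hsub
      exact (Set.finite_singleton _).union ((hstep x).biUnion fun z hz =>
        ih z (Relation.TransGen.single hz))
  have hall : {l | ∃ w x : List A, w.length ≤ n ∧
      Relation.ReflTransGen (RewriteStep (R : Set (List A × List A))) w x ∧ x.length = l}.Finite := by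
    have hw : {w : List A | w.length ≤ n}.Finite := List.finite_length_le A n
    refine ((hw.biUnion fun w _ => hdesc w).image List.length).subset ?_
    rintro l ⟨w, x, hwn, hx, rfl⟩
    refine ⟨x, ?_, rfl⟩
    simp only [Set.mem_iUnion]
    exact ⟨w, hwn, hx⟩
  exact ⟨Nat.sSup_mem ⟨0, [], [], by simp, Relation.ReflTransGen.refl, rfl⟩ hall.bddAbove,
    fun l hl => le_csSup hall.bddAbove hl⟩

/-- The rules `r → 1` for `r` a relator, and `a a⁻¹ → 1`. -/
def SymmetricAlphabet.groupRules {A : Type*} {G : Type*} [Group G] (S : SymmetricAlphabet A G)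
    (relators : Set (List A)) : Set (List A × List A) :=
  {p | p.2 = [] ∧ (p.1 ∈ relators ∨ ∃ a, p.1 = [a, S.inv a])}

/-- A finite symmetric presentation of `G`: finitely many generators, closed under inversion, and
finitely many nonempty relators, closed under inversion and cyclic conjugation. -/
structure SymmetricPresentation (A : Type*) (G : Type*) [Group G] extends
    SymmetricAlphabet A G where
  relators : Set (List A)
  finite_letters : Finite A
  finite_relators : relators.Finite
  relator_ne_nil : ∀ r ∈ relators, r ≠ []
  inv_mem : ∀ r ∈ relators, toSymmetricAlphabet.wordInv r ∈ relators
  rotate_mem : ∀ r ∈ relators, ∀ r', r ~r r' → r' ∈ relators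
  generates : Function.Surjective toSymmetricAlphabet.eval
  presents : ∀ x y, toSymmetricAlphabet.eval x = toSymmetricAlphabet.eval y ↔
    Relation.EqvGen (RewriteStep (toSymmetricAlphabet.groupRules relators)) x y

/-- The relators `u v⁻¹`, for `(u, v)` a rule, with all cyclic conjugates of these words and of their
inverses. -/
def SymmetricAlphabet.ruleRelators {A : Type*} {G : Type*} [Group G] (S : SymmetricAlphabet A G)
    (R : Finset (List A × List A)) : Set (List A) :=
  {r | ∃ p ∈ R, (p.1 ++ S.wordInv p.2) ~r r ∨ S.wordInv (p.1 ++ S.wordInv p.2) ~r r}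

theorem RewriteStep.context {A : Type*} {rules : Set (List A × List A)} {x y : List A}
    (h : RewriteStep rules x y) (p q : List A) :
    RewriteStep rules (p ++ x ++ q) (p ++ y ++ q) := by
  obtain ⟨p', q', u, v, hr, rfl, rfl⟩ := h
  exact ⟨p ++ p', q' ++ q, u, v, hr, by simp, by simp⟩

theorem rewriteEqv_context {A : Type*} {rules : Set (List A × List A)} {x y : List A}
    (h : Relation.EqvGen (RewriteStep rules) x y) (p q : List A) :
    Relation.EqvGen (RewriteStep rules) (p ++ x ++ q) (p ++ y ++ q) := by
  induction h with
  | rel x y h => exact .rel _ _ (h.context p q)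
  | refl x => exact .refl _
  | symm x y _ ih => exact ih.symm
  | trans x y z _ _ ih₁ ih₂ => exact ih₁.trans _ _ _ ih₂

theorem SymmetricAlphabet.wordInv_append_self {A : Type*} {G : Type*} [Group G]
    (S : SymmetricAlphabet A G) (rel : Set (List A)) (w : List A) :
    Relation.EqvGen (RewriteStep (S.groupRules rel)) (S.wordInv w ++ w) [] := by
  induction w with
  | nil => exact .refl _
  | cons a w ih =>
    refine Relation.EqvGen.trans _ (S.wordInv w ++ w) _ (.rel _ _ ?_) ih
    refine ⟨S.wordInv w, w, [S.inv a, a], [], ⟨rfl, Or.inr ⟨S.inv a, by rw [S.inv_inv]⟩⟩, ?_, ?_⟩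
    · simp [S.wordInv_cons]
    · simp

theorem SymmetricAlphabet.wordInv_rotated {A : Type*} {G : Type*} [Group G]
    (S : SymmetricAlphabet A G) {x y : List A} (h : x ~r y) : S.wordInv x ~r S.wordInv y :=
  (h.map S.inv).reverse

theorem SymmetricAlphabet.eval_rotated {A : Type*} {G : Type*} [Group G]
    (S : SymmetricAlphabet A G) {x y : List A} (h : x ~r y) (hx : S.eval x = 1) :
    S.eval y = 1 := by
  obtain ⟨n, rfl⟩ := h
  rw [List.rotate_eq_drop_append_take_mod, S.eval_append]
  rw [← List.take_append_drop (n % x.length) x, S.eval_append] at hx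
  exact mul_eq_one_iff_eq_inv.2 (eq_inv_of_mul_eq_one_right hx)

/-- The symmetric presentation of `G` given by a finite complete rewriting system. -/
def IsFiniteCRS.presentation {A : Type*} {G : Type*} [Group G] {S : SymmetricAlphabet A G}
    {R : Finset (List A × List A)} (h : IsFiniteCRS S R) : SymmetricPresentation A G where
  toSymmetricAlphabet := S
  relators := S.ruleRelators R
  finite_letters := h.finite
  finite_relators := by
    have : S.ruleRelators R ⊆ ⋃ p ∈ (R : Set (List A × List A)),
        ({r | (p.1 ++ S.wordInv p.2) ~r r} ∪ {r | S.wordInv (p.1 ++ S.wordInv p.2) ~r r}) := by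
      rintro r ⟨p, hp, hr⟩
      simp only [Set.mem_iUnion]
      exact ⟨p, hp, hr⟩
    refine Set.Finite.subset (R.finite_toSet.biUnion fun p _ => ?_) this
    have hrot : ∀ x : List A, {r | x ~r r}.Finite := fun x => by
      refine (x.cyclicPermutations.finite_toSet).subset fun r hr => ?_
      exact List.mem_cyclicPermutations_iff.2 hr.symm
    exact (hrot _).union (hrot _)
  relator_ne_nil := by
    rintro r ⟨⟨u, v⟩, hp, hr⟩ rfl
    have huv : u = [] := by
      rcases hr with hr | hr
      · have := List.isRotated_nil_iff.1 hr
        exact (List.append_eq_nil_iff.1 this).1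
      · have := List.isRotated_nil_iff.1 hr
        rw [SymmetricAlphabet.wordInv, List.reverse_eq_nil_iff, List.map_eq_nil_iff] at this
        exact (List.append_eq_nil_iff.1 this).1
    subst huv
    -- a rule with empty left side could be applied forever
    have hs : ∀ x : List A, RewriteStep (R : Set (List A × List A)) x (v ++ x) := fun x =>
      ⟨[], x, [], v, hp, by simp, by simp⟩
    obtain ⟨m, -, hm⟩ := h.terminates.has_min Set.univ ⟨[], trivial⟩
    exact hm _ trivial (Relation.TransGen.single (hs m))
  inv_mem := by
    rintro r ⟨p, hp, hr | hr⟩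
    · exact ⟨p, hp, Or.inr (S.wordInv_rotated hr)⟩
    · refine ⟨p, hp, Or.inl ?_⟩
      have := S.wordInv_rotated hr
      rwa [S.wordInv_wordInv] at this
  rotate_mem := by
    rintro r ⟨p, hp, hr | hr⟩ r' hrr
    · exact ⟨p, hp, Or.inl (hr.trans hrr)⟩
    · exact ⟨p, hp, Or.inr (hr.trans hrr)⟩
  generates := h.generates
  presents := by
    intro x y
    have hrule : ∀ p ∈ R, S.eval p.1 = S.eval p.2 := fun p hp =>
      (h.presents _ _).2 (.rel _ _ ⟨[], [], p.1, p.2, hp, by simp, by simp⟩)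
    constructor
    · intro hxy
      refine (h.presents x y).1 hxy |>.rec (motive := fun x y _ =>
        Relation.EqvGen (RewriteStep (S.groupRules (S.ruleRelators R))) x y) ?_ ?_ ?_ ?_
      · rintro x y ⟨p, q, u, v, hr, rfl, rfl⟩
        have h1 := rewriteEqv_context (S.wordInv_append_self (S.ruleRelators R) v) (p ++ u) q
        have h2 : RewriteStep (S.groupRules (S.ruleRelators R))
            (p ++ u ++ (S.wordInv v ++ v) ++ q) (p ++ v ++ q) :=
          ⟨p, v ++ q, u ++ S.wordInv v, [],
            ⟨rfl, Or.inl ⟨(u, v), hr, Or.inl (List.IsRotated.refl _)⟩⟩, by simp, by simp⟩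
        have h3 := (h1.symm).trans _ _ _ (Relation.EqvGen.rel _ _ h2)
        simpa using h3
      · intro x; exact .refl _
      · intro x y _ ih; exact ih.symm
      · intro x y z _ _ ih₁ ih₂; exact ih₁.trans _ _ _ ih₂
    · intro hxy
      induction hxy with
      | rel x y hs =>
        obtain ⟨p, q, u, v, ⟨hv, hu⟩, rfl, rfl⟩ := hs
        have hu1 : S.eval u = 1 := by
          rcases hu with ⟨s, hs, hr | hr⟩ | ⟨a, ha⟩
          · refine S.eval_rotated hr ?_
            rw [S.eval_append, S.eval_wordInv, hrule s hs, mul_inv_cancel]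
          · refine S.eval_rotated hr ?_
            rw [S.eval_wordInv, S.eval_append, S.eval_wordInv, hrule s hs, mul_inv_cancel, inv_one]
          · simp only at ha
            rw [ha, S.eval_cons, S.eval_cons, S.eval_nil, S.rep_inv]
            simp
        simp only at hv
        rw [hv]
        simp [S.eval_append, hu1]
      | refl x => rfl
      | symm x y _ ih => exact ih.symm
      | trans x y z _ _ ih₁ ih₂ => exact ih₁.trans ih₂

/-! ## Combinatorial 2-complexes -/

/-- A 1-complex: vertices, and directed edges with an orientation-reversing involution. -/
structure OneComplex.{u, v} where
  V : Type u
  D : Type v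
  src : D → V
  rev : D → D
  rev_rev : ∀ d, rev (rev d) = d
  rev_ne : ∀ d, rev d ≠ d

/-- The terminal vertex of a directed edge. -/
def OneComplex.tgt (Y : OneComplex) (d : Y.D) : Y.V := Y.src (Y.rev d)

/-- `p` is an edge path from `u` to `v`. -/
def OneComplex.IsPath (Y : OneComplex) : Y.V → List Y.D → Y.V → Prop
  | u, [], v => u = v
  | u, d :: p, v => Y.src d = u ∧ Y.IsPath (Y.tgt d) p v

/-- The path metric on vertices (the complexes below are connected). -/
noncomputable def OneComplex.pathDist (Y : OneComplex) (u v : Y.V) : ℕ :=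
  sInf {n | ∃ p, Y.IsPath u p v ∧ p.length = n}

/-- A combinatorial 2-complex: each 2-cell is a polygon attached along a closed edge path. -/
structure TwoComplex.{u, v} extends OneComplex.{u, v} where
  F : Type v
  bd : F → List D
  bd_ne_nil : ∀ f, bd f ≠ []
  bd_closed : ∀ f, ∃ u, toOneComplex.IsPath u (bd f) u

theorem OneComplex.IsPath.tgt_eq {Y : OneComplex} {u v : Y.V} {p : List Y.D}
    (h : Y.IsPath u p v) : ∀ (k : ℕ) (hk : k + 1 < p.length), Y.tgt p[k] = Y.src p[k + 1] := by
  induction p generalizing u with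
  | nil => intro k hk; simp at hk
  | cons d p ih =>
    intro k hk
    obtain ⟨h1, h2⟩ := h
    cases k with
    | zero =>
      cases p with
      | nil => simp at hk
      | cons e p => exact h2.1.symm
    | succ k => exact ih h2 k (by simpa using hk)

theorem OneComplex.IsPath.src_head {Y : OneComplex} {u v : Y.V} {p : List Y.D}
    (h : Y.IsPath u p v) (hp : 0 < p.length) : Y.src p[0] = u := by
  cases p with
  | nil => simp at hp
  | cons d p => exact h.1

theorem OneComplex.IsPath.tgt_last {Y : OneComplex} {u v : Y.V} {p : List Y.D}
    (h : Y.IsPath u p v) (k : ℕ) (hk : k < p.length) (hl : k + 1 = p.length) :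
    Y.tgt p[k] = v := by
  induction p generalizing u k with
  | nil => simp at hk
  | cons d p ih =>
    obtain ⟨h1, h2⟩ := h
    cases k with
    | zero =>
      cases p with
      | nil => exact h2
      | cons e p => simp at hl
    | succ k => exact ih h2 k (by simpa using hk) (by simpa using hl)

namespace TwoComplex

/-- The sides of the 2-cells: the `k`-th side of the polygon `f`. -/
def Side (Y : TwoComplex) : Type _ := {c : Y.F × ℕ // c.2 < (Y.bd c.1).length}

/-- The directed edge to which a side is attached. -/
def Side.dart {Y : TwoComplex} (c : Y.Side) : Y.D := (Y.bd c.1.1)[c.1.2]'c.2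

/-- The next side of the same polygon. -/
def Side.next {Y : TwoComplex} (c : Y.Side) : Y.Side :=
  ⟨(c.1.1, (c.1.2 + 1) % (Y.bd c.1.1).length),
    Nat.mod_lt _ (List.length_pos_of_ne_nil (Y.bd_ne_nil c.1.1))⟩

theorem Side.src_next {Y : TwoComplex} (c : Y.Side) : Y.src c.next.dart = Y.tgt c.dart := by
  obtain ⟨⟨f, k⟩, hk⟩ := c
  obtain ⟨u, hu⟩ := Y.bd_closed f
  simp only at hk
  simp only [Side.dart, Side.next]
  by_cases hl : k + 1 = (Y.bd f).length
  · have h0 : (k + 1) % (Y.bd f).length = 0 := by rw [hl, Nat.mod_self]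
    simp only [h0]
    rw [hu.src_head (by omega), hu.tgt_last k hk hl]
  · have h1 : (k + 1) % (Y.bd f).length = k + 1 := Nat.mod_eq_of_lt (by omega)
    simp only [h1]
    exact (hu.tgt_eq k (by omega)).symm

/-- Points of the cells, before gluing. The closed polygon `f` is the cone over its boundary cycle:
`face c t s` lies above the point with parameter `t` of the side `c`, at height `s`, where `s = 0` is
the boundary and `s = 1` is the centre of the polygon. -/
inductive PrePoint (Y : TwoComplex) where
  | vert (v : Y.V)
  | edge (d : Y.D) (t : I)
  | face (c : Y.Side) (t s : I)

/-- The gluing of the cells. -/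
inductive Glue (Y : TwoComplex) : Y.PrePoint → Y.PrePoint → Prop
  | edge_src (d : Y.D) : Glue Y (.edge d 0) (.vert (Y.src d))
  | edge_rev (d : Y.D) (t : I) : Glue Y (.edge d t) (.edge (Y.rev d) (unitInterval.symm t))
  | face_bd (c : Y.Side) (t : I) : Glue Y (.face c t 0) (.edge c.dart t)
  | face_side (c : Y.Side) (s : I) : Glue Y (.face c 1 s) (.face c.next 0 s)
  | face_centre (c c' : Y.Side) (t t' : I) (h : c.1.1 = c'.1.1) :
      Glue Y (.face c t 1) (.face c' t' 1)

/-- The topological space underlying the complex. -/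
def Space (Y : TwoComplex) : Type _ := Quot Y.Glue

/-- The point of the space given by a point of a cell. -/
def pt (Y : TwoComplex) (x : Y.PrePoint) : Y.Space := Quot.mk _ x

/-- The weak topology: a set is open iff its preimages in all closed edges and all the sectors of
all closed polygons are open. -/
instance (Y : TwoComplex) : TopologicalSpace Y.Space :=
  (⨆ d : Y.D, TopologicalSpace.coinduced (fun t : I => Y.pt (.edge d t)) inferInstance) ⊔
  (⨆ c : Y.Side,
    TopologicalSpace.coinduced (fun x : I × I => Y.pt (.face c x.1 x.2)) inferInstance)

/-- The 0-skeleton. -/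
def skeleton0 (Y : TwoComplex) : Set Y.Space := Set.range fun v => Y.pt (.vert v)

/-- The 1-skeleton. -/
def skeleton1 (Y : TwoComplex) : Set Y.Space :=
  Y.skeleton0 ∪ Set.range fun x : Y.D × I => Y.pt (.edge x.1 x.2)

/-- Coarse distance from `y` to the interior points of the edge `d`. -/
noncomputable def edgeCoarseDist (Y : TwoComplex) (y : Y.V) (d : Y.D) : ℝ :=
  min (Y.pathDist y (Y.src d) : ℝ) (Y.pathDist y (Y.tgt d)) + 1 / 2

/-- Coarse distance from `y` to the interior points of the 2-cell `f`. -/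
noncomputable def faceCoarseDist (Y : TwoComplex) (y : Y.V) (f : Y.F) : ℝ :=
  (⨆ k : Fin (Y.bd f).length, Y.edgeCoarseDist y ((Y.bd f)[k])) - 1 / 4

open Classical in
/-- Coarse distance from `y` to the point with parameter `t` on the closed edge `d`. -/
noncomputable def closedEdgeCoarseDist (Y : TwoComplex) (y : Y.V) (d : Y.D) (t : I) : ℝ :=
  if t = 0 then (Y.pathDist y (Y.src d) : ℝ)
  else if t = 1 then (Y.pathDist y (Y.tgt d) : ℝ)
  else Y.edgeCoarseDist y d

open Classical in
/-- Coarse distance on points of the cells, before gluing. -/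
noncomputable def preCoarseDist (Y : TwoComplex) (y : Y.V) : Y.PrePoint → ℝ
  | .vert v => (Y.pathDist y v : ℝ)
  | .edge d t => Y.closedEdgeCoarseDist y d t
  | .face c t s => if s = 0 then Y.closedEdgeCoarseDist y c.dart t
      else Y.faceCoarseDist y c.1.1

theorem preCoarseDist_glue (Y : TwoComplex) (y : Y.V) (a b : Y.PrePoint) (h : Y.Glue a b) :
    Y.preCoarseDist y a = Y.preCoarseDist y b := by
  have h10 : (1 : I) ≠ 0 := one_ne_zero
  cases h with
  | edge_src d => simp [preCoarseDist, closedEdgeCoarseDist]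
  | edge_rev d t =>
    by_cases h0 : t = 0
    · subst h0
      simp [preCoarseDist, closedEdgeCoarseDist, OneComplex.tgt, Y.rev_rev]
    · by_cases h1 : t = 1
      · subst h1
        simp [preCoarseDist, closedEdgeCoarseDist, OneComplex.tgt]
      · have h0' : unitInterval.symm t ≠ 0 := fun h => h1 (unitInterval.symm_eq_zero.1 h)
        have h1' : unitInterval.symm t ≠ 1 := fun h => h0 (unitInterval.symm_eq_one.1 h)
        simp only [preCoarseDist, closedEdgeCoarseDist, edgeCoarseDist, h0, h1, h0', h1', if_false,
          OneComplex.tgt, Y.rev_rev]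
        rw [min_comm]
  | face_bd c t => simp [preCoarseDist]
  | face_side c s =>
    by_cases hs : s = 0
    · subst hs
      simp [preCoarseDist, closedEdgeCoarseDist, Side.src_next]
    · simp [preCoarseDist, hs, Side.next]
  | face_centre c c' t t' h => simp [preCoarseDist, h]

/-- The coarse distance from the vertex `y` to a point of the complex. -/
noncomputable def coarseDist (Y : TwoComplex) (y : Y.V) (x : Y.Space) : ℝ :=
  Quot.lift (Y.preCoarseDist y) (Y.preCoarseDist_glue y) x

/-- `ψ` is a 1-combing of the pair `(Y, Z)` at the vertex `y`. -/
structure IsOneCombing (Y : TwoComplex) (Z : Set Y.Space) (y : Y.V) (ψ : Z × I → Y.Space) :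
    Prop where
  continuous : Continuous ψ
  start : ∀ p, ψ (p, 0) = Y.pt (.vert y)
  finish : ∀ p, ψ (p, 1) = p
  base : ∀ p : Z, (p : Y.Space) = Y.pt (.vert y) → ∀ t, ψ (p, t) = Y.pt (.vert y)
  skeleton : ∀ p : Z, (p : Y.Space) ∈ Y.skeleton0 → ∀ t, ψ (p, t) ∈ Y.skeleton1

/-- `f`-tameness, with coarse distances measured from the vertex `y`. -/
def IsTame (Y : TwoComplex) (y : Y.V) (f : ℝ → ℝ) {Z : Type*} (ψ : Z × I → Y.Space) : Prop :=
  ∀ (p : Z) (s t : I), s < t → Y.coarseDist y (ψ (p, s)) ≤ f (Y.coarseDist y (ψ (p, t)))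

/-- A cellular map that sends each cell to a cell of the same dimension, preserving the attaching
paths. -/
structure Hom (Y Z : TwoComplex) where
  onV : Y.V → Z.V
  onD : Y.D → Z.D
  onF : Y.F → Z.F
  src : ∀ d, Z.src (onD d) = onV (Y.src d)
  rev : ∀ d, onD (Y.rev d) = Z.rev (onD d)
  bd : ∀ f, Z.bd (onF f) = (Y.bd f).map onD

namespace Hom

variable {Y Z : TwoComplex} (φ : Hom Y Z)

/-- The induced map on sides of polygons. -/
def onSide (c : Y.Side) : Z.Side :=
  ⟨(φ.onF c.1.1, c.1.2), by rw [φ.bd, List.length_map]; exact c.2⟩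

/-- The induced map on points of cells. -/
def onPrePoint : Y.PrePoint → Z.PrePoint
  | .vert v => .vert (φ.onV v)
  | .edge d t => .edge (φ.onD d) t
  | .face c t s => .face (φ.onSide c) t s

theorem dart_onSide (c : Y.Side) : (φ.onSide c).dart = φ.onD c.dart := by
  simp [onSide, Side.dart, φ.bd]

theorem next_onSide (c : Y.Side) : (φ.onSide c).next = φ.onSide c.next := by
  apply Subtype.ext
  simp [onSide, Side.next, φ.bd]

theorem glue (a b : Y.PrePoint) (h : Y.Glue a b) : Z.Glue (φ.onPrePoint a) (φ.onPrePoint b) := by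
  cases h with
  | edge_src d => simpa [onPrePoint, φ.src] using Glue.edge_src (Y := Z) (φ.onD d)
  | edge_rev d t => simpa [onPrePoint, φ.rev] using Glue.edge_rev (Y := Z) (φ.onD d) t
  | face_bd c t => simpa [onPrePoint, dart_onSide] using Glue.face_bd (φ.onSide c) t
  | face_side c s => simpa [onPrePoint, next_onSide] using Glue.face_side (φ.onSide c) s
  | face_centre c c' t t' h =>
    exact Glue.face_centre (φ.onSide c) (φ.onSide c') t t' (congrArg φ.onF h)

/-- The induced map on the underlying spaces. -/
def onSpace : Y.Space → Z.Space := Quot.map φ.onPrePoint φ.glue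

end Hom

end TwoComplex

/-! ## Cayley complex and van Kampen diagrams -/

namespace SymmetricPresentation

variable {A : Type*} {G : Type*} [Group G] (P : SymmetricPresentation A G)

/-- The Cayley graph: `(g, a)` is the directed edge labelled `a` from `g` to `g a`. It has the same
underlying edge as `(g a, a⁻¹)`. -/
def cayleyGraph : OneComplex where
  V := G
  D := G × A
  src d := d.1
  rev d := (d.1 * P.rep d.2, P.inv d.2)
  rev_rev d := by simp [P.rep_inv, P.inv_inv]
  rev_ne d h := by
    have h1 := congrArg Prod.fst h
    simp only [mul_eq_left] at h1
    exact P.rep_ne_one _ h1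

/-- The Cayley 2-complex: a 2-cell is attached along each closed edge path whose label is a relator.
(Such a path is given with its starting point and direction. The 2-cells for the various starting
points and directions on one loop have the same coarse distances.) -/
def cayleyComplex : TwoComplex where
  toOneComplex := P.cayleyGraph
  F := {p : List (G × A) // p.map Prod.snd ∈ P.relators ∧ ∃ g, P.cayleyGraph.IsPath g p g}
  bd p := p.1
  bd_ne_nil p h := P.relator_ne_nil _ p.2.1 (by rw [h]; rfl)
  bd_closed p := p.2.2

/-- The boundary cycles of the 2-cells and of an outer face `none`, where the closed path `b` runs
along the outer face with that face on its right. -/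
def _root_.TwoComplex.faceCycle (Y : TwoComplex) (b : List Y.D) : Option Y.F → List Y.D
  | some f => Y.bd f
  | none => (b.map Y.rev).reverse

/-- A van Kampen diagram for the word `w`: a finite planar contractible labelled 2-complex with
boundary label `w`. It is given as a cell decomposition of the oriented 2-sphere with one face, the
outer one, removed. The boundary paths `bd f` of 2-cells and the path `bdry` around the diagram all
run counterclockwise, so that the outer face has the reverse of `bdry` as its boundary with the face
on the left. -/
structure VanKampenDiagram (w : List A) extends TwoComplex.{0, 0} where
  finite_V : Finite V
  finite_D : Finite D
  finite_F : Finite F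
  base : V
  connected : ∀ v, ∃ p, toOneComplex.IsPath base p v
  label : D → A
  label_rev : ∀ d, label (rev d) = P.inv (label d)
  label_bd : ∀ f, (bd f).map label ∈ P.relators
  bdry : List D
  bdry_closed : toOneComplex.IsPath base bdry base
  label_bdry : bdry.map label = w
  /-- each directed edge has exactly one face on its left, and occurs once in its boundary cycle -/
  left_face : ∀ d, ∃! c : Option F × ℕ,
    (toTwoComplex.faceCycle bdry c.1)[c.2]? = some d
  /-- the directed edges starting at a vertex form a single cycle around it, where `d` is followed by
  `d'` if the reverse of `d'` precedes `d` in the boundary cycle of a face -/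
  rotation : ∀ d d', src d = src d' → Relation.ReflTransGen
    (fun d d' => ∃ f k, (toTwoComplex.faceCycle bdry f)[k]? = some (rev d') ∧
      (toTwoComplex.faceCycle bdry f)[(k + 1) % (toTwoComplex.faceCycle bdry f).length]? =
        some d) d d'
  /-- the surface glued from the faces, which is connected, closed and oriented, is a sphere: the
  numbers of vertices, edges and faces (including the outer face) satisfy `V - E + F = 2` -/
  euler : (Nat.card V : ℤ) - (Nat.card D : ℤ) / 2 + Nat.card (Option F) = 2

namespace VanKampenDiagram

variable {P} {w : List A} (Δ : P.VanKampenDiagram w)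

/-- The boundary of the diagram, as a subset of the underlying space. -/
def boundary : Set Δ.toTwoComplex.Space :=
  {Δ.toTwoComplex.pt (.vert Δ.base)} ∪
    {x | ∃ d ∈ Δ.bdry, ∃ t, x = Δ.toTwoComplex.pt (.edge d t)}

/-- `π` is the cellular map to the Cayley complex that sends the basepoint to the vertex `1` and
preserves labels and orientations. -/
structure IsCayleyMap (π : TwoComplex.Hom Δ.toTwoComplex P.cayleyComplex) : Prop where
  base : π.onV Δ.base = (1 : G)
  label : ∀ d, (π.onD d : G × A).2 = Δ.label d

/-- There is at most one such map. -/
theorem IsCayleyMap.unique {π π' : TwoComplex.Hom Δ.toTwoComplex P.cayleyComplex}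
    (h : Δ.IsCayleyMap π) (h' : Δ.IsCayleyMap π') : π = π' := by
  have hD : ∀ d, π.onV (Δ.src d) = π'.onV (Δ.src d) → π.onD d = π'.onD d := fun d hd => by
    have h1 : (π.onD d : G × A).1 = π.onV (Δ.src d) := π.src d
    have h2 : (π'.onD d : G × A).1 = π'.onV (Δ.src d) := π'.src d
    exact Prod.ext (h1.trans (hd.trans h2.symm)) ((h.label d).trans (h'.label d).symm)
  have hpath : ∀ (p : List Δ.D) (u v : Δ.V), Δ.IsPath u p v → π.onV u = π'.onV u →
      π.onV v = π'.onV v := by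
    intro p
    induction p with
    | nil => rintro u v rfl hu; exact hu
    | cons d p ih =>
      rintro u v ⟨rfl, hp⟩ hu
      refine ih _ _ hp ?_
      have e1 := π.src (Δ.rev d)
      have e2 := π'.src (Δ.rev d)
      rw [π.rev, hD d hu, ← π'.rev] at e1
      exact e1.symm.trans e2
  have hV : π.onV = π'.onV := funext fun v => by
    obtain ⟨p, hp⟩ := Δ.connected v
    exact hpath p _ _ hp (h.base.trans h'.base.symm)
  have hD' : π.onD = π'.onD := funext fun d => hD d (congrFun hV _)
  have hF : π.onF = π'.onF := funext fun f => by
    have e := (π.bd f).trans ((congrArg (fun m => (Δ.bd f).map m) hD').trans (π'.bd f).symm)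
    exact Subtype.ext e
  cases π
  cases π'
  simp only at hV hD' hF
  subst hV hD' hF
  rfl

end VanKampenDiagram

end SymmetricPresentation

/-- The set `ℕ[1/4]` of quarter-integers, in which coarse distances take their values. -/
def quarterNat : Set ℝ := {x | ∃ n : ℕ, x = n / 4}

namespace SymmetricPresentation

variable {A : Type*} {G : Type*} [Group G] (P : SymmetricPresentation A G)

/-- `f` is an intrinsic tame filling function for `G` over the presentation `P`. -/
def IsIntrinsicTameFilling (f : ℝ → ℝ) : Prop :=
  Set.MapsTo f quarterNat quarterNat ∧ MonotoneOn f quarterNat ∧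
  ∀ w : List A, P.eval w = 1 →
    ∃ (Δ : P.VanKampenDiagram w) (ψ : Δ.boundary × I → Δ.toTwoComplex.Space),
      Δ.toTwoComplex.IsOneCombing Δ.boundary Δ.base ψ ∧
      Δ.toTwoComplex.IsTame Δ.base f ψ

/-- `f` is an extrinsic tame filling function for `G` over the presentation `P`. -/
def IsExtrinsicTameFilling (f : ℝ → ℝ) : Prop :=
  Set.MapsTo f quarterNat quarterNat ∧ MonotoneOn f quarterNat ∧
  ∀ w : List A, P.eval w = 1 →
    ∃ (Δ : P.VanKampenDiagram w) (ψ : Δ.boundary × I → Δ.toTwoComplex.Space),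
      Δ.toTwoComplex.IsOneCombing Δ.boundary Δ.base ψ ∧
      ∃ π : TwoComplex.Hom Δ.toTwoComplex P.cayleyComplex, Δ.IsCayleyMap π ∧
        P.cayleyComplex.IsTame (1 : G) f (π.onSpace ∘ ψ)

end SymmetricPresentation

/-! Call a word a reachable prefix of `x` if it is a prefix of some word to which `x` rewrites.
Every point of a suitable van Kampen diagram receives a set of reachable prefixes as its weight, and
the 1-combing is built so that weights only grow, with respect to inclusion, along its paths.

The diagrams come from well-founded induction along rewriting (`IsFiniteCRS.hasNormalDiagram`). A
nonempty word for the identity is reducible, so it has the form `p u a q` with a rule `u a → v` and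
`p u` irreducible. In a diagram for `p v q`, attach a hair labelled `u` at the end of `p`, so that
the boundary reads `p u u⁻¹ v q`. Then cut off `u⁻¹ v` by a new edge labelled `a`. The new face
carries a cyclic conjugate of `u a v⁻¹`, and the boundary reads `p u a q`. Spurs form a spanning
tree whose paths carry normal forms, and each chord is the top edge of one face whose other edges
are older; this structure is a `Stacking`.

A stacking gives a combing by recursion on rank (`exists_isOneCombing`). Tree edges are combed along
the tree. For the top edge of a face, the combings of the other sides are continued radially to the
centre of the face and from there down onto the top edge.

A vertex is weighted by the reachable prefixes of its normal form, an edge by those of the normal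
form of its positive source followed by its label, and a face by the weight of its top edge. Weights
grow across a face because the word of each of its edges is a reachable prefix of `p u a`. For the
edges of the hair it is a prefix of `p u`. For an edge of `v` it appears when `p u a` is rewritten
to `p v` and then the part of `p v` before that edge is rewritten to its normal form.

For the estimate, the weight of a point contains a word whose length is at least its coarse distance
minus 1 (`exists_coarse_le`), and is contained in the reachable prefixes of a word of length at most
the rounded-up coarse distance plus 2 (`exists_length_le`). Comparing an earlier with a later point
of a combing path gives the bound. Both facts use only that the distance of a vertex is at most the
length of its tree path and is the length of some word for the corresponding group element. This
holds in the diagram and in the Cayley complex, so one combing serves both. -/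

/-! ## Cyclic lists -/

namespace List

variable {α β : Type*}

/-- `a` is followed by `b` in the list. -/
def Follows (l : List α) (a b : α) : Prop := ∃ s t, l = s ++ a :: b :: t

/-- `a` is followed by `b` in the cyclic list. -/
def CycFollows (l : List α) (a b : α) : Prop := (l ++ l.take 1).Follows a b

theorem follows_append {l₁ l₂ : List α} {a b : α} : (l₁ ++ l₂).Follows a b ↔
    l₁.Follows a b ∨ l₂.Follows a b ∨ ((∃ s, l₁ = s ++ [a]) ∧ ∃ t, l₂ = b :: t) := by
  constructor
  · rintro ⟨s, t, h⟩
    rcases List.append_eq_append_iff.1 h with ⟨m, hs, h2⟩ | ⟨m, hs, h2⟩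
    · exact Or.inr (Or.inl ⟨m, t, h2⟩)
    · match m, h2 with
      | [], h2 => exact Or.inr (Or.inl ⟨[], t, by simpa using h2.symm⟩)
      | [c], h2 =>
        simp only [cons_append, nil_append, cons.injEq] at h2
        exact Or.inr (Or.inr ⟨⟨s, by rw [hs, ← h2.1]⟩, t, h2.2.symm⟩)
      | c :: d :: m, h2 =>
        simp only [cons_append, cons.injEq] at h2
        exact Or.inl ⟨s, m, by rw [hs, ← h2.1, ← h2.2.1]⟩
  · rintro (⟨s, t, rfl⟩ | ⟨s, t, rfl⟩ | ⟨⟨s, rfl⟩, t, rfl⟩)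
    · exact ⟨s, t ++ l₂, by simp⟩
    · exact ⟨l₁ ++ s, t, by simp⟩
    · exact ⟨s, t, by simp⟩

theorem not_follows_nil {a b : α} : ¬ ([] : List α).Follows a b := by
  rintro ⟨s, t, h⟩; simp at h

theorem not_follows_singleton {a b c : α} : ¬ [c].Follows a b := by
  rintro ⟨s, t, h⟩
  have := congrArg List.length h
  simp only [length_append, length_cons, length_nil] at this
  omega

theorem follows_iff_getElem? {l : List α} {a b : α} :
    l.Follows a b ↔ ∃ k, l[k]? = some a ∧ l[k + 1]? = some b := by
  constructor
  · rintro ⟨s, t, rfl⟩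
    exact ⟨s.length, by simp, by simp⟩
  · rintro ⟨k, h1, h2⟩
    obtain ⟨h1', rfl⟩ := List.getElem?_eq_some_iff.1 h1
    obtain ⟨h2', rfl⟩ := List.getElem?_eq_some_iff.1 h2
    refine ⟨l.take k, l.drop (k + 2), ?_⟩
    rw [← List.drop_eq_getElem_cons, ← List.drop_eq_getElem_cons, List.take_append_drop]

theorem cycFollows_iff_getElem? {l : List α} {a b : α} :
    l.CycFollows a b ↔ ∃ k, l[k]? = some a ∧ l[(k + 1) % l.length]? = some b := by
  rw [CycFollows, follows_iff_getElem?]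
  cases l with
  | nil => simp
  | cons c l =>
    have hlen : (c :: l).length = l.length + 1 := rfl
    refine exists_congr fun k => ?_
    rcases lt_trichotomy k l.length with hk | hk | hk
    · rw [Nat.mod_eq_of_lt (by simpa using hk)]
      rw [List.getElem?_append_left (by simp; omega), List.getElem?_append_left (by simp; omega)]
    · subst hk
      rw [List.getElem?_append_left (by simp), List.getElem?_append_right (by simp)]
      simp
    · have h1 : (c :: l)[k]? = none := by simp; omega
      have h2 : (c :: l ++ take 1 (c :: l))[k + 1]? = none := by simp; omega
      rw [h1, h2]; simp

/-- Face cycles matter only up to rotation, so the outer cycle may be started at the place where a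
diagram is modified. -/
theorem cycFollows_rotated {l l' : List α} (h : l ~r l') {a b : α} (hl : l.CycFollows a b) :
    l'.CycFollows a b := by
  rw [cycFollows_iff_getElem?] at hl ⊢
  obtain ⟨n, rfl⟩ := h
  obtain ⟨k, h1, h2⟩ := hl
  have hk : k < l.length := (List.getElem?_eq_some_iff.1 h1).1
  have hpos : 0 < l.length := by omega
  have hn : n % l.length < l.length := Nat.mod_lt _ hpos
  -- Rotation moves entries back by `n`. The complementary forward shift, modulo the length, avoids
  -- truncated subtraction.
  have key : ∀ j, l[j % l.length]? = (l.rotate n)[(j + (l.length - n % l.length)) % l.length]? := by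
    intro j
    rw [List.getElem?_rotate (Nat.mod_lt _ hpos)]
    congr 1
    rw [Nat.mod_add_mod]
    have := Nat.mod_add_div n l.length
    rw [show j + (l.length - n % l.length) + n = j + l.length * (n / l.length + 1) by
      rw [Nat.mul_add]; omega, Nat.add_mul_mod_self_left]
  refine ⟨(k + (l.length - n % l.length)) % l.length, ?_, ?_⟩
  · rw [← key, Nat.mod_eq_of_lt hk, h1]
  · rw [List.length_rotate, Nat.mod_add_mod, Nat.add_right_comm, ← key, h2]

theorem Follows.map {l : List α} {a b : α} (h : l.Follows a b) (f : α → β) :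
    (l.map f).Follows (f a) (f b) := by
  obtain ⟨s, t, rfl⟩ := h
  exact ⟨s.map f, t.map f, by simp⟩

theorem CycFollows.map {l : List α} {a b : α} (h : l.CycFollows a b) (f : α → β) :
    (l.map f).CycFollows (f a) (f b) := by
  have := Follows.map h f
  rwa [List.map_append, List.map_take] at this

theorem Follows.cycFollows_cons {a b : α} {l : List α} (h : l.Follows a b) (c : α) :
    (c :: l).CycFollows a b := by
  obtain ⟨s, t, rfl⟩ := h
  exact ⟨c :: s, t ++ [c], by simp⟩

theorem cycFollows_cons_cons (c b : α) (l : List α) : (c :: b :: l).CycFollows c b :=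
  ⟨[], l ++ [c], by simp⟩

theorem cycFollows_cons_concat (c a : α) (l : List α) : (c :: (l ++ [a])).CycFollows a c :=
  ⟨c :: l, [], by simp⟩

theorem cycFollows_singleton (c : α) : [c].CycFollows c c := ⟨[], [], by simp⟩

/-- A cyclic pair lies inside one half or at one of the two junctions. If one half is empty, the two
junctions collapse to the wrap-around of the other half, which is why the last two alternatives are
separate. -/
theorem cycFollows_append {a b : α} {l₁ l₂ : List α} (h : (l₁ ++ l₂).CycFollows a b) :
    l₁.Follows a b ∨ l₂.Follows a b ∨ ((∃ s, l₁ = s ++ [a]) ∧ ∃ t, l₂ = b :: t) ∨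
      ((∃ s, l₂ = s ++ [a]) ∧ ∃ t, l₁ = b :: t) ∨
      (l₁ = [] ∧ (∃ s, l₂ = s ++ [a]) ∧ ∃ t, l₂ = b :: t) ∨
      (l₂ = [] ∧ (∃ s, l₁ = s ++ [a]) ∧ ∃ t, l₁ = b :: t) := by
  rw [CycFollows, follows_append, follows_append] at h
  rcases h with (h | h | h) | h | ⟨⟨s, hs⟩, t, ht⟩
  · exact Or.inl h
  · exact Or.inr (Or.inl h)
  · exact Or.inr (Or.inr (Or.inl h))
  -- The wrap-around part has at most one entry, so it contains no pair.
  · exfalso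
    cases hl : l₁ ++ l₂ with
    | nil => rw [hl] at h; exact not_follows_nil h
    | cons c l => rw [hl] at h; exact not_follows_singleton h
  · rcases l₁ with _ | ⟨c, l₁⟩
    · rcases l₂ with _ | ⟨d, l₂⟩
      · simp at ht
      · simp only [nil_append, take_succ_cons, take_zero, cons.injEq] at ht hs
        exact Or.inr (Or.inr (Or.inr (Or.inr (Or.inl ⟨rfl, ⟨s, hs⟩, l₂, by rw [ht.1]⟩))))
    · simp only [cons_append, take_succ_cons, take_zero, cons.injEq] at ht
      rcases List.eq_nil_or_concat l₂ with rfl | ⟨l, x, rfl⟩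
      · simp only [append_nil] at hs
        exact Or.inr (Or.inr (Or.inr (Or.inr (Or.inr ⟨rfl, ⟨s, hs⟩, l₁, by rw [ht.1]⟩))))
      · have hx := congrArg getLast? hs
        simp only [concat_eq_append, ← append_assoc, getLast?_append, getLast?_singleton,
          Option.some_or, Option.some.injEq] at hx
        exact Or.inr (Or.inr (Or.inr (Or.inl ⟨⟨l, by simp [hx]⟩, l₁, by rw [ht.1]⟩)))

/-- Counting occurrences is additive under concatenation and blind to order, so the condition that
every directed edge has a unique face on its left becomes arithmetic when cycles are cut and
regrouped. -/
theorem existsUnique_getElem?_iff_sum_countP {ι : Type*} [Fintype ι] [DecidableEq α]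
    (L : ι → List α) (d : α) :
    (∃! c : ι × ℕ, (L c.1)[c.2]? = some d) ↔ ∑ i, (L i).countP (· = d) = 1 := by
  classical
  have hcount : ∀ l : List α, l.countP (· = d) = {k ∈ Finset.range l.length | l[k]? = some d}.card := by
    intro l
    induction l using List.reverseRecOn with
    | nil => simp
    | append_singleton l c ih =>
      have h1 : {k ∈ Finset.range l.length | (l ++ [c])[k]? = some d} =
          {k ∈ Finset.range l.length | l[k]? = some d} := by
        refine Finset.filter_congr fun k hk => ?_
        rw [List.getElem?_append_left (Finset.mem_range.1 hk)]
      rw [List.countP_append, ih, List.length_append, List.length_singleton, Finset.range_add_one,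
        Finset.filter_insert, h1]
      by_cases hc : c = d
      · simp [hc]
      · simp [hc]
  have hset : ∑ i, (L i).countP (· = d) =
      (Finset.univ.sigma fun i => {k ∈ Finset.range (L i).length | (L i)[k]? = some d}).card := by
    rw [Finset.card_sigma]
    exact Finset.sum_congr rfl fun i _ => hcount _
  have hmem : ∀ i k, (⟨i, k⟩ : Σ _ : ι, ℕ) ∈
      (Finset.univ.sigma fun i => {k ∈ Finset.range (L i).length | (L i)[k]? = some d}) ↔
      (L i)[k]? = some d := by
    intro i k
    simp only [Finset.mem_sigma, Finset.mem_univ, true_and, Finset.mem_filter, Finset.mem_range,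
      and_iff_right_iff_imp]
    intro h
    exact (List.getElem?_eq_some_iff.1 h).1
  rw [hset, Finset.card_eq_one]
  constructor
  · rintro ⟨⟨i, k⟩, h, huniq⟩
    refine ⟨⟨i, k⟩, Finset.ext ?_⟩
    rintro ⟨j, l⟩
    rw [hmem, Finset.mem_singleton]
    constructor
    · intro hj
      have := huniq (j, l) hj
      rw [Prod.mk.injEq] at this
      rw [this.1, this.2]
    · intro hj
      cases hj
      exact h
  · rintro ⟨⟨i, k⟩, h⟩
    refine ⟨(i, k), (hmem i k).1 (h ▸ Finset.mem_singleton_self _), ?_⟩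
    rintro ⟨j, l⟩ hj
    have := (hmem j l).2 hj
    rw [h, Finset.mem_singleton, Sigma.mk.inj_iff] at this
    rw [this.1, eq_of_heq this.2]

end List

/-! ## Edge paths -/

namespace OneComplex

variable {Y : OneComplex}

theorem isPath_append {u v : Y.V} {p q : List Y.D} :
    Y.IsPath u (p ++ q) v ↔ ∃ m, Y.IsPath u p m ∧ Y.IsPath m q v := by
  induction p generalizing u with
  | nil => simp [IsPath]
  | cons d p ih => simp [IsPath, ih, and_assoc]

theorem tgt_rev (d : Y.D) : Y.tgt (Y.rev d) = Y.src d := by rw [tgt, Y.rev_rev]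

theorem IsPath.reverse {u v : Y.V} {p : List Y.D} (h : Y.IsPath u p v) :
    Y.IsPath v (p.map Y.rev).reverse u := by
  induction p generalizing u with
  | nil => exact h.symm
  | cons d p ih =>
    rw [List.map_cons, List.reverse_cons, isPath_append]
    exact ⟨_, ih h.2, rfl, (tgt_rev d).trans h.1⟩

theorem IsPath.src_cons {u v : Y.V} {d : Y.D} {p : List Y.D} (h : Y.IsPath u (d :: p) v) :
    Y.src d = u := h.1

theorem IsPath.src_rev_concat {u v : Y.V} {d : Y.D} {p : List Y.D} (h : Y.IsPath u (p ++ [d]) v) :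
    Y.src (Y.rev d) = v := by
  obtain ⟨m, -, h⟩ := isPath_append.1 h
  exact h.2

theorem IsPath.unique {u v v' : Y.V} {p : List Y.D} (h : Y.IsPath u p v) (h' : Y.IsPath u p v') :
    v = v' := by
  induction p generalizing u with
  | nil => exact Eq.trans (Eq.symm h) h'
  | cons d p ih => exact ih h.2 h'.2

/-- The complex with vertices mapped by `i` and one new edge, with directed edges `inr true` from
`a` to `b` and `inr false` from `b` to `a`. -/
def addEdge (Y : OneComplex) {V' : Type*} (i : Y.V → V') (a b : V') : OneComplex where
  V := V'
  D := Y.D ⊕ Bool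
  src := Sum.elim (fun d => i (Y.src d)) fun t => bif t then a else b
  rev := Sum.map Y.rev not
  rev_rev d := by rcases d with d | t <;> simp [Y.rev_rev]
  rev_ne d h := by
    rcases d with d | t
    · exact Y.rev_ne d (Sum.inl_injective h)
    · exact Bool.not_ne_self t (Sum.inr_injective h)

section addEdge

variable {V' : Type*} (i : Y.V → V') (a b : V')

theorem IsPath.addEdge {u v : Y.V} {p : List Y.D} (h : Y.IsPath u p v) :
    (Y.addEdge i a b).IsPath (i u) (p.map Sum.inl) (i v) := by
  induction p generalizing u with
  | nil => exact congrArg i h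
  | cons d p ih => exact ⟨congrArg i h.1, ih h.2⟩

end addEdge

/-! ### Rotation around vertices after adding an edge -/

open Relation

/-- The chord splits a face with cycle `z y` into two faces with cycles `e z` and `e⁻¹ y`. The only
old corners that disappear are those at the junctions of `z` and `y`, and there the new edge is
inserted between the two neighbours. If `z` and `y` are both empty, there is no corner to receive
the new edge, so then there must be no old edges. -/
theorem rotation_addEdge_chord {a b : Y.V} {z y : List Y.D}
    (hz : Y.IsPath b z a) (hy : Y.IsPath a y b)
    {r : Y.D → Y.D → Prop} {r' : Y.D ⊕ Bool → Y.D ⊕ Bool → Prop}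
    (hrot : ∀ d d', Y.src d = Y.src d' → ReflTransGen r d d')
    (hr : ∀ d d', r d d' → (z ++ y).CycFollows (Y.rev d') d ∨ r' (.inl d) (.inl d'))
    (h1 : ∀ d d', (Sum.inr true :: z.map Sum.inl).CycFollows (Sum.map Y.rev not d') d → r' d d')
    (h2 : ∀ d d', (Sum.inr false :: y.map Sum.inl).CycFollows (Sum.map Y.rev not d') d → r' d d')
    (hne : z = [] → y = [] → IsEmpty Y.D) (d d' : Y.D ⊕ Bool)
    (hd : (Y.addEdge id a b).src d = (Y.addEdge id a b).src d') : ReflTransGen r' d d' := by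
  have out1 : ∀ s c, z = s ++ [c] → r' (.inr true) (.inl (Y.rev c)) := by
    rintro s c rfl
    apply h1
    simpa [Y.rev_rev] using List.cycFollows_cons_concat (Sum.inr true) (Sum.inl c)
      (s.map Sum.inl : List (Y.D ⊕ Bool))
  have in1 : ∀ t c, z = c :: t → r' (.inl c) (.inr false) := by
    rintro t c rfl
    exact h1 _ _ (List.cycFollows_cons_cons _ _ _)
  have nil1 : z = [] → r' (.inr true) (.inr false) := by
    rintro rfl
    exact h1 _ _ (List.cycFollows_singleton _)
  have out2 : ∀ s c, y = s ++ [c] → r' (.inr false) (.inl (Y.rev c)) := by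
    rintro s c rfl
    apply h2
    simpa [Y.rev_rev] using List.cycFollows_cons_concat (Sum.inr false) (Sum.inl c)
      (s.map Sum.inl : List (Y.D ⊕ Bool))
  have in2 : ∀ t c, y = c :: t → r' (.inl c) (.inr true) := by
    rintro t c rfl
    exact h2 _ _ (List.cycFollows_cons_cons _ _ _)
  have nil2 : y = [] → r' (.inr false) (.inr true) := by
    rintro rfl
    exact h2 _ _ (List.cycFollows_singleton _)
  -- An old step across a junction becomes a detour through an end of the new edge. If one half is
  -- empty, both ends sit in the same corner and the detour passes through both.
  have hstep : ∀ d d', r d d' → ReflTransGen r' (.inl d) (.inl d') := by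
    intro d d' hdd
    rcases hr d d' hdd with h | h
    · rcases List.cycFollows_append h with h | h | ⟨⟨s, hs⟩, t, ht⟩ | ⟨⟨s, hs⟩, t, ht⟩ |
        ⟨h0, ⟨s, hs⟩, t, ht⟩ | ⟨h0, ⟨s, hs⟩, t, ht⟩
      · exact .single (h1 _ _ ((h.map Sum.inl).cycFollows_cons _))
      · exact .single (h2 _ _ ((h.map Sum.inl).cycFollows_cons _))
      · refine .head (in2 _ _ ht) (.single ?_)
        simpa [Y.rev_rev] using out1 _ _ hs
      · refine .head (in1 _ _ ht) (.single ?_)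
        simpa [Y.rev_rev] using out2 _ _ hs
      · refine .head (in2 _ _ ht) (.head (nil1 h0) (.single ?_))
        simpa [Y.rev_rev] using out2 _ _ hs
      · refine .head (in1 _ _ ht) (.head (nil2 h0) (.single ?_))
        simpa [Y.rev_rev] using out1 _ _ hs
    · exact .single h
  have hold : ∀ d d', Y.src d = Y.src d' → ReflTransGen r' (.inl d) (.inl d') := by
    intro d d' h
    have H := hrot d d' h
    clear h
    induction H with
    | refl => exact .refl
    | tail _ h ih => exact ih.trans (hstep _ _ h)
  have toE : ∀ d, Y.src d = a → ReflTransGen r' (.inl d) (.inr true) := by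
    intro d hd
    rcases y with _ | ⟨c, t⟩
    · rcases z with _ | ⟨c, t⟩
      · exact ((hne rfl rfl).false d).elim
      · exact (hold d c (hd.trans (hy.trans hz.src_cons.symm))).trans
          (.head (in1 _ _ rfl) (.single (nil2 rfl)))
    · exact (hold d c (hd.trans hy.src_cons.symm)).trans (.single (in2 _ _ rfl))
  have fromE : ∀ d, Y.src d = a → ReflTransGen r' (.inr true) (.inl d) := by
    intro d hd
    rcases z.eq_nil_or_concat' with rfl | ⟨s, c, rfl⟩
    · rcases y.eq_nil_or_concat' with rfl | ⟨s, c, rfl⟩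
      · exact ((hne rfl rfl).false d).elim
      · refine .head (nil1 rfl) (.head (out2 _ _ rfl) (hold _ d ?_))
        exact hy.src_rev_concat.trans (Eq.trans hz hd.symm)
    · exact .head (out1 _ _ rfl) (hold _ d (hz.src_rev_concat.trans hd.symm))
  have toF : ∀ d, Y.src d = b → ReflTransGen r' (.inl d) (.inr false) := by
    intro d hd
    rcases z with _ | ⟨c, t⟩
    · rcases y with _ | ⟨c, t⟩
      · exact ((hne rfl rfl).false d).elim
      · exact (hold d c (hd.trans (hz.trans hy.src_cons.symm))).trans
          (.head (in2 _ _ rfl) (.single (nil1 rfl)))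
    · exact (hold d c (hd.trans hz.src_cons.symm)).trans (.single (in1 _ _ rfl))
  have fromF : ∀ d, Y.src d = b → ReflTransGen r' (.inr false) (.inl d) := by
    intro d hd
    rcases y.eq_nil_or_concat' with rfl | ⟨s, c, rfl⟩
    · rcases z.eq_nil_or_concat' with rfl | ⟨s, c, rfl⟩
      · exact ((hne rfl rfl).false d).elim
      · refine .head (nil2 rfl) (.head (out1 _ _ rfl) (hold _ d ?_))
        exact hz.src_rev_concat.trans (Eq.trans hy hd.symm)
    · exact .head (out2 _ _ rfl) (hold _ d (hy.src_rev_concat.trans hd.symm))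
  -- The two ends of the chord share a vertex only if the chord is a loop.
  have hEF : a = b → ReflTransGen r' (.inr true) (.inr false) := by
    intro hab
    rcases z with _ | ⟨c, t⟩
    · exact .single (nil1 rfl)
    · exact (fromE c (hz.src_cons.trans hab.symm)).trans (toF c hz.src_cons)
  have hFE : a = b → ReflTransGen r' (.inr false) (.inr true) := by
    intro hab
    rcases y with _ | ⟨c, t⟩
    · exact .single (nil2 rfl)
    · exact (fromF c (hy.src_cons.trans hab)).trans (toE c hy.src_cons)
  rcases d with d | _ | _ <;> rcases d' with d' | _ | _
  · exact hold d d' hd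
  · exact toF d hd
  · exact toE d hd
  · exact fromF d' hd.symm
  · exact .refl
  · exact hFE hd.symm
  · exact fromE d' hd.symm
  · exact hEF hd
  · exact .refl

/-- A spur inserts `e e⁻¹` into one face cycle. At `a` the corner between the last and the first
edge of `y` is split by `e`; at the new vertex `e⁻¹` is alone. -/
theorem rotation_addEdge_spur {a : Y.V} {y : List Y.D} (hy : Y.IsPath a y a)
    {r : Y.D → Y.D → Prop} {r' : Y.D ⊕ Bool → Y.D ⊕ Bool → Prop}
    (hrot : ∀ d d', Y.src d = Y.src d' → ReflTransGen r d d')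
    (hr : ∀ d d', r d d' → y.CycFollows (Y.rev d') d ∨ r' (.inl d) (.inl d'))
    (h1 : ∀ d d', (Sum.inr true :: Sum.inr false :: y.map Sum.inl).CycFollows
      (Sum.map Y.rev not d') d → r' d d')
    (hne : y = [] → IsEmpty Y.D) (d d' : Y.D ⊕ Bool)
    (hd : (Y.addEdge some (some a) none).src d = (Y.addEdge some (some a) none).src d') :
    ReflTransGen r' d d' := by
  have out1 : ∀ s c, y = s ++ [c] → r' (.inr true) (.inl (Y.rev c)) := by
    rintro s c rfl
    apply h1
    simpa [Y.rev_rev] using List.cycFollows_cons_concat (Sum.inr true) (Sum.inl c)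
      (Sum.inr false :: s.map Sum.inl : List (Y.D ⊕ Bool))
  have in1 : ∀ t c, y = c :: t → r' (.inl c) (.inr true) := by
    rintro t c rfl
    refine h1 _ _ (List.Follows.cycFollows_cons ⟨[], t.map Sum.inl, rfl⟩ _)
  have hstep : ∀ d d', r d d' → ReflTransGen r' (.inl d) (.inl d') := by
    intro d d' hdd
    rcases hr d d' hdd with h | h
    · rcases List.cycFollows_append (l₁ := []) h with h | h | ⟨⟨s, hs⟩, t, ht⟩ |
        ⟨⟨s, hs⟩, t, ht⟩ | ⟨h0, ⟨s, hs⟩, t, ht⟩ | ⟨h0, ⟨s, hs⟩, t, ht⟩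
      · exact (List.not_follows_nil h).elim
      · refine .single (h1 _ _ (List.Follows.cycFollows_cons ?_ _))
        obtain ⟨s, t, hst⟩ := h.map (Sum.inl : Y.D → Y.D ⊕ Bool)
        exact ⟨.inr false :: s, t, by rw [hst]; rfl⟩
      · simp at hs
      · simp at ht
      · refine .head (in1 _ _ ht) (.single ?_)
        simpa [Y.rev_rev] using out1 _ _ hs
      · simp at hs
    · exact .single h
  have hold : ∀ d d', Y.src d = Y.src d' → ReflTransGen r' (.inl d) (.inl d') := by
    intro d d' h
    have H := hrot d d' h
    clear h
    induction H with
    | refl => exact .refl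
    | tail _ h ih => exact ih.trans (hstep _ _ h)
  have toE : ∀ d, Y.src d = a → ReflTransGen r' (.inl d) (.inr true) := by
    intro d hd
    rcases y with _ | ⟨c, t⟩
    · exact ((hne rfl).false d).elim
    · exact (hold d c (hd.trans hy.src_cons.symm)).trans (.single (in1 _ _ rfl))
  have fromE : ∀ d, Y.src d = a → ReflTransGen r' (.inr true) (.inl d) := by
    intro d hd
    rcases y.eq_nil_or_concat' with rfl | ⟨s, c, rfl⟩
    · exact ((hne rfl).false d).elim
    · exact .head (out1 _ _ rfl) (hold _ d (hy.src_rev_concat.trans hd.symm))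
  rcases d with d | _ | _ <;> rcases d' with d' | _ | _
  · exact hold d d' (Option.some_injective _ hd)
  · exact (Option.some_ne_none _ hd).elim
  · exact toE d (Option.some_injective _ hd)
  · exact (Option.some_ne_none _ hd.symm).elim
  · exact .refl
  · exact (Option.some_ne_none _ hd.symm).elim
  · exact fromE d' (Option.some_injective _ hd.symm)
  · exact (Option.some_ne_none _ hd).elim
  · exact .refl

end OneComplex

/-! ## Enlarging van Kampen diagrams -/

namespace TwoComplex

/-- The complex with a new edge from `a` to `b`, and a new face bounded by this edge and the path `z`
from `a` to `b`. -/
def chord (Y : TwoComplex) {a b : Y.V} {z : List Y.D} (hz : Y.IsPath a z b) : TwoComplex where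
  toOneComplex := Y.toOneComplex.addEdge id a b
  F := Option Y.F
  bd f := f.elim (Sum.inr true :: (z.map Y.rev).reverse.map Sum.inl) fun f => (Y.bd f).map Sum.inl
  bd_ne_nil f := by
    cases f with
    | none => exact List.cons_ne_nil _ _
    | some f => exact fun h => Y.bd_ne_nil f (List.map_eq_nil_iff.1 h)
  bd_closed f := by
    cases f with
    | none => exact ⟨a, rfl, hz.reverse.addEdge id a b⟩
    | some f =>
      obtain ⟨u, hu⟩ := Y.bd_closed f
      exact ⟨u, hu.addEdge id a b⟩

/-- The complex with a new vertex and a new edge from `a` to it. -/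
def spur (Y : TwoComplex) (a : Y.V) : TwoComplex where
  toOneComplex := Y.toOneComplex.addEdge some (some a) none
  F := Y.F
  bd f := (Y.bd f).map Sum.inl
  bd_ne_nil f h := Y.bd_ne_nil f (List.map_eq_nil_iff.1 h)
  bd_closed f := by
    obtain ⟨u, hu⟩ := Y.bd_closed f
    exact ⟨some u, hu.addEdge some (some a) none⟩

end TwoComplex

theorem revPath_sum_chord {D : Type*} (rev : D → D) (x q : List D) :
    ((x.map Sum.inl ++ (Sum.inr true :: q.map Sum.inl)).map (Sum.map rev not)).reverse =
      (q.map rev).reverse.map Sum.inl ++ (Sum.inr false :: (x.map rev).reverse.map Sum.inl) := by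
  simp [List.map_reverse, Function.comp_def]

theorem revPath_sum_spur {D : Type*} (rev : D → D) (x q : List D) :
    ((x.map Sum.inl ++ (Sum.inr true :: Sum.inr false :: q.map Sum.inl)).map
      (Sum.map rev not)).reverse = (q.map rev).reverse.map Sum.inl ++
        (Sum.inr true :: Sum.inr false :: (x.map rev).reverse.map Sum.inl) := by
  simp [List.map_reverse, Function.comp_def]

theorem countP_map_inl_inl {D : Type*} [DecidableEq D] (d : D) (l : List D) :
    (l.map (Sum.inl : D → D ⊕ Bool)).countP (· = Sum.inl d) = l.countP (· = d) := by
  simp [List.countP_map, Function.comp_def]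

theorem countP_map_inl_inr {D : Type*} [DecidableEq D] (t : Bool) (l : List D) :
    (l.map (Sum.inl : D → D ⊕ Bool)).countP (· = Sum.inr t) = 0 := by
  simp [List.countP_map, Function.comp_def]

namespace SymmetricPresentation.VanKampenDiagram

variable {A : Type*} {G : Type*} [Group G] {P : SymmetricPresentation A G} {w : List A}
  (Δ : P.VanKampenDiagram w)

theorem exists_cycFollows_iff {ι D : Type*} (L : ι → List D) (a b : D) :
    (∃ f k, (L f)[k]? = some a ∧ (L f)[(k + 1) % (L f).length]? = some b) ↔
      ∃ f, (L f).CycFollows a b := by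
  simp only [List.cycFollows_iff_getElem?]

theorem label_revPath (p : List Δ.D) :
    ((p.map Δ.rev).reverse).map Δ.label = P.wordInv (p.map Δ.label) := by
  simp [SymmetricAlphabet.wordInv, List.map_reverse, Function.comp_def, Δ.label_rev]

/-- The diagram for `x a q` obtained from a diagram for `x z q` by gluing a face with boundary label
`a z⁻¹` along `z`. -/
def chord {u v : Δ.V} {x z q : List Δ.D} (hb : Δ.bdry = x ++ (z ++ q))
    (hx : Δ.IsPath Δ.base x u) (hz : Δ.IsPath u z v) (hq : Δ.IsPath v q Δ.base) (a : A)
    (ha : a :: P.wordInv (z.map Δ.label) ∈ P.relators) (hne : Δ.bdry = [] → IsEmpty Δ.D) :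
    P.VanKampenDiagram (x.map Δ.label ++ (a :: q.map Δ.label)) where
  toTwoComplex := Δ.toTwoComplex.chord hz
  finite_V := Δ.finite_V
  finite_D := by
    have := Δ.finite_D
    exact inferInstanceAs (Finite (Δ.D ⊕ Bool))
  finite_F := by
    have := Δ.finite_F
    exact inferInstanceAs (Finite (Option Δ.F))
  base := Δ.base
  connected w := by
    obtain ⟨p, hp⟩ := Δ.connected w
    exact ⟨_, hp.addEdge id u v⟩
  label := Sum.elim Δ.label fun t => bif t then a else P.inv a
  label_rev d := by
    rcases d with d | _ | _
    · exact Δ.label_rev d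
    · exact (P.inv_inv a).symm
    · rfl
  label_bd f := by
    cases f with
    | none =>
      change List.map _ (Sum.inr true :: (z.map Δ.rev).reverse.map Sum.inl) ∈ _
      rw [List.map_cons, List.map_map]
      change a :: ((z.map Δ.rev).reverse).map Δ.label ∈ _
      rwa [label_revPath]
    | some f =>
      change List.map _ ((Δ.bd f).map Sum.inl) ∈ _
      rw [List.map_map]
      exact Δ.label_bd f
  bdry := x.map Sum.inl ++ (Sum.inr true :: q.map Sum.inl)
  bdry_closed := OneComplex.isPath_append.2
    ⟨u, hx.addEdge id u v, rfl, hq.addEdge id u v⟩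
  label_bdry := by
    refine List.map_append.trans (congrArg₂ _ List.map_map (congrArg (a :: ·) List.map_map))
  left_face := by
    classical
    have := Δ.finite_F
    have := Fintype.ofFinite Δ.F
    intro (d : Δ.D ⊕ Bool)
    refine (List.existsUnique_getElem?_iff_sum_countP (α := Δ.D ⊕ Bool)
      (ι := Option (Option Δ.F)) _ d).2 ?_
    have hold : ∀ d, ∑ c : Option Δ.F, (Δ.faceCycle Δ.bdry c).countP (· = d) = 1 := fun d =>
      (List.existsUnique_getElem?_iff_sum_countP _ d).1 (Δ.left_face d)
    rw [Fintype.sum_option, Fintype.sum_option]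
    suffices H : List.countP (α := Δ.D ⊕ Bool) (· = d) ((List.map (Sum.map Δ.rev not)
        (x.map Sum.inl ++ (Sum.inr true :: q.map Sum.inl))).reverse) +
      (List.countP (α := Δ.D ⊕ Bool) (· = d) (Sum.inr true :: (z.map Δ.rev).reverse.map Sum.inl) +
        ∑ f : Δ.F, List.countP (α := Δ.D ⊕ Bool) (· = d) ((Δ.bd f).map Sum.inl)) = 1 from H
    rw [revPath_sum_chord]
    rcases d with d | t
    · have h1 := hold d
      rw [Fintype.sum_option] at h1
      -- The part `z⁻¹` of the outer cycle moves to the new face, so the total count of each old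
      -- edge stays the same.
      simp only [TwoComplex.faceCycle, hb, List.map_append, List.reverse_append,
        List.countP_append] at h1
      simp only [List.countP_append, countP_map_inl_inl, List.countP_cons, reduceCtorEq,
        decide_false, Bool.false_eq_true, if_false]
      omega
    · simp only [List.countP_append, countP_map_inl_inr, List.countP_cons]
      cases t <;> simp
  rotation d d' hd := by
    simp only [exists_cycFollows_iff]
    have hold := Δ.rotation
    simp only [exists_cycFollows_iff] at hold
    -- Started at the modified place, the old outer cycle is `z⁻¹` followed by `x⁻¹ q⁻¹`, and the
    -- new one is the reversed chord followed by `x⁻¹ q⁻¹`.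
    have houter : ((x.map Sum.inl ++ (Sum.inr true :: q.map Sum.inl)).map
        (Sum.map Δ.rev not)).reverse ~r Sum.inr false ::
          ((x.map Δ.rev).reverse ++ (q.map Δ.rev).reverse).map Sum.inl := by
      rw [revPath_sum_chord, List.map_append]
      exact List.isRotated_append
    have houter' : ((Δ.bdry.map Δ.rev).reverse) ~r (z.map Δ.rev).reverse ++
        ((x.map Δ.rev).reverse ++ (q.map Δ.rev).reverse) := by
      rw [hb, List.map_append, List.map_append, List.reverse_append, List.reverse_append,
        List.append_assoc, ← List.append_assoc (List.map Δ.rev z).reverse]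
      exact List.isRotated_append
    refine OneComplex.rotation_addEdge_chord hz.reverse
      (OneComplex.isPath_append.2 ⟨_, hx.reverse, hq.reverse⟩) hold ?_ ?_ ?_ ?_ d d' hd
    · rintro d d' ⟨f, hf⟩
      cases f with
      | none => exact Or.inl (List.cycFollows_rotated houter' hf)
      | some f => exact Or.inr ⟨some (some f), hf.map Sum.inl⟩
    · intro d d' h
      exact ⟨some none, h⟩
    · intro d d' h
      exact ⟨none, List.cycFollows_rotated houter.symm h⟩
    · intro h1 h2
      refine hne ?_
      simp_all
  euler := by
    have := Δ.finite_F
    have := Δ.finite_D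
    have h := Δ.euler
    -- One more edge, counted as two directed edges, is balanced by one more face.
    change (Nat.card Δ.V : ℤ) - (Nat.card (Δ.D ⊕ Bool) : ℤ) / 2 +
      Nat.card (Option (Option Δ.F)) = 2
    rw [Finite.card_option, Finite.card_option] at *
    rw [Nat.card_sum, Nat.card_eq_fintype_card (α := Bool), Fintype.card_bool]
    push_cast at h ⊢
    omega

/-- The diagram for `x a a⁻¹ q` obtained from a diagram for `x q` by adding an edge. -/
def spur {u : Δ.V} {x q : List Δ.D} (hb : Δ.bdry = x ++ q)
    (hx : Δ.IsPath Δ.base x u) (hq : Δ.IsPath u q Δ.base) (a : A)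
    (hne : Δ.bdry = [] → IsEmpty Δ.D) :
    P.VanKampenDiagram (x.map Δ.label ++ (a :: P.inv a :: q.map Δ.label)) where
  toTwoComplex := Δ.toTwoComplex.spur u
  finite_V := by
    have := Δ.finite_V
    exact inferInstanceAs (Finite (Option Δ.V))
  finite_D := by
    have := Δ.finite_D
    exact inferInstanceAs (Finite (Δ.D ⊕ Bool))
  finite_F := Δ.finite_F
  base := some Δ.base
  connected w := by
    cases w with
    | none =>
      exact ⟨x.map Sum.inl ++ [Sum.inr true], OneComplex.isPath_append.2
        ⟨some u, hx.addEdge some (some u) none,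
          (⟨rfl, rfl⟩ : (Δ.addEdge some (some u) none).IsPath (some u) [Sum.inr true] none)⟩⟩
    | some w =>
      obtain ⟨p, hp⟩ := Δ.connected w
      exact ⟨_, hp.addEdge some (some u) none⟩
  label := Sum.elim Δ.label fun t => bif t then a else P.inv a
  label_rev d := by
    rcases d with d | _ | _
    · exact Δ.label_rev d
    · exact (P.inv_inv a).symm
    · rfl
  label_bd f := by
    change List.map _ ((Δ.bd f).map Sum.inl) ∈ _
    rw [List.map_map]
    exact Δ.label_bd f
  bdry := x.map Sum.inl ++ (Sum.inr true :: Sum.inr false :: q.map Sum.inl)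
  bdry_closed := OneComplex.isPath_append.2
    ⟨some u, hx.addEdge some (some u) none, rfl, rfl, hq.addEdge some (some u) none⟩
  label_bdry := by
    refine List.map_append.trans
      (congrArg₂ _ List.map_map (congrArg (a :: P.inv a :: ·) List.map_map))
  left_face := by
    classical
    have := Δ.finite_F
    have := Fintype.ofFinite Δ.F
    intro (d : Δ.D ⊕ Bool)
    refine (List.existsUnique_getElem?_iff_sum_countP (α := Δ.D ⊕ Bool)
      (ι := Option Δ.F) _ d).2 ?_
    have hold : ∀ d, ∑ c : Option Δ.F, (Δ.faceCycle Δ.bdry c).countP (· = d) = 1 := fun d =>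
      (List.existsUnique_getElem?_iff_sum_countP _ d).1 (Δ.left_face d)
    rw [Fintype.sum_option]
    suffices H : List.countP (α := Δ.D ⊕ Bool) (· = d) ((List.map (Sum.map Δ.rev not)
        (x.map Sum.inl ++ (Sum.inr true :: Sum.inr false :: q.map Sum.inl))).reverse) +
        ∑ f : Δ.F, List.countP (α := Δ.D ⊕ Bool) (· = d) ((Δ.bd f).map Sum.inl) = 1 from H
    rw [revPath_sum_spur]
    rcases d with d | t
    · have h1 := hold d
      rw [Fintype.sum_option] at h1
      simp only [TwoComplex.faceCycle, hb, List.map_append, List.reverse_append,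
        List.countP_append] at h1
      simp only [List.countP_append, countP_map_inl_inl, List.countP_cons, reduceCtorEq,
        decide_false, Bool.false_eq_true, if_false]
      omega
    · simp only [List.countP_append, countP_map_inl_inr, List.countP_cons]
      cases t <;> simp
  rotation d d' hd := by
    simp only [exists_cycFollows_iff]
    have hold := Δ.rotation
    simp only [exists_cycFollows_iff] at hold
    have houter : ((x.map Sum.inl ++ (Sum.inr true :: Sum.inr false :: q.map Sum.inl)).map
        (Sum.map Δ.rev not)).reverse ~r Sum.inr true :: Sum.inr false ::
          ((x.map Δ.rev).reverse ++ (q.map Δ.rev).reverse).map Sum.inl := by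
      rw [revPath_sum_spur, List.map_append]
      exact List.isRotated_append
    have houter' : ((Δ.bdry.map Δ.rev).reverse) ~r
        ((x.map Δ.rev).reverse ++ (q.map Δ.rev).reverse) := by
      rw [hb, List.map_append, List.reverse_append]
      exact List.isRotated_append
    refine OneComplex.rotation_addEdge_spur
      (OneComplex.isPath_append.2 ⟨_, hx.reverse, hq.reverse⟩) hold ?_ ?_ ?_ d d' hd
    · rintro d d' ⟨f, hf⟩
      cases f with
      | none => exact Or.inl (List.cycFollows_rotated houter' hf)
      | some f => exact Or.inr ⟨some f, hf.map Sum.inl⟩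
    · intro d d' h
      exact ⟨none, List.cycFollows_rotated houter.symm h⟩
    · intro h
      refine hne ?_
      simp_all
  euler := by
    have := Δ.finite_V
    have := Δ.finite_D
    have h := Δ.euler
    -- Here the new edge is balanced by the new vertex.
    change (Nat.card (Option Δ.V) : ℤ) - (Nat.card (Δ.D ⊕ Bool) : ℤ) / 2 +
      Nat.card (Option Δ.F) = 2
    rw [Finite.card_option (α := Δ.V)]
    rw [Nat.card_sum, Nat.card_eq_fintype_card (α := Bool), Fintype.card_bool]
    push_cast at h ⊢
    omega

/-- The diagram for the empty word. -/
def trivial (P : SymmetricPresentation A G) : P.VanKampenDiagram [] where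
  V := Unit
  D := Empty
  F := Empty
  src := Empty.elim
  rev := Empty.elim
  rev_rev := Empty.rec
  rev_ne := Empty.rec
  bd := Empty.elim
  bd_ne_nil := Empty.rec
  bd_closed := Empty.rec
  finite_V := inferInstance
  finite_D := inferInstance
  finite_F := inferInstance
  base := ()
  connected _ := ⟨[], rfl⟩
  label := Empty.elim
  label_rev := Empty.rec
  label_bd := Empty.rec
  bdry := []
  bdry_closed := rfl
  label_bdry := rfl
  left_face := Empty.rec
  rotation := Empty.rec
  euler := by simp

end SymmetricPresentation.VanKampenDiagram

/-! ## Moore paths -/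

/-- A path with parameter interval `[0, len]`. -/
@[ext]
structure MoorePath (X : Type*) where
  len : ℝ
  toFun : ℝ → X

namespace MoorePath

variable {X T T' α : Type*} [Preorder α]

/-- The path `p` followed by the restriction of `g` to `[0, l]`. -/
noncomputable def extend (p : MoorePath X) (g : ℝ → X) (l : ℝ) : MoorePath X where
  len := p.len + l
  toFun x := if x ≤ p.len then p.toFun x else g (min (x - p.len) l)

/-- `p` is a path from `x₀` to `x` along which `w` does not decrease. -/
structure IsMonoPath (w : X → α) (x₀ x : X) (p : MoorePath X) : Prop where
  len_nonneg : 0 ≤ p.len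
  start : p.toFun 0 = x₀
  after : ∀ s, p.len ≤ s → p.toFun s = x
  mono : ∀ s t, 0 ≤ s → s ≤ t → w (p.toFun s) ≤ w (p.toFun t)

theorem IsMonoPath.extend {w : X → α} {x₀ x : X} {p : MoorePath X} (hp : p.IsMonoPath w x₀ x)
    {g : ℝ → X} {l : ℝ} (hl : 0 ≤ l) (hg : g 0 = x)
    (hw : ∀ s t, 0 ≤ s → s ≤ t → t ≤ l → w (g s) ≤ w (g t)) :
    (p.extend g l).IsMonoPath w x₀ (g l) where
  len_nonneg := add_nonneg hp.len_nonneg hl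
  start := by simp [MoorePath.extend, hp.len_nonneg, hp.start]
  after s hs := by
    simp only [MoorePath.extend] at hs ⊢
    split_ifs with h
    · have : l = 0 := by linarith
      rw [this, hg, hp.after]
      linarith
    · rw [min_eq_right (by linarith)]
  mono s t hs hst := by
    simp only [MoorePath.extend]
    have h0 : ∀ u, 0 ≤ u → w (g 0) ≤ w (g (min u l)) := fun u hu =>
      hw _ _ le_rfl (le_min hu hl) (min_le_right _ _)
    split_ifs with h1 h2 h2
    · exact hp.mono s t hs hst
    · refine (hp.mono s p.len hs h1).trans ?_
      rw [hp.after _ le_rfl, ← hg]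
      exact h0 _ (by linarith)
    · linarith
    · exact hw _ _ (le_min (by linarith) hl) (min_le_min_right _ (by linarith)) (min_le_right _ _)

/-- This is the advantage of Moore paths: an extension of length zero leaves the path literally
unchanged. Families of detours that shrink to nothing therefore match exactly where they are glued,
without reparametrization. -/
theorem extend_zero {p : MoorePath X} {g : ℝ → X} (hp : ∀ s, p.len ≤ s → p.toFun s = g 0) :
    p.extend g 0 = p := by
  refine MoorePath.ext (add_zero _) (funext fun x => ?_)
  simp only [extend]
  split_ifs with h
  · rfl
  · rw [min_eq_right (by linarith), hp x (by linarith)]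

theorem IsMonoPath.extend_zero {w : X → α} {x₀ x : X} {p : MoorePath X}
    (hp : p.IsMonoPath w x₀ x) {g : ℝ → X} (hg : g 0 = x) : p.extend g 0 = p :=
  MoorePath.extend_zero fun s hs => (hp.after s hs).trans hg.symm

variable [TopologicalSpace X] [TopologicalSpace T] [TopologicalSpace T']

/-- A continuous family of Moore paths. -/
structure ContFamily (F : T → MoorePath X) : Prop where
  len : Continuous fun t => (F t).len
  toFun : Continuous fun q : T × ℝ => (F q.1).toFun q.2

theorem ContFamily.comp {F : T → MoorePath X} (hF : ContFamily F) {u : T' → T}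
    (hu : Continuous u) : ContFamily fun t => F (u t) where
  len := hF.len.comp hu
  toFun := hF.toFun.comp ((hu.comp continuous_fst).prodMk continuous_snd)

theorem ContFamily.extend {F : T → MoorePath X} (hF : ContFamily F) {G : T → ℝ → X} {l : T → ℝ}
    (hG : Continuous fun q : T × ℝ => G q.1 q.2) (hl : Continuous l) (hl0 : ∀ t, 0 ≤ l t)
    (h : ∀ t, (F t).toFun (F t).len = G t 0) :
    ContFamily fun t => (F t).extend (G t) (l t) where
  len := hF.len.add hl
  toFun := by
    have h1 : Continuous fun q : T × ℝ => (F q.1).len := hF.len.comp continuous_fst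
    have h2 : Continuous fun q : T × ℝ => G q.1 (min (q.2 - (F q.1).len) (l q.1)) :=
      hG.comp (continuous_fst.prodMk ((continuous_snd.sub h1).min (hl.comp continuous_fst)))
    refine Continuous.if_le hF.toFun h2 continuous_snd h1 ?_
    rintro ⟨t, s⟩ hs
    simp only at hs ⊢
    rw [hs, h, sub_self, min_eq_left (hl0 t)]

theorem ContFamily.const (p : MoorePath X) (hp : Continuous p.toFun) :
    ContFamily fun _ : T => p where
  len := continuous_const
  toFun := hp.comp continuous_snd

theorem ContFamily.glue {F F' : ℝ → MoorePath X} (hF : ContFamily F) (hF' : ContFamily F') (a : ℝ)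
    (h : F a = F' a) : ContFamily fun t => if t ≤ a then F t else F' t where
  len := by
    simp only [apply_ite MoorePath.len]
    exact Continuous.if_le hF.len hF'.len continuous_id continuous_const fun t ht => by
      rw [show t = a from ht, h]
  toFun := by
    have : ∀ q : ℝ × ℝ, (if q.1 ≤ a then F q.1 else F' q.1).toFun q.2 =
        if q.1 ≤ a then (F q.1).toFun q.2 else (F' q.1).toFun q.2 := fun q => by
      split_ifs <;> rfl
    simp only [this]
    exact Continuous.if_le hF.toFun hF'.toFun continuous_fst continuous_const fun t ht => by
      rw [show t.1 = a from ht, h]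

end MoorePath

/-! ## Functions on the cells, and points of a complex -/

namespace TwoComplex

variable {Y : TwoComplex} {β : Type*}

section cellFun

open Classical in
/-- The function on a closed edge with given values on its interior and on vertices. -/
noncomputable def closedEdgeFun (fV : Y.V → β) (fD : Y.D → β) (d : Y.D) (t : I) : β :=
  if t = 0 then fV (Y.src d) else if t = 1 then fV (Y.tgt d) else fD d

open Classical in
/-- The function with given values on open cells, before gluing. -/
noncomputable def preCellFun (fV : Y.V → β) (fD : Y.D → β) (fF : Y.F → β) : Y.PrePoint → β
  | .vert v => fV v
  | .edge d t => closedEdgeFun fV fD d t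
  | .face c t s => if s = 0 then closedEdgeFun fV fD c.dart t else fF c.1.1

theorem preCellFun_glue (fV : Y.V → β) {fD : Y.D → β} (fF : Y.F → β)
    (hD : ∀ d, fD (Y.rev d) = fD d) (a b : Y.PrePoint) (h : Y.Glue a b) :
    preCellFun fV fD fF a = preCellFun fV fD fF b := by
  have h10 : (1 : I) ≠ 0 := one_ne_zero
  cases h with
  | edge_src d => simp [preCellFun, closedEdgeFun]
  | edge_rev d t =>
    by_cases h0 : t = 0
    · subst h0
      simp [preCellFun, closedEdgeFun, OneComplex.tgt, Y.rev_rev]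
    · by_cases h1 : t = 1
      · subst h1
        simp [preCellFun, closedEdgeFun, OneComplex.tgt]
      · have h0' : unitInterval.symm t ≠ 0 := fun h => h1 (unitInterval.symm_eq_zero.1 h)
        have h1' : unitInterval.symm t ≠ 1 := fun h => h0 (unitInterval.symm_eq_one.1 h)
        simp only [preCellFun, closedEdgeFun, h0, h1, h0', h1', if_false, hD]
  | face_bd c t => simp [preCellFun]
  | face_side c s =>
    by_cases hs : s = 0
    · subst hs
      simp [preCellFun, closedEdgeFun, Side.src_next]
    · simp [preCellFun, hs, Side.next]
  | face_centre c c' t t' h => simp [preCellFun, h]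

/-- The function on the space with given values on open cells. -/
noncomputable def cellFun (fV : Y.V → β) (fD : Y.D → β) (fF : Y.F → β)
    (hD : ∀ d, fD (Y.rev d) = fD d) (x : Y.Space) : β :=
  Quot.lift (preCellFun fV fD fF) (preCellFun_glue fV fF hD) x

end cellFun

theorem continuous_edge (d : Y.D) : Continuous fun t : I => Y.pt (.edge d t) :=
  continuous_iff_coinduced_le.2 (le_sup_of_le_left (le_iSup (fun d : Y.D =>
    TopologicalSpace.coinduced (fun t : I => Y.pt (.edge d t)) inferInstance) d))

theorem continuous_face (c : Y.Side) : Continuous fun x : I × I => Y.pt (.face c x.1 x.2) :=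
  continuous_iff_coinduced_le.2 (le_sup_of_le_right (le_iSup (fun c : Y.Side =>
    TopologicalSpace.coinduced (fun x : I × I => Y.pt (.face c x.1 x.2)) inferInstance) c))

theorem isClosed_iff {s : Set Y.Space} : IsClosed s ↔
    (∀ d : Y.D, IsClosed {t : I | Y.pt (.edge d t) ∈ s}) ∧
      ∀ c : Y.Side, IsClosed {x : I × I | Y.pt (.face c x.1 x.2) ∈ s} := by
  constructor
  · exact fun h => ⟨fun d => h.preimage (continuous_edge d), fun c => h.preimage (continuous_face c)⟩
  · rintro ⟨h1, h2⟩
    rw [← isOpen_compl_iff]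
    exact ⟨isOpen_iSup_iff.2 fun d => isOpen_coinduced.2 (isOpen_compl_iff.2 (h1 d)),
      isOpen_iSup_iff.2 fun c => isOpen_coinduced.2 (isOpen_compl_iff.2 (h2 c))⟩

/-- The predicate that holds on vertices and edges, and on sectors exactly at height 0, respects the
gluing and so descends to the space. -/
theorem face_mem_skeleton1 {c : Y.Side} {t s : I} : Y.pt (.face c t s) ∈ Y.skeleton1 ↔ s = 0 := by
  constructor
  · let q : Y.PrePoint → Prop := fun
      | .face _ _ s => s = 0
      | _ => True
    have hq : ∀ a b, Y.Glue a b → q a = q b := by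
      intro a b h
      cases h <;> simp [q]
    have key : ∀ x : Y.Space, x ∈ Y.skeleton1 → Quot.lift q hq x := by
      rintro x (⟨v, rfl⟩ | ⟨⟨d, t⟩, rfl⟩) <;> trivial
    exact fun h => key _ h
  · rintro rfl
    exact Or.inr ⟨(c.dart, t), (Quot.sound (Glue.face_bd c t)).symm⟩

/-- A function is continuous on the 1-skeleton if it is so on each closed edge. -/
theorem continuousOn_skeleton1 {Z : Type*} [TopologicalSpace Z] {g : Y.Space → Z}
    (hg : ∀ d, Continuous fun t : I => g (Y.pt (.edge d t))) : ContinuousOn g Y.skeleton1 := by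
  rw [continuousOn_iff_isClosed]
  intro C hC
  -- This set is closed in the whole complex: its trace on a sector lies at height 0, where it is
  -- governed by the edge below.
  refine ⟨g ⁻¹' C ∩ Y.skeleton1, isClosed_iff.2 ⟨fun d => ?_, fun c => ?_⟩, by simp⟩
  · have : {t : I | Y.pt (.edge d t) ∈ g ⁻¹' C ∩ Y.skeleton1} =
        (fun t : I => g (Y.pt (.edge d t))) ⁻¹' C := by
      ext t
      exact and_iff_left (Or.inr ⟨(d, t), rfl⟩)
    rw [this]
    exact hC.preimage (hg d)
  · have : {x : I × I | Y.pt (.face c x.1 x.2) ∈ g ⁻¹' C ∩ Y.skeleton1} =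
        {x | g (Y.pt (.edge c.dart x.1)) ∈ C} ∩ {x | x.2 = 0} := by
      ext ⟨t, s⟩
      simp only [Set.mem_ofPred_eq, Set.mem_inter_iff, face_mem_skeleton1, Set.mem_preimage]
      refine and_congr_left ?_
      rintro rfl
      rw [show Y.pt (.face c t 0) = Y.pt (.edge c.dart t) from Quot.sound (Glue.face_bd c t)]
    rw [this]
    exact (hC.preimage ((hg c.dart).comp continuous_fst)).inter
      (isClosed_singleton.preimage continuous_snd)

/-- The clamped parametrization of a closed edge. -/
noncomputable def edgePt (Y : TwoComplex) (d : Y.D) (t : ℝ) : Y.Space :=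
  Y.pt (.edge d (Set.projIcc 0 1 zero_le_one t))

/-- The clamped parametrization of a sector of a closed polygon. -/
noncomputable def sectorPt (Y : TwoComplex) (c : Y.Side) (t s : ℝ) : Y.Space :=
  Y.pt (.face c (Set.projIcc 0 1 zero_le_one t) (Set.projIcc 0 1 zero_le_one s))

theorem continuous_edgePt (d : Y.D) : Continuous (Y.edgePt d) :=
  (continuous_edge d).comp continuous_projIcc

theorem continuous_sectorPt {T : Type*} [TopologicalSpace T] (c : Y.Side) {f g : T → ℝ}
    (hf : Continuous f) (hg : Continuous g) : Continuous fun t => Y.sectorPt c (f t) (g t) :=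
  have h : Continuous (Set.projIcc (0 : ℝ) 1 zero_le_one) := continuous_projIcc
  (continuous_face c).comp ((h.comp hf).prodMk (h.comp hg))

theorem edgePt_zero (d : Y.D) : Y.edgePt d 0 = Y.pt (.vert (Y.src d)) := by
  rw [edgePt, Set.projIcc_left]
  exact Quot.sound (Glue.edge_src d)

theorem edgePt_rev (d : Y.D) (t : ℝ) : Y.edgePt (Y.rev d) t = Y.edgePt d (1 - t) := by
  have h : Y.pt (.edge d (Set.projIcc 0 1 zero_le_one (1 - t))) = Y.pt (.edge (Y.rev d) _) :=
    Quot.sound (Glue.edge_rev d _)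
  rw [edgePt, edgePt, h, unitInterval.symm_projIcc, sub_sub_cancel]

theorem edgePt_one (d : Y.D) : Y.edgePt d 1 = Y.pt (.vert (Y.tgt d)) := by
  rw [OneComplex.tgt, ← edgePt_zero, edgePt_rev, sub_zero]

theorem edgePt_coe (d : Y.D) (t : I) : Y.edgePt d t = Y.pt (.edge d t) := by
  rw [edgePt, Set.projIcc_val]

theorem sectorPt_zero (c : Y.Side) (t : ℝ) : Y.sectorPt c t 0 = Y.edgePt c.dart t := by
  rw [sectorPt, Set.projIcc_left]
  exact Quot.sound (Glue.face_bd c _)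

theorem sectorPt_next (c : Y.Side) (s : ℝ) : Y.sectorPt c 1 s = Y.sectorPt c.next 0 s := by
  rw [sectorPt, sectorPt, Set.projIcc_left, Set.projIcc_right]
  exact Quot.sound (Glue.face_side c _)

theorem sectorPt_one (c c' : Y.Side) (h : c.1.1 = c'.1.1) (t t' : ℝ) :
    Y.sectorPt c t 1 = Y.sectorPt c' t' 1 := by
  rw [sectorPt, sectorPt, Set.projIcc_right]
  exact Quot.sound (Glue.face_centre c c' _ _ h)

end TwoComplex

/-! ## Combings of stacked complexes -/

namespace TwoComplex

open MoorePath

theorem Side.dart_zero {Y : TwoComplex} (c : Y.Side) {f : Y.F} {d : Y.D} {l : List Y.D}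
    (hf : Y.bd f = d :: l) (hc : c.1 = (f, 0)) : c.dart = d := by
  obtain ⟨c, hc'⟩ := c
  simp only at hc
  subst hc
  simp only [Side.dart, hf, List.getElem_cons_zero]

theorem Side.dart_succ {Y : TwoComplex} (c : Y.Side) {f : Y.F} {d : Y.D} {l : List Y.D}
    (hf : Y.bd f = d :: l) {k : ℕ} (hc : c.1 = (f, k + 1)) : c.dart ∈ l := by
  obtain ⟨c, hc'⟩ := c
  simp only at hc
  subst hc
  simp only [Side.dart, hf, List.getElem_cons_succ]
  exact List.getElem_mem _

/-- A spanning tree, given by paths from the base vertex, together with an orientation and a ranking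
of the edges, such that each positive directed edge outside the tree is the first edge of the
boundary path of a 2-cell whose other edges have lower rank. -/
structure Stacking (Y : TwoComplex) (y : Y.V) where
  path : Y.V → List Y.D
  pos : Y.D → Prop
  rank : Y.D → ℕ
  path_base : path y = []
  path_cases : ∀ v, v = y ∨ ∃ d, pos d ∧ Y.tgt d = v ∧ path v = path (Y.src d) ++ [d]
  pos_rev : ∀ d, pos (Y.rev d) ↔ ¬ pos d
  rank_rev : ∀ d, rank (Y.rev d) = rank d
  pos_cases : ∀ d, pos d → path (Y.tgt d) = path (Y.src d) ++ [d] ∨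
    ∃ f l, Y.bd f = d :: l ∧ ∀ c ∈ l, rank c < rank d
  head_pos : ∀ f d l, Y.bd f = d :: l → pos d

/-- Weights of the cells that decrease towards the base vertex along the spanning tree, and along
each 2-cell from its first edge to the other edges. -/
structure Stacking.IsWeight {Y : TwoComplex} {y : Y.V} (T : Y.Stacking y) {α : Type*} [Preorder α]
    (wV : Y.V → α) (wD : Y.D → α) (wF : Y.F → α) : Prop where
  rev : ∀ d, wD (Y.rev d) = wD d
  src_le : ∀ d, wV (Y.src d) ≤ wD d
  tree_le : ∀ d, T.pos d → T.path (Y.tgt d) = T.path (Y.src d) ++ [d] → wD d ≤ wV (Y.tgt d)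
  top_le : ∀ f d l, Y.bd f = d :: l → wF f ≤ wD d
  le_face : ∀ f, ∀ d ∈ Y.bd f, wD d ≤ wF f

namespace Stacking

variable {Y : TwoComplex} {y : Y.V} (T : Y.Stacking y) {α : Type*} [Preorder α]
  {wV : Y.V → α} {wD : Y.D → α} {wF : Y.F → α}

/-- The path in the spanning tree from the base vertex to a vertex. -/
noncomputable def vertPath (v : Y.V) : MoorePath Y.Space :=
  (T.path v).foldl (fun p d => p.extend (Y.edgePt d) 1) ⟨0, fun _ => Y.pt (.vert y)⟩

theorem vertPath_base : T.vertPath y = ⟨0, fun _ => Y.pt (.vert y)⟩ := by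
  rw [vertPath, T.path_base, List.foldl_nil]

theorem vertPath_tgt {d : Y.D} (h : T.path (Y.tgt d) = T.path (Y.src d) ++ [d]) :
    T.vertPath (Y.tgt d) = (T.vertPath (Y.src d)).extend (Y.edgePt d) 1 := by
  rw [vertPath, vertPath, h, List.foldl_append, List.foldl_cons, List.foldl_nil]

/-- Induction outwards along the tree, on the length of the tree path. -/
theorem induction_path {p : Y.V → Prop} (h0 : p y)
    (h1 : ∀ d, T.pos d → T.path (Y.tgt d) = T.path (Y.src d) ++ [d] → p (Y.src d) → p (Y.tgt d))
    (v : Y.V) : p v := by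
  induction hn : (T.path v).length generalizing v with
  | zero =>
    rcases T.path_cases v with rfl | ⟨d, -, -, hd⟩
    · exact h0
    · rw [hd] at hn; simp at hn
  | succ n ih =>
    rcases T.path_cases v with rfl | ⟨d, hpos, rfl, hd⟩
    · exact h0
    · refine h1 d hpos hd (ih _ ?_)
      rw [hd] at hn
      simpa using hn

theorem isPath_path (v : Y.V) : Y.IsPath y (T.path v) v := by
  induction v using T.induction_path with
  | h0 => rw [T.path_base]; rfl
  | h1 d hpos hd ih =>
    rw [hd, OneComplex.isPath_append]
    exact ⟨_, ih, rfl, rfl⟩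

theorem vertPath_mem_skeleton1 (v : Y.V) (s : ℝ) : (T.vertPath v).toFun s ∈ Y.skeleton1 := by
  induction v using T.induction_path generalizing s with
  | h0 => rw [T.vertPath_base]; exact Or.inl ⟨y, rfl⟩
  | h1 d hpos hd ih =>
    rw [T.vertPath_tgt hd]
    simp only [MoorePath.extend]
    split_ifs
    · exact ih s
    · exact Or.inr ⟨(d, _), rfl⟩

theorem continuous_vertPath (v : Y.V) : Continuous (T.vertPath v).toFun ∧
    ∀ s, (T.vertPath v).len ≤ s → (T.vertPath v).toFun s = Y.pt (.vert v) := by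
  induction v using T.induction_path with
  | h0 => rw [T.vertPath_base]; exact ⟨continuous_const, fun _ _ => rfl⟩
  | h1 d hpos hd ih =>
    rw [T.vertPath_tgt hd]
    refine ⟨?_, fun s hs => ?_⟩
    · have := (ContFamily.const (T := Unit) (T.vertPath (Y.src d)) ih.1).extend
        (G := fun _ => Y.edgePt d) (l := fun _ => 1) ((continuous_edgePt d).comp continuous_snd)
        continuous_const (fun _ => zero_le_one)
        (fun _ => (ih.2 _ le_rfl).trans (edgePt_zero d).symm)
      exact this.toFun.comp (Continuous.prodMk_right ())
    · simp only [MoorePath.extend] at hs ⊢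
      rw [if_neg (by linarith), min_eq_right (by linarith), edgePt_one]

/-! ### Weights along tree paths and radial segments -/

variable (hw : T.IsWeight wV wD wF)

/-- The weights of the points of the complex. -/
noncomputable abbrev IsWeight.fn {T : Y.Stacking y} (hw : T.IsWeight wV wD wF) : Y.Space → α :=
  cellFun wV wD wF hw.rev

namespace IsWeight

variable {T}

include hw

theorem tgt_le (d : Y.D) : wV (Y.tgt d) ≤ wD d := by
  rw [← hw.rev]
  exact hw.src_le (Y.rev d)

theorem fn_vert (v : Y.V) : hw.fn (Y.pt (.vert v)) = wV v := rfl

theorem fn_edgePt {t : ℝ} (h0 : 0 < t) (h1 : t < 1) (d : Y.D) : hw.fn (Y.edgePt d t) = wD d := by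
  have e : hw.fn (Y.edgePt d t) = closedEdgeFun wV wD d (Set.projIcc 0 1 zero_le_one t) := rfl
  rw [e, closedEdgeFun, Set.projIcc_of_mem zero_le_one ⟨h0.le, h1.le⟩, if_neg, if_neg]
  · exact fun h => h1.ne (congrArg Subtype.val h)
  · exact fun h => h0.ne' (congrArg Subtype.val h)

theorem fn_edgePt_le (d : Y.D) (t : ℝ) : hw.fn (Y.edgePt d t) ≤ wD d := by
  have e : hw.fn (Y.edgePt d t) = closedEdgeFun wV wD d (Set.projIcc 0 1 zero_le_one t) := rfl
  rw [e, closedEdgeFun]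
  split_ifs
  · exact hw.src_le d
  · exact hw.tgt_le d
  · exact le_rfl

theorem fn_sectorPt (c : Y.Side) (t : ℝ) {s : ℝ} (h0 : 0 < s) :
    hw.fn (Y.sectorPt c t s) = wF c.1.1 := by
  have e : hw.fn (Y.sectorPt c t s) = preCellFun wV wD wF
    (.face c (Set.projIcc 0 1 zero_le_one t) (Set.projIcc 0 1 zero_le_one s)) := rfl
  rw [e, preCellFun, if_neg]
  intro h
  have := congrArg Subtype.val h
  rw [Set.coe_projIcc] at this
  have h2 : 0 < max 0 (min 1 s) := lt_max_of_lt_right (lt_min one_pos h0)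
  exact h2.ne' this

theorem fn_sectorPt_mono (c : Y.Side) (t : ℝ) {s s' : ℝ} (h0 : 0 ≤ s) (h : s ≤ s') :
    hw.fn (Y.sectorPt c t s) ≤ hw.fn (Y.sectorPt c t s') := by
  rcases h0.eq_or_lt with rfl | h0
  · rcases h.eq_or_lt with rfl | h
    · exact le_rfl
    · rw [hw.fn_sectorPt c t h, sectorPt_zero]
      exact (hw.fn_edgePt_le _ _).trans (hw.le_face _ _ (List.getElem_mem _))
  · rw [hw.fn_sectorPt c t h0, hw.fn_sectorPt c t (h0.trans_le h)]

theorem isMonoPath_vertPath (v : Y.V) :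
    (T.vertPath v).IsMonoPath hw.fn (Y.pt (.vert y)) (Y.pt (.vert v)) := by
  induction v using T.induction_path with
  | h0 => exact T.vertPath_base ▸ ⟨le_rfl, rfl, fun _ _ => rfl, fun _ _ _ _ => le_rfl⟩
  | h1 d hpos hd ih =>
    rw [T.vertPath_tgt hd, ← edgePt_one]
    refine ih.extend zero_le_one (edgePt_zero d) fun s t hs hst ht => ?_
    rcases ht.eq_or_lt with rfl | ht
    · rw [edgePt_one, hw.fn_vert]
      exact (hw.fn_edgePt_le d s).trans (hw.tree_le d hpos hd)
    · rcases hs.eq_or_lt with rfl | hs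
      · rcases hst.eq_or_lt with rfl | hst
        · exact le_rfl
        · rw [edgePt_zero, hw.fn_vert, hw.fn_edgePt hst ht]
          exact hw.src_le d
      · rw [hw.fn_edgePt hs (hst.trans_lt ht), hw.fn_edgePt (hs.trans_le hst) ht]

end IsWeight

/-- A combing of a closed edge: a family of paths from the base vertex to the points of the edge. -/
structure IsEdgeCombing (d : Y.D) (w : Y.Space → α) (F : ℝ → MoorePath Y.Space) : Prop where
  cont : ContFamily F
  zero : F 0 = T.vertPath (Y.src d)
  one : F 1 = T.vertPath (Y.tgt d)
  mono : ∀ t, (F t).IsMonoPath w (Y.pt (.vert y)) (Y.edgePt d t)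

variable {T} in
theorem IsEdgeCombing.rev {d : Y.D} {w : Y.Space → α} {F : ℝ → MoorePath Y.Space}
    (h : T.IsEdgeCombing d w F) : T.IsEdgeCombing (Y.rev d) w fun t => F (1 - t) where
  cont := h.cont.comp (continuous_const.sub continuous_id)
  zero := by rw [sub_zero, h.one, OneComplex.tgt]
  one := by rw [sub_self, h.zero, OneComplex.tgt_rev]
  mono t := by rw [edgePt_rev]; exact h.mono (1 - t)

/-- Two paths from `x₀` to `x` are joined by a family of such paths. -/
def Joined (w : Y.Space → α) (x₀ x : Y.Space) (p q : MoorePath Y.Space) : Prop :=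
  ∃ F : ℝ → MoorePath Y.Space, ContFamily F ∧ F 0 = p ∧ F 1 = q ∧ ∀ t, (F t).IsMonoPath w x₀ x

theorem Joined.trans {w : Y.Space → α} {x₀ x : Y.Space} {p q r : MoorePath Y.Space}
    (h : Joined w x₀ x p q) (h' : Joined w x₀ x q r) : Joined w x₀ x p r := by
  obtain ⟨F, hF, rfl, rfl, hm⟩ := h
  obtain ⟨F', hF', h0, rfl, hm'⟩ := h'
  refine ⟨_, (hF.comp (u := fun t => 2 * t) (by fun_prop)).glue
    (hF'.comp (u := fun t => 2 * t - 1) (by fun_prop)) (1 / 2) ?_, ?_, ?_, fun t => ?_⟩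
  · norm_num [h0]
  · norm_num
  · norm_num
  · split_ifs
    exacts [hm _, hm' _]

theorem Joined.symm {w : Y.Space → α} {x₀ x : Y.Space} {p q : MoorePath Y.Space}
    (h : Joined w x₀ x p q) : Joined w x₀ x q p := by
  obtain ⟨F, hF, rfl, rfl, hm⟩ := h
  exact ⟨_, hF.comp (u := fun t => 1 - t) (by fun_prop), by norm_num, by norm_num,
    fun t => hm (1 - t)⟩

/-- The path along the tree to the start of a side of a polygon and then to the centre. -/
noncomputable def cornerPath (c : Y.Side) : MoorePath Y.Space :=
  (T.vertPath (Y.src c.dart)).extend (Y.sectorPt c 0) 1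

theorem cornerPath_next (c : Y.Side) :
    T.cornerPath c.next = (T.vertPath (Y.tgt c.dart)).extend (Y.sectorPt c 1) 1 := by
  rw [cornerPath, Side.src_next, funext (sectorPt_next c)]

/-! ### Sweeping around a face -/

namespace IsWeight

variable {T}

include hw

/-- Continue each path of the combing of the side radially to the centre. All the paths then end at
the centre, and entering the face does not lower the weight because its sides weigh at most as much
as the face. -/
theorem joined_next {c c₀ : Y.Side} (hc : c.1.1 = c₀.1.1) {F : ℝ → MoorePath Y.Space}
    (hF : T.IsEdgeCombing c.dart hw.fn F) : Joined hw.fn (Y.pt (.vert y)) (Y.sectorPt c₀ 0 1)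
      (T.cornerPath c) (T.cornerPath c.next) := by
  refine ⟨fun t => (F t).extend (Y.sectorPt c t) 1, ?_, ?_, ?_, fun t => ?_⟩
  · refine hF.cont.extend (continuous_sectorPt c continuous_fst continuous_snd) continuous_const
      (fun _ => zero_le_one) fun t => ?_
    rw [(hF.mono t).after _ le_rfl, sectorPt_zero]
  · simp only [hF.zero, cornerPath]
  · simp only [hF.one, cornerPath_next]
  · rw [sectorPt_one c₀ c hc.symm 0 t]
    exact (hF.mono t).extend zero_le_one (sectorPt_zero c t) fun s s' hs hss _ =>
      hw.fn_sectorPt_mono c t hs hss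

theorem joined_refl (c : Y.Side) : Joined hw.fn (Y.pt (.vert y)) (Y.sectorPt c 0 1)
    (T.cornerPath c) (T.cornerPath c) := by
  have hv := hw.isMonoPath_vertPath (Y.src c.dart)
  have h0 : Y.sectorPt c 0 0 = Y.pt (.vert (Y.src c.dart)) := by rw [sectorPt_zero, edgePt_zero]
  refine ⟨fun _ => T.cornerPath c, ?_, rfl, rfl, fun _ => ?_⟩
  · refine (ContFamily.const _ (T.continuous_vertPath _).1).extend
      (G := fun _ => Y.sectorPt c 0) (l := fun _ => 1)
      (continuous_sectorPt c continuous_const continuous_snd) continuous_const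
      (fun _ => zero_le_one) fun t => ?_
    rw [hv.after _ le_rfl, h0]
  · exact hv.extend zero_le_one h0 fun s s' hs hss _ => hw.fn_sectorPt_mono c 0 hs hss

/-- The two corner paths at the ends of the top edge are joined by going around the other sides,
from the end of `d` back to its start. The top edge, whose combing is still to be found, is not
used. -/
theorem joined_around {f : Y.F} {d : Y.D} {l : List Y.D} (hf : Y.bd f = d :: l)
    (hl : ∀ c ∈ l, ∃ F, T.IsEdgeCombing c hw.fn F) (c : Y.Side) (hc : c.1 = (f, 0)) :
    Joined hw.fn (Y.pt (.vert y)) (Y.sectorPt c 0 1) (T.cornerPath c) (T.cornerPath c.next) := by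
  have hlen : (Y.bd f).length = l.length + 1 := by rw [hf]; rfl
  have hiter : ∀ k, (Side.next^[k] c).1 = (f, k % (Y.bd f).length) := by
    intro k
    induction k with
    | zero => rw [Function.iterate_zero_apply, hc, Nat.zero_mod]
    | succ k ih =>
      rw [Function.iterate_succ_apply']
      simp only [Side.next, ih]
      rw [Nat.mod_add_mod]
  have key : ∀ k ≤ l.length, Joined hw.fn (Y.pt (.vert y)) (Y.sectorPt c 0 1)
      (T.cornerPath c.next) (T.cornerPath (Side.next^[k + 1] c)) := by
    intro k
    induction k with
    | zero =>
      intro _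
      have hcn : c.1.1 = c.next.1.1 := rfl
      rw [sectorPt_one c c.next hcn 0 0]
      exact hw.joined_refl c.next
    | succ k ih =>
      intro hk
      refine (ih (by omega)).trans ?_
      rw [Function.iterate_succ_apply' _ (k + 1)]
      have h1 : (Side.next^[k + 1] c).1 = (f, k + 1) := by
        rw [hiter, Nat.mod_eq_of_lt (by omega)]
      obtain ⟨F, hF⟩ := hl _ ((Side.next^[k + 1] c).dart_succ hf h1)
      exact hw.joined_next (by rw [h1, hc]) hF
  have hback : Side.next^[l.length + 1] c = c :=
    Subtype.ext (by rw [hiter, hlen, Nat.mod_self, hc])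
  have := key l.length le_rfl
  rw [hback] at this
  exact this.symm

end IsWeight

/-- A path followed by a path through a polygon, which starts at the height `0` above `τ 0`, rises to
the height `3 r`, moves to `τ r` and falls. -/
noncomputable def legPath (p : MoorePath Y.Space) (c : Y.Side) (τ : ℝ → ℝ) (r : ℝ) :
    MoorePath Y.Space :=
  ((p.extend (fun x => Y.sectorPt c (τ 0) x) (3 * r)).extend
    (fun x => Y.sectorPt c (τ x) (3 * r)) r).extend (fun x => Y.sectorPt c (τ r) (3 * r - x)) (3 * r)

/-! ### Combing the edges -/

namespace IsWeight

variable {T}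

include hw

/-- Only the top edge may be reached from inside the face, since its weight is at least that of the
face. Its endpoints may weigh less, so the descent must land in the interior of the edge. -/
theorem fn_sectorPt_anti {f : Y.F} {d : Y.D} {l : List Y.D} (hf : Y.bd f = d :: l) {c : Y.Side}
    (hc : c.1 = (f, 0)) {t : ℝ} (ht0 : 0 < t) (ht1 : t < 1) {s s' : ℝ} (h0 : 0 ≤ s) (h : s ≤ s') :
    hw.fn (Y.sectorPt c t s') ≤ hw.fn (Y.sectorPt c t s) := by
  rcases h0.eq_or_lt with rfl | h0
  · rcases h.eq_or_lt with rfl | h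
    · exact le_rfl
    · rw [hw.fn_sectorPt _ t h, sectorPt_zero, hw.fn_edgePt ht0 ht1, c.dart_zero hf hc, hc]
      exact hw.top_le f _ l hf
  · rw [hw.fn_sectorPt _ t h0, hw.fn_sectorPt _ t (h0.trans_le h)]

theorem isMonoPath_legPath {f : Y.F} {d : Y.D} {l : List Y.D} (hf : Y.bd f = d :: l) {c : Y.Side}
    (hc : c.1 = (f, 0)) {τ : ℝ → ℝ} (hτ : ∀ r, 0 < r → r ≤ 1 / 3 → 0 < τ r ∧ τ r < 1)
    {p : MoorePath Y.Space} (hp : p.IsMonoPath hw.fn (Y.pt (.vert y)) (Y.edgePt c.dart (τ 0)))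
    {r : ℝ} (hr : 0 ≤ r) (hr' : r ≤ 1 / 3) :
    (legPath p c τ r).IsMonoPath hw.fn (Y.pt (.vert y)) (Y.edgePt c.dart (τ r)) := by
  have h1 := hp.extend (g := fun x => Y.sectorPt c (τ 0) x) (l := 3 * r) (by linarith)
    (sectorPt_zero c _) fun s s' hs hss _ => hw.fn_sectorPt_mono c _ hs hss
  have h2 := h1.extend (g := fun x => Y.sectorPt c (τ x) (3 * r)) hr rfl fun s s' hs hss hs' => by
    rcases hr.eq_or_lt with rfl | hr
    · rw [show s = s' by linarith]
    · rw [hw.fn_sectorPt c _ (by linarith), hw.fn_sectorPt c _ (by linarith)]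
  have h3 := h2.extend (g := fun x => Y.sectorPt c (τ r) (3 * r - x)) (l := 3 * r) (by linarith)
    (by simp only [sub_zero]) fun s s' hs hss hs' => by
      rcases hr.eq_or_lt with rfl | hr
      · rw [show s = s' by linarith]
      · exact hw.fn_sectorPt_anti hf hc (hτ r hr hr').1 (hτ r hr hr').2 (by linarith) (by linarith)
  rw [sub_self, sectorPt_zero] at h3
  exact h3

/-- At an endpoint of the edge the detour has vanished, so the edge combing begins and ends with the
prescribed tree paths. -/
theorem legPath_zero {c : Y.Side} {τ : ℝ → ℝ} {p : MoorePath Y.Space}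
    (hp : p.IsMonoPath hw.fn (Y.pt (.vert y)) (Y.edgePt c.dart (τ 0))) : legPath p c τ 0 = p := by
  have hp' := hp
  rw [← sectorPt_zero] at hp'
  rw [legPath, mul_zero, hp'.extend_zero rfl,
    hp'.extend_zero (g := fun x => Y.sectorPt c (τ x) 0) rfl, hp'.extend_zero (by simp)]

theorem contFamily_legPath {c : Y.Side} {τ : ℝ → ℝ} (hτ : Continuous τ) {p : MoorePath Y.Space}
    (hp : p.IsMonoPath hw.fn (Y.pt (.vert y)) (Y.edgePt c.dart (τ 0))) (hpc : Continuous p.toFun)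
    {r : ℝ → ℝ} (hr : Continuous r) (hr0 : ∀ t, 0 ≤ r t) :
    ContFamily fun t => legPath p c τ (r t) := by
  have h0 : ∀ t, 0 ≤ 3 * r t := fun t => by linarith [hr0 t]
  have hp' := hp
  rw [← sectorPt_zero] at hp'
  have m1 : ∀ t, (p.extend (fun x => Y.sectorPt c (τ 0) x) (3 * r t)).IsMonoPath hw.fn
      (Y.pt (.vert y)) (Y.sectorPt c (τ 0) (3 * r t)) := fun t =>
    hp'.extend (h0 t) rfl fun s s' hs hss _ => hw.fn_sectorPt_mono c _ hs hss
  have e2 : ∀ (q : MoorePath Y.Space) (g : ℝ → Y.Space) (l : ℝ), 0 ≤ l →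
      q.toFun q.len = g 0 → (q.extend g l).toFun (q.extend g l).len = g l := by
    intro q g l hl hg
    simp only [MoorePath.extend]
    split_ifs with h
    · have : l = 0 := by linarith
      rw [this, add_zero, hg]
    · rw [add_sub_cancel_left, min_self]
  refine ContFamily.extend (ContFamily.extend (ContFamily.extend (.const p hpc)
    (G := fun _ x => Y.sectorPt c (τ 0) x) (l := fun t => 3 * r t)
    (continuous_sectorPt c continuous_const continuous_snd) (by fun_prop) h0 fun t => ?_)
    (G := fun t x => Y.sectorPt c (τ x) (3 * r t)) (l := r)
    (continuous_sectorPt c (by fun_prop) (by fun_prop)) hr hr0 fun t => ?_)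
    (G := fun t x => Y.sectorPt c (τ (r t)) (3 * r t - x)) (l := fun t => 3 * r t)
    (continuous_sectorPt c (by fun_prop) (by fun_prop)) (by fun_prop) h0 fun t => ?_
  · exact hp'.after _ le_rfl
  · exact (m1 t).after _ le_rfl
  · rw [e2 _ _ _ (hr0 t) ((m1 t).after _ le_rfl), sub_zero]

theorem exists_isEdgeCombing_tree {d : Y.D} (hpos : T.pos d)
    (hd : T.path (Y.tgt d) = T.path (Y.src d) ++ [d]) : ∃ F, T.IsEdgeCombing d hw.fn F := by
  have hv := hw.isMonoPath_vertPath (Y.src d)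
  -- Edge combings are indexed by all real parameters, with values outside the unit interval
  -- clamped.
  have hcl : ∀ t : ℝ, Y.edgePt d (max 0 (min 1 t)) = Y.edgePt d t := fun t => by
    rw [edgePt, edgePt]
    congr 2
    rw [← Set.coe_projIcc 0 1 zero_le_one t, Set.projIcc_val]
  refine ⟨fun t => (T.vertPath (Y.src d)).extend (Y.edgePt d) (max 0 (min 1 t)), ?_, ?_, ?_, ?_⟩
  · refine (ContFamily.const _ (T.continuous_vertPath _).1).extend (G := fun _ => Y.edgePt d)
      ((continuous_edgePt d).comp continuous_snd) (by fun_prop) (fun _ => le_max_left _ _)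
      fun _ => ?_
    rw [hv.after _ le_rfl, edgePt_zero]
  · norm_num [hv.extend_zero (edgePt_zero d)]
  · norm_num [T.vertPath_tgt hd]
  · intro t
    rw [← hcl]
    refine hv.extend (le_max_left _ _) (edgePt_zero d) fun s s' hs hss hs' => ?_
    have hs1 : s' ≤ 1 := hs'.trans (max_le zero_le_one (min_le_left _ _))
    rcases hs1.eq_or_lt with rfl | hs1
    · rw [edgePt_one, hw.fn_vert]
      exact (hw.fn_edgePt_le d s).trans (hw.tree_le d hpos hd)
    · rcases hs.eq_or_lt with rfl | hs
      · rcases hss.eq_or_lt with rfl | hss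
        · exact le_rfl
        · rw [edgePt_zero, hw.fn_vert, hw.fn_edgePt hss hs1]
          exact hw.src_le d
      · rw [hw.fn_edgePt hs (hss.trans_lt hs1), hw.fn_edgePt (hs.trans_le hss) hs1]

/-- The parameter interval is cut into thirds. In the middle third the paths to the centre sweep
around the other sides of the face and then descend to the point of the edge. The outer thirds
deform the result to the tree paths at the endpoints: after the tree path comes a small detour into
the face, and its height grows from 0 until it passes through the centre. -/
theorem exists_isEdgeCombing_top {f : Y.F} {d : Y.D} {l : List Y.D} (hf : Y.bd f = d :: l)
    (hl : ∀ c ∈ l, ∃ F, T.IsEdgeCombing c hw.fn F) : ∃ F, T.IsEdgeCombing d hw.fn F := by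
  obtain ⟨c, hc⟩ : ∃ c : Y.Side, c.1 = (f, 0) := ⟨⟨(f, 0), by simp [hf]⟩, rfl⟩
  have hcd : c.dart = d := c.dart_zero hf hc
  obtain ⟨B, hB, hB0, hB1, hBm⟩ := hw.joined_around hf hl c hc
  have hv0 := hw.isMonoPath_vertPath (Y.src c.dart)
  have hv1 := hw.isMonoPath_vertPath (Y.tgt c.dart)
  rw [← edgePt_zero] at hv0
  rw [← edgePt_one] at hv1
  have hctr : ∀ t t' : ℝ, Y.sectorPt c t 1 = Y.sectorPt c t' 1 := sectorPt_one c c rfl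
  let τ : ℝ → ℝ := fun t => 1 - t
  have hτ0 : τ 0 = 1 := sub_zero 1
  rw [← hτ0] at hv1
  have hp1 : ∀ r : ℝ, 0 < r → r ≤ 1 / 3 → 0 < id r ∧ id r < 1 := fun r h h' =>
    ⟨h, by simp only [id]; linarith⟩
  have hp2 : ∀ r : ℝ, 0 < r → r ≤ 1 / 3 → 0 < τ r ∧ τ r < 1 := fun r h h' =>
    ⟨by simp only [τ]; linarith, by simp only [τ]; linarith⟩
  -- Parameters clamped to their thirds, so that each piece is a continuous family over all of `ℝ`.
  let r : ℝ → ℝ := fun t => max 0 (min t (1 / 3))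
  let m : ℝ → ℝ := fun t => max (1 / 3) (min t (2 / 3))
  have hr : Continuous r := by fun_prop
  have hm : Continuous m := by fun_prop
  have hr0 : ∀ t, 0 ≤ r t := fun t => le_max_left _ _
  have hr1 : ∀ t, r t ≤ 1 / 3 := fun t => max_le (by norm_num) (min_le_right _ _)
  have hm0 : ∀ t, 1 / 3 ≤ m t := fun t => le_max_left _ _
  have hm1 : ∀ t, m t ≤ 2 / 3 := fun t => max_le (by norm_num) (min_le_right _ _)
  -- The rest of length `1/3` at the centre matches the sideways segment of `legPath` for `r = 1/3`:
  -- there the height is 1, so that segment is constant at the centre.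
  let mid : ℝ → MoorePath Y.Space := fun t => ((B (3 * m t - 1)).extend
    (fun _ => Y.sectorPt c 0 1) (1 / 3)).extend (fun x => Y.sectorPt c (m t) (1 - x)) 1
  have hmid1 : ∀ t, ((B (3 * m t - 1)).extend (fun _ => Y.sectorPt c 0 1) (1 / 3)).IsMonoPath
      hw.fn (Y.pt (.vert y)) (Y.sectorPt c 0 1) := fun t =>
    (hBm _).extend (g := fun _ => Y.sectorPt c 0 1) (l := 1 / 3) (by norm_num) rfl
      fun _ _ _ _ _ => le_rfl
  have hmidc : ContFamily mid := by
    refine ContFamily.extend (ContFamily.extend (hB.comp (u := fun t => 3 * m t - 1) (by fun_prop))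
      (G := fun _ _ => Y.sectorPt c 0 1) (l := fun _ => 1 / 3)
      continuous_const continuous_const (fun _ => by norm_num) fun t => ?_)
      (G := fun t x => Y.sectorPt c (m t) (1 - x)) (l := fun _ => 1)
      (continuous_sectorPt c (by fun_prop) (by fun_prop)) continuous_const
      (fun _ => zero_le_one) fun t => ?_
    · exact (hBm _).after _ le_rfl
    · rw [(hmid1 t).after _ le_rfl, sub_zero, hctr]
  have hmid : ∀ t, (mid t).IsMonoPath hw.fn (Y.pt (.vert y)) (Y.edgePt c.dart (m t)) := by
    intro t
    have := (hmid1 t).extend (g := fun x => Y.sectorPt c (m t) (1 - x)) zero_le_one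
      (by simp only [sub_zero]; exact hctr _ _) fun s s' hs hss hs' =>
        hw.fn_sectorPt_anti hf hc (by linarith [hm0 t]) (by linarith [hm1 t]) (by linarith)
          (by linarith)
    rwa [sub_self, sectorPt_zero] at this
  have hleg1 : ContFamily fun t => legPath (T.vertPath (Y.src c.dart)) c id (r t) :=
    hw.contFamily_legPath continuous_id hv0 (T.continuous_vertPath _).1 hr hr0
  have hleg2 : ContFamily fun t => legPath (T.vertPath (Y.tgt c.dart)) c τ (r (1 - t)) :=
    hw.contFamily_legPath (r := fun t => r (1 - t)) (by fun_prop) hv1 (T.continuous_vertPath _).1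
      (by fun_prop) fun _ => hr0 _
  have hcorner : T.cornerPath c.next = (T.vertPath (Y.tgt c.dart)).extend (Y.sectorPt c 1) 1 :=
    T.cornerPath_next c
  -- At the junction both sides are the corner path, a rest of length `1/3` at the centre, and a
  -- descent of length 1.
  have g1 : legPath (T.vertPath (Y.src c.dart)) c id (r (1 / 3)) = mid (1 / 3) := by
    have e1 : r (1 / 3) = 1 / 3 := by simp only [r]; norm_num
    have e2 : m (1 / 3) = 1 / 3 := by simp only [m]; norm_num
    simp only [mid, e1, e2, legPath, id]
    norm_num
    rw [hB0, cornerPath]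
    simp only [hctr _ 0]
  have g2 : mid (2 / 3) = legPath (T.vertPath (Y.tgt c.dart)) c τ (r (1 - 2 / 3)) := by
    have e1 : r (1 - 2 / 3) = 1 / 3 := by simp only [r]; norm_num
    have e2 : m (2 / 3) = 2 / 3 := by simp only [m]; norm_num
    simp only [mid, e1, e2, legPath, τ]
    norm_num
    rw [hB1, hcorner]
    simp only [hctr _ 0]
  refine ⟨fun t => if t ≤ 1 / 3 then legPath (T.vertPath (Y.src c.dart)) c id (r t) else
    if t ≤ 2 / 3 then mid t else legPath (T.vertPath (Y.tgt c.dart)) c τ (r (1 - t)),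
    hleg1.glue (hmidc.glue hleg2 (2 / 3) g2) (1 / 3) ?_, ?_, ?_, fun t => ?_⟩
  · rw [if_pos (by norm_num), g1]
  · have : r 0 = 0 := by simp only [r]; norm_num
    rw [if_pos (by norm_num), this, hw.legPath_zero hv0, hcd]
  · have : r (1 - 1) = 0 := by simp only [r]; norm_num
    rw [if_neg (by norm_num), if_neg (by norm_num), this, hw.legPath_zero hv1, hcd]
  · have hcl : ∀ t : ℝ, Y.edgePt d (max 0 (min 1 t)) = Y.edgePt d t := fun t => by
      rw [edgePt, edgePt]
      congr 2
      rw [← Set.coe_projIcc 0 1 zero_le_one t, Set.projIcc_val]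
    rw [← hcd] at hcl ⊢
    split_ifs with h1 h2
    · have := hw.isMonoPath_legPath hf hc hp1 hv0 (hr0 t) (hr1 t)
      have e : max 0 (min 1 t) = id (r t) := by
        simp only [id, r]
        rw [min_eq_right (by linarith), min_eq_left h1]
      rwa [← e, hcl] at this
    · have := hmid t
      have e : m t = t := by
        simp only [m]
        rw [min_eq_left h2, max_eq_right (by linarith)]
      rwa [e] at this
    · have := hw.isMonoPath_legPath hf hc hp2 hv1 (hr0 (1 - t)) (hr1 _)
      have e : max 0 (min 1 t) = τ (r (1 - t)) := by
        simp only [τ, r]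
        rw [min_eq_left (b := (1 / 3 : ℝ)) (by linarith)]
        rcases le_total t 1 with h | h
        · rw [min_eq_right h, max_eq_right (by linarith), max_eq_right (by linarith)]; ring
        · rw [min_eq_left h, max_eq_right (by linarith), max_eq_left (by linarith)]; ring
      rwa [← e, hcl] at this

/-- Strong induction on rank: the other sides of the face under a non-tree edge have lower rank. A
negative edge has the rank of its reverse and takes the reversed combing. -/
theorem exists_isEdgeCombing (d : Y.D) : ∃ F, T.IsEdgeCombing d hw.fn F := by
  induction hn : T.rank d using Nat.strong_induction_on generalizing d with
  | _ n ih =>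
    have hpos : ∀ d, T.pos d → T.rank d = n → ∃ F, T.IsEdgeCombing d hw.fn F := by
      rintro d hd rfl
      rcases T.pos_cases d hd with h | ⟨f, l, hf, hl⟩
      · exact hw.exists_isEdgeCombing_tree hd h
      · exact hw.exists_isEdgeCombing_top hf fun c hc => ih _ (hl c hc) c rfl
    by_cases hd : T.pos d
    · exact hpos d hd hn
    · obtain ⟨F, hF⟩ := hpos (Y.rev d) ((T.pos_rev d).2 hd) ((T.rank_rev d).trans hn)
      have := hF.rev
      rw [Y.rev_rev] at this
      exact ⟨_, this⟩

/-- A complex with a stacking has a combing of its 1-skeleton along which weights do not decrease. -/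
theorem exists_isOneCombing : ∃ ψ : Y.skeleton1 × I → Y.Space,
    Y.IsOneCombing Y.skeleton1 y ψ ∧
      ∀ (p : Y.skeleton1) (s t : I), s ≤ t → hw.fn (ψ (p, s)) ≤ hw.fn (ψ (p, t)) := by
  classical
  choose F₀ hF₀ using hw.exists_isEdgeCombing
  -- The chosen combings of an edge and its reverse need not agree. Using only the choice for the
  -- positive direction makes the family compatible with the gluing.
  let F : Y.D → ℝ → MoorePath Y.Space := fun d =>
    if T.pos d then F₀ d else fun t => F₀ (Y.rev d) (1 - t)
  have hF : ∀ d, T.IsEdgeCombing d hw.fn (F d) := by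
    intro d
    simp only [F]
    split_ifs with h
    · exact hF₀ d
    · have := (hF₀ (Y.rev d)).rev
      rwa [Y.rev_rev] at this
  have hrev : ∀ d t, F d t = F (Y.rev d) (1 - t) := by
    intro d t
    simp only [F]
    by_cases h : T.pos d
    · rw [if_pos h, if_neg (by rw [T.pos_rev]; exact not_not_intro h), Y.rev_rev, sub_sub_cancel]
    · rw [if_neg h, if_pos ((T.pos_rev d).2 h)]
  let Φ₀ : Y.PrePoint → MoorePath Y.Space := fun
    | .vert v => T.vertPath v
    | .edge d t => F d t
    -- Only the 1-skeleton is combed; the value inside faces is an arbitrary constant.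
    | .face c t s => if s = 0 then F c.dart t else T.vertPath y
  have hΦ₀ : ∀ a b, Y.Glue a b → Φ₀ a = Φ₀ b := by
    intro a b h
    cases h with
    | edge_src d => exact (hF d).zero
    | edge_rev d t => exact (hrev d t).trans (by simp [Φ₀])
    | face_bd c t => simp [Φ₀]
    | face_side c s =>
      simp only [Φ₀]
      rw [Set.Icc.coe_one, Set.Icc.coe_zero, (hF _).one, (hF _).zero, Side.src_next]
    | face_centre c c' t t' h => simp [Φ₀]
  let Φ : Y.Space → MoorePath Y.Space := Quot.lift Φ₀ hΦ₀
  have hΦm : ∀ x ∈ Y.skeleton1, (Φ x).IsMonoPath hw.fn (Y.pt (.vert y)) x := by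
    rintro _ (⟨v, rfl⟩ | ⟨⟨d, t⟩, rfl⟩)
    · exact hw.isMonoPath_vertPath v
    · have := (hF d).mono t
      rwa [edgePt_coe] at this
  have hΦc : ∀ x ∈ Y.skeleton1, Continuous (Φ x).toFun := by
    rintro _ (⟨v, rfl⟩ | ⟨⟨d, t⟩, rfl⟩)
    · exact (T.continuous_vertPath v).1
    · exact (hF d).cont.toFun.comp (Continuous.prodMk_right (t : ℝ))
  -- Continuity is checked edge by edge on the 1-skeleton, not on its product with the interval. The
  -- paths are therefore regarded as points of a function space: currying gives continuity on each
  -- edge, and evaluation is continuous because `ℝ` is locally compact.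
  let Γ : Y.Space → ℝ × C(ℝ, Y.Space) := fun x => ((Φ x).len,
    if h : Continuous (Φ x).toFun then ⟨(Φ x).toFun, h⟩ else .const _ x)
  have hΓ : ContinuousOn Γ Y.skeleton1 := by
    refine continuousOn_skeleton1 fun d => ?_
    have hc : Continuous fun q : I × ℝ => (F d q.1).toFun q.2 :=
      (hF d).cont.toFun.comp (Continuous.prodMap continuous_subtype_val continuous_id)
    refine ((hF d).cont.len.comp continuous_subtype_val).prodMk ?_
    have := (ContinuousMap.curry ⟨_, hc⟩).continuous
    refine this.congr fun t => ?_
    rw [dif_pos (hΦc _ (Or.inr ⟨(d, t), rfl⟩))]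
    rfl
  have hΓ' : Continuous fun p : Y.skeleton1 => Γ p := hΓ.domRestrict
  have hψ : Continuous fun q : Y.skeleton1 × I => (Φ q.1).toFun (q.2 * (Φ q.1).len) := by
    have h1 : Continuous fun q : Y.skeleton1 × I => (Γ q.1).2 ((q.2 : ℝ) * (Γ q.1).1) := by
      have h2 := hΓ'.comp (continuous_fst (X := Y.skeleton1) (Y := I))
      exact h2.snd.eval ((continuous_subtype_val.comp continuous_snd).mul h2.fst)
    refine h1.congr fun q => ?_
    simp only [Γ]
    rw [dif_pos (hΦc _ q.1.2)]
    rfl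
  refine ⟨fun q => (Φ q.1).toFun (q.2 * (Φ q.1).len), ⟨hψ, fun p => ?_, fun p => ?_,
    fun p hp t => ?_, fun p hp t => ?_⟩, fun p s t hst => ?_⟩
  · simp only [Set.Icc.coe_zero, zero_mul]
    exact (hΦm p p.2).start
  · simp only [Set.Icc.coe_one, one_mul]
    exact (hΦm p p.2).after _ le_rfl
  · have e : Φ (Y.pt (.vert y)) = T.vertPath y := rfl
    simp only [hp, e, T.vertPath_base]
  · obtain ⟨v, hv⟩ := hp
    have e : Φ (Y.pt (.vert v)) = T.vertPath v := rfl
    simp only at hv ⊢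
    rw [← hv, e]
    exact T.vertPath_mem_skeleton1 v _
  · have h0 := (hΦm p p.2).len_nonneg
    exact (hΦm p p.2).mono _ _ (mul_nonneg s.2.1 h0) (mul_le_mul_of_nonneg_right hst h0)

end IsWeight

end Stacking

end TwoComplex

/-! ## Reachable prefixes -/

section Rewriting

open Relation

variable {A : Type*} {rules : Set (List A × List A)}

theorem rewrite_context {x y : List A} (h : ReflTransGen (RewriteStep rules) x y) (p q : List A) :
    ReflTransGen (RewriteStep rules) (p ++ x ++ q) (p ++ y ++ q) := by
  induction h with
  | refl => exact .refl
  | tail _ h ih => exact ih.tail (h.context p q)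

/-- The prefixes of the words to which a word rewrites. -/
def reachablePrefixes (rules : Set (List A × List A)) (x : List A) : Set (List A) :=
  {z | ∃ r, ReflTransGen (RewriteStep rules) x (z ++ r)}

theorem mem_reachablePrefixes_of_prefix {x z : List A} (h : z <+: x) :
    z ∈ reachablePrefixes rules x := by
  obtain ⟨r, rfl⟩ := h
  exact ⟨r, .refl⟩

/-- Rewriting can continue inside the prefix while the remainder is left alone. Inclusion of weights
thus reduces to membership of a single word. -/
theorem reachablePrefixes_subset {x z : List A} (h : z ∈ reachablePrefixes rules x) :
    reachablePrefixes rules z ⊆ reachablePrefixes rules x := by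
  rintro z' ⟨r', hr'⟩
  obtain ⟨r, hr⟩ := h
  refine ⟨r' ++ r, hr.trans ?_⟩
  simpa using rewrite_context hr' [] r

theorem IrreducibleWord.of_prefix {x y : List A} (h : IrreducibleWord rules y) (hxy : x <+: y) :
    IrreducibleWord rules x := by
  obtain ⟨z, rfl⟩ := hxy
  intro x' hx
  exact h _ (by simpa using hx.context [] z)

/-- Take the shortest reducible prefix. Removing its last letter makes it irreducible, so the left
side of the rule ends at that letter. -/
theorem exists_reducible_prefix (hne : ∀ v, ([], v) ∉ rules) (w : List A)
    (hw : ¬ IrreducibleWord rules w) : ∃ p u a v q, (u ++ [a], v) ∈ rules ∧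
      w = p ++ u ++ a :: q ∧ IrreducibleWord rules (p ++ u) := by
  induction w using List.reverseRecOn with
  | nil =>
    refine (hw ?_).elim
    rintro y ⟨p, q, u, v, h, hx, -⟩
    simp only [List.nil_eq, List.append_eq_nil_iff] at hx
    exact hne v (hx.1.2 ▸ h)
  | append_singleton w b ih =>
    by_cases hwi : IrreducibleWord rules w
    · rw [IrreducibleWord] at hw
      push Not at hw
      obtain ⟨y, p, q, u, v, h, hx, -⟩ := hw
      rcases q.eq_nil_or_concat' with rfl | ⟨q, c, rfl⟩
      · rcases u.eq_nil_or_concat' with rfl | ⟨u, c, rfl⟩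
        · exact (hne v h).elim
        · rw [List.append_nil, ← List.append_assoc] at hx
          obtain ⟨h1, h2⟩ := List.append_inj' hx rfl
          refine ⟨p, u, c, v, [], h, ?_, h1 ▸ hwi⟩
          rw [hx]
      · exfalso
        rw [← List.append_assoc] at hx
        obtain ⟨h1, h2⟩ := List.append_inj' hx rfl
        exact hwi _ ⟨p, q, u, v, h, h1, rfl⟩
    · obtain ⟨p, u, a, v, q, h, rfl, hpu⟩ := ih hwi
      exact ⟨p, u, a, v, q ++ [b], h, by simp, hpu⟩

variable {G : Type*} [Group G] {S : SymmetricAlphabet A G} {R : Finset (List A × List A)}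

theorem IsFiniteCRS.nil_notMem (h : IsFiniteCRS S R) (v : List A) :
    ([], v) ∉ (R : Set (List A × List A)) := by
  intro hp
  have hs : ∀ x : List A, RewriteStep (R : Set (List A × List A)) x (v ++ x) := fun x =>
    ⟨[], x, [], v, hp, by simp, by simp⟩
  obtain ⟨m, -, hm⟩ := h.terminates.has_min Set.univ ⟨[], _root_.trivial⟩
  exact hm _ _root_.trivial (Relation.TransGen.single (hs m))

theorem IsFiniteCRS.eval_eq (h : IsFiniteCRS S R) {x y : List A}
    (hxy : ReflTransGen (RewriteStep (R : Set (List A × List A))) x y) : S.eval x = S.eval y := by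
  induction hxy with
  | refl => rfl
  | tail _ hs ih => exact ih.trans ((h.presents _ _).2 (.rel _ _ hs))

/-- By termination, rewrite until nothing applies; uniqueness of the irreducible representative
identifies the result. -/
theorem IsFiniteCRS.rewrites_to (h : IsFiniteCRS S R) {x y : List A} (hxy : S.eval x = S.eval y)
    (hy : IrreducibleWord (R : Set (List A × List A)) y) :
    ReflTransGen (RewriteStep (R : Set (List A × List A))) x y := by
  induction x using h.terminates.induction with
  | _ x ih =>
    by_cases hx : IrreducibleWord (R : Set (List A × List A)) x
    · rw [(h.normalForm (S.eval y)).unique ⟨hxy, hx⟩ ⟨rfl, hy⟩]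
    · rw [IrreducibleWord] at hx
      push Not at hx
      obtain ⟨z, hz⟩ := hx
      exact .head hz (ih z (.single hz) ((h.eval_eq (.single hz)).symm.trans hxy))

end Rewriting

/-! ## Extending stackings -/

namespace TwoComplex.Stacking

variable {Y : TwoComplex} {y : Y.V} (T : Y.Stacking y)

theorem exists_path_eq_of_prefix {x : List Y.D} {v : Y.V} (h : x <+: T.path v) :
    ∃ u, T.path u = x := by
  induction v using T.induction_path with
  | h0 =>
    rw [T.path_base] at h
    exact ⟨y, by rw [T.path_base, List.prefix_nil.1 h]⟩
  | h1 d hpos hd ih =>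
    rw [hd, List.prefix_concat_iff] at h
    rcases h with rfl | h
    · exact ⟨_, hd⟩
    · exact ih h

theorem pos_of_mem_path {v : Y.V} : ∀ d ∈ T.path v, T.pos d := by
  induction v using T.induction_path with
  | h0 => rw [T.path_base]; simp
  | h1 d hpos hd ih =>
    rw [hd]
    intro c hc
    rcases List.mem_append.1 hc with hc | hc
    · exact ih c hc
    · rwa [List.mem_singleton.1 hc]

/-- The stacking of a complex with a new edge that leads to a new vertex. -/
def spur (u : Y.V) : (Y.spur u).Stacking (some y) where
  path v := v.elim ((T.path u).map Sum.inl ++ [Sum.inr true]) fun v => (T.path v).map Sum.inl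
  pos := Sum.elim T.pos fun t => t = true
  rank := Sum.elim T.rank fun _ => 0
  path_base := by rw [Option.elim_some, T.path_base]; rfl
  path_cases v := by
    rcases v with _ | v
    · exact Or.inr ⟨Sum.inr true, rfl, rfl, rfl⟩
    · rcases T.path_cases v with rfl | ⟨d, hpos, rfl, hd⟩
      · exact Or.inl rfl
      · exact Or.inr ⟨Sum.inl d, hpos, rfl, (congrArg (List.map Sum.inl) hd).trans List.map_append⟩
  pos_rev d := by
    rcases d with d | _ | _
    · exact T.pos_rev d
    · exact iff_of_true rfl Bool.false_ne_true
    · exact iff_of_false Bool.false_ne_true (not_not_intro rfl)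
  rank_rev d := by
    rcases d with d | _
    · exact T.rank_rev d
    · rfl
  pos_cases d hd := by
    rcases d with d | t
    · rcases T.pos_cases d hd with h | ⟨f, l, hf, hl⟩
      · exact Or.inl ((congrArg (List.map Sum.inl) h).trans List.map_append)
      · refine Or.inr ⟨f, l.map Sum.inl, congrArg (List.map Sum.inl) hf, fun c hc => ?_⟩
        obtain ⟨c, hc', rfl⟩ := List.mem_map.1 hc
        exact hl c hc'
    · obtain rfl : t = true := hd
      exact Or.inl rfl
  head_pos f d l hf := by
    obtain ⟨d, l, h, rfl, -⟩ := List.map_eq_cons_iff.1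
      (show (Y.bd f).map (Sum.inl : Y.D → Y.D ⊕ Bool) = _ from hf)
    exact T.head_pos f d l h

/-- The stacking of a complex with a new edge that cuts off a new face. -/
def chord {a b : Y.V} {z : List Y.D} (hz : Y.IsPath a z b) : (Y.chord hz).Stacking y where
  path v := (T.path v).map Sum.inl
  pos := Sum.elim T.pos fun t => t = true
  -- The sum is a convenient upper bound for the rank of every edge of `z`.
  rank := Sum.elim T.rank fun _ => (z.map T.rank).sum + 1
  path_base := by rw [T.path_base]; rfl
  path_cases v := by
    rcases T.path_cases v with rfl | ⟨d, hpos, rfl, hd⟩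
    · exact Or.inl rfl
    · exact Or.inr ⟨Sum.inl d, hpos, rfl, (congrArg (List.map Sum.inl) hd).trans List.map_append⟩
  pos_rev d := by
    rcases d with d | _ | _
    · exact T.pos_rev d
    · exact iff_of_true rfl Bool.false_ne_true
    · exact iff_of_false Bool.false_ne_true (not_not_intro rfl)
  rank_rev d := by
    rcases d with d | _
    · exact T.rank_rev d
    · rfl
  pos_cases d hd := by
    rcases d with d | t
    · rcases T.pos_cases d hd with h | ⟨f, l, hf, hl⟩
      · exact Or.inl ((congrArg (List.map Sum.inl) h).trans List.map_append)
      · refine Or.inr ⟨some f, l.map Sum.inl, congrArg (List.map Sum.inl) hf, fun c hc => ?_⟩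
        obtain ⟨c, hc', rfl⟩ := List.mem_map.1 hc
        exact hl c hc'
    · obtain rfl : t = true := hd
      refine Or.inr ⟨none, (z.map Y.rev).reverse.map Sum.inl, rfl, fun c hc => ?_⟩
      obtain ⟨c, hc', rfl⟩ := List.mem_map.1 hc
      obtain ⟨c, hc'', rfl⟩ := List.mem_map.1 (List.mem_reverse.1 hc')
      change T.rank (Y.rev c) < (z.map T.rank).sum + 1
      rw [T.rank_rev]
      exact Nat.lt_succ_of_le (List.le_sum_of_mem (List.mem_map.2 ⟨c, hc'', rfl⟩))
  head_pos f d l hf := by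
    cases f with
    | none =>
      obtain rfl : Sum.inr true = d := (List.cons.inj hf).1
      rfl
    | some f =>
      obtain ⟨d, l, h, rfl, -⟩ := List.map_eq_cons_iff.1
        (show (Y.bd f).map (Sum.inl : Y.D → Y.D ⊕ Bool) = _ from hf)
      exact T.head_pos f d l h

/-! ### Words attached to vertices and edges -/

variable {A : Type*} (label : Y.D → A)

/-- The label of the path in the spanning tree to a vertex. -/
def word (v : Y.V) : List A := (T.path v).map label

open Classical in
/-- The label of the path to an edge, followed by the label of the positively oriented edge. -/
noncomputable def edgeWord (d : Y.D) : List A :=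
  if T.pos d then T.word label (Y.src d) ++ [label d]
  else T.word label (Y.tgt d) ++ [label (Y.rev d)]

theorem edgeWord_rev (d : Y.D) : T.edgeWord label (Y.rev d) = T.edgeWord label d := by
  by_cases h : T.pos d
  · rw [edgeWord, edgeWord, if_neg (by rw [T.pos_rev]; exact not_not_intro h), if_pos h,
      OneComplex.tgt_rev, Y.rev_rev]
  · rw [edgeWord, edgeWord, if_pos ((T.pos_rev d).2 h), if_neg h, OneComplex.tgt]

theorem edgeWord_of_pos {d : Y.D} (h : T.pos d) :
    T.edgeWord label d = T.word label (Y.src d) ++ [label d] := if_pos h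

end TwoComplex.Stacking

namespace SymmetricPresentation

variable {A : Type*} {G : Type*} [Group G] {P : SymmetricPresentation A G}

theorem eval_relator {r : List A} (hr : r ∈ P.relators) : P.eval r = 1 := by
  rw [← P.eval_nil, P.presents]
  exact .rel _ _ ⟨[], [], r, [], ⟨rfl, Or.inl hr⟩, by simp, rfl⟩

namespace VanKampenDiagram

variable {w : List A} {Δ : P.VanKampenDiagram w} {rules : Set (List A × List A)}

/-- The labels of the paths in the spanning tree are irreducible, and the words of the edges of a face
can be reached by rewriting the word of its first edge. -/
structure IsNormalStacking (rules : Set (List A × List A)) (T : Δ.toTwoComplex.Stacking Δ.base) :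
    Prop where
  irreducible : ∀ v, IrreducibleWord rules (T.word Δ.label v)
  eval : ∀ d, P.eval (T.word Δ.label (Δ.tgt d)) =
    P.eval (T.word Δ.label (Δ.src d)) * P.rep (Δ.label d)
  reach : ∀ f d l, Δ.bd f = d :: l → ∀ c ∈ l,
    T.edgeWord Δ.label c ∈ reachablePrefixes rules (T.edgeWord Δ.label d)

theorem IsNormalStacking.eval_path {T : Δ.toTwoComplex.Stacking Δ.base}
    (hT : IsNormalStacking rules T) {u v : Δ.V} {p : List Δ.D} (hp : Δ.IsPath u p v) :
    P.eval (T.word Δ.label v) = P.eval (T.word Δ.label u) * P.eval (p.map Δ.label) := by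
  induction p generalizing u with
  | nil =>
    obtain rfl : u = v := hp
    rw [List.map_nil, P.eval_nil, mul_one]
  | cons d p ih =>
    obtain ⟨rfl, hp⟩ := hp
    rw [ih hp, hT.eval, List.map_cons, P.eval_cons, mul_assoc]

section spur

variable {T : Δ.toTwoComplex.Stacking Δ.base} {u : Δ.V} {x q : List Δ.D}
  (hb : Δ.bdry = x ++ q) (hx : Δ.IsPath Δ.base x u) (hq : Δ.IsPath u q Δ.base) (a : A)
  (hne : Δ.bdry = [] → IsEmpty Δ.D)

/-- The stacking of the diagram with a new edge leading to a new vertex. -/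
def spurStacking (T : Δ.toTwoComplex.Stacking Δ.base) :
    (Δ.spur hb hx hq a hne).toTwoComplex.Stacking (Δ.spur hb hx hq a hne).base := T.spur u

theorem word_spur_some (v : Δ.V) :
    (spurStacking hb hx hq a hne T).word (Δ.spur hb hx hq a hne).label (some v) =
      T.word Δ.label v :=
  List.map_map

theorem word_spur_none :
    (spurStacking hb hx hq a hne T).word (Δ.spur hb hx hq a hne).label none =
      T.word Δ.label u ++ [a] :=
  List.map_append.trans (congrArg (· ++ [a]) List.map_map)

theorem edgeWord_spur_inl (d : Δ.D) :
    (spurStacking hb hx hq a hne T).edgeWord (Δ.spur hb hx hq a hne).label (Sum.inl d) =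
      T.edgeWord Δ.label d := by
  classical
  exact ite_congr rfl (fun _ => congrArg (· ++ [Δ.label d]) (word_spur_some hb hx hq a hne _))
    fun _ => congrArg (· ++ [Δ.label (Δ.rev d)]) (word_spur_some hb hx hq a hne _)

theorem edgeWord_spur_inr (t : Bool) :
    (spurStacking hb hx hq a hne T).edgeWord (Δ.spur hb hx hq a hne).label (Sum.inr t) =
      T.word Δ.label u ++ [a] := by
  have h1 : (spurStacking hb hx hq a hne T).edgeWord (Δ.spur hb hx hq a hne).label
      (Sum.inr true) = T.word Δ.label u ++ [a] :=
    ((spurStacking hb hx hq a hne T).edgeWord_of_pos _ (d := Sum.inr true) rfl).trans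
      (congrArg (· ++ [a]) (word_spur_some hb hx hq a hne u))
  cases t with
  | true => exact h1
  | false =>
    exact ((spurStacking hb hx hq a hne T).edgeWord_rev _ (Sum.inr true)).trans h1

theorem IsNormalStacking.spur (hT : IsNormalStacking rules T)
    (ha : IrreducibleWord rules (T.word Δ.label u ++ [a])) :
    IsNormalStacking rules (spurStacking hb hx hq a hne T) where
  irreducible v := by
    cases v with
    | none => rw [word_spur_none]; exact ha
    | some v => rw [word_spur_some]; exact hT.irreducible v
  eval d := by
    have e1 := word_spur_some hb hx hq a hne (T := T)
    have e2 := word_spur_none hb hx hq a hne (T := T)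
    rcases d with d | _ | _
    · exact (congrArg P.eval (e1 (Δ.tgt d))).trans ((hT.eval d).trans
        (congrArg (P.eval · * P.rep (Δ.label d)) (e1 (Δ.src d)).symm))
    · refine (congrArg P.eval (e1 u)).trans (Eq.trans ?_
        (congrArg (P.eval · * P.rep (P.inv a)) e2.symm))
      simp only [P.eval_append, P.eval_cons, P.eval_nil, P.rep_inv, mul_one,
        mul_inv_cancel_right]
    · refine (congrArg P.eval e2).trans (Eq.trans ?_
        (congrArg (P.eval · * P.rep a) (e1 u).symm))
      simp only [P.eval_append, P.eval_cons, P.eval_nil, mul_one]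
  reach f d l hf c hc := by
    obtain ⟨d, l, h, rfl, rfl⟩ := List.map_eq_cons_iff.1
      (show (Δ.bd f).map (Sum.inl : Δ.D → Δ.D ⊕ Bool) = _ from hf)
    obtain ⟨c, hc', rfl⟩ := List.mem_map.1 hc
    have e := edgeWord_spur_inl hb hx hq a hne (T := T)
    exact (e c).symm ▸ (e d).symm ▸ hT.reach f d l h c hc'

end spur

section chord

variable {T : Δ.toTwoComplex.Stacking Δ.base} {u v : Δ.V} {x z q : List Δ.D}
  (hb : Δ.bdry = x ++ (z ++ q)) (hx : Δ.IsPath Δ.base x u) (hz : Δ.IsPath u z v)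
  (hq : Δ.IsPath v q Δ.base) (a : A) (ha : a :: P.wordInv (z.map Δ.label) ∈ P.relators)
  (hne : Δ.bdry = [] → IsEmpty Δ.D)

/-- The stacking of the diagram with a new face cut off by a new edge. -/
def chordStacking (T : Δ.toTwoComplex.Stacking Δ.base) :
    (Δ.chord hb hx hz hq a ha hne).toTwoComplex.Stacking (Δ.chord hb hx hz hq a ha hne).base :=
  T.chord hz

theorem word_chord (v : Δ.V) :
    (chordStacking hb hx hz hq a ha hne T).word (Δ.chord hb hx hz hq a ha hne).label v =
      T.word Δ.label v :=
  List.map_map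

theorem edgeWord_chord_inl (d : Δ.D) :
    (chordStacking hb hx hz hq a ha hne T).edgeWord (Δ.chord hb hx hz hq a ha hne).label
      (Sum.inl d) = T.edgeWord Δ.label d := by
  classical
  exact ite_congr rfl (fun _ => congrArg (· ++ [Δ.label d]) (word_chord hb hx hz hq a ha hne _))
    fun _ => congrArg (· ++ [Δ.label (Δ.rev d)]) (word_chord hb hx hz hq a ha hne _)

theorem edgeWord_chord_inr_true :
    (chordStacking hb hx hz hq a ha hne T).edgeWord (Δ.chord hb hx hz hq a ha hne).label
      (Sum.inr true) = T.word Δ.label u ++ [a] :=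
  ((chordStacking hb hx hz hq a ha hne T).edgeWord_of_pos _ (d := Sum.inr true) rfl).trans
    (congrArg (· ++ [a]) (word_chord hb hx hz hq a ha hne u))

theorem IsNormalStacking.chord (hT : IsNormalStacking rules T)
    (hreach : ∀ c ∈ z, T.edgeWord Δ.label c ∈ reachablePrefixes rules (T.word Δ.label u ++ [a])) :
    IsNormalStacking rules (chordStacking hb hx hz hq a ha hne T) where
  irreducible v :=
    (congrArg (IrreducibleWord rules) (word_chord hb hx hz hq a ha hne v)).mpr (hT.irreducible v)
  eval d := by
    have e := word_chord hb hx hz hq a ha hne (T := T)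
    have h1 := eval_relator ha
    rw [P.eval_cons, P.eval_wordInv, mul_inv_eq_one] at h1
    rcases d with d | _ | _
    · exact (congrArg P.eval (e (Δ.tgt d))).trans ((hT.eval d).trans
        (congrArg (P.eval · * P.rep (Δ.label d)) (e (Δ.src d)).symm))
    · refine (congrArg P.eval (e u)).trans (Eq.trans ?_
        (congrArg (P.eval · * P.rep (P.inv a)) (e v).symm))
      rw [hT.eval_path hz, P.rep_inv, h1, mul_inv_cancel_right]
    · refine (congrArg P.eval (e v)).trans (Eq.trans ?_
        (congrArg (P.eval · * P.rep a) (e u).symm))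
      rw [hT.eval_path hz, h1]
  reach f d l hf c hc := by
    have e := edgeWord_chord_inl hb hx hz hq a ha hne (T := T)
    cases f with
    | none =>
      obtain ⟨rfl, rfl⟩ := List.cons.inj
        (show Sum.inr true :: (z.map Δ.rev).reverse.map Sum.inl = d :: l from hf)
      obtain ⟨c, hc', rfl⟩ := List.mem_map.1 hc
      obtain ⟨c, hc'', rfl⟩ := List.mem_map.1 (List.mem_reverse.1 hc')
      rw [edgeWord_chord_inr_true]
      have := hreach c hc''
      rw [← T.edgeWord_rev] at this
      exact (e (Δ.rev c)).symm ▸ this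
    | some f =>
      obtain ⟨d, l, h, rfl, rfl⟩ := List.map_eq_cons_iff.1
        (show (Δ.bd f).map (Sum.inl : Δ.D → Δ.D ⊕ Bool) = _ from hf)
      obtain ⟨c, hc', rfl⟩ := List.mem_map.1 hc
      exact (e c).symm ▸ (e d).symm ▸ hT.reach f d l h c hc'

end chord

end VanKampenDiagram

end SymmetricPresentation

/-! ## Diagrams from rewritings -/

namespace SymmetricPresentation

open VanKampenDiagram Relation

variable {A : Type*} {G : Type*} [Group G] {P : SymmetricPresentation A G}
  {rules : Set (List A × List A)}

/-- There is a diagram for `w` with a normal stacking, whose boundary edges are positively oriented,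
and in which boundary paths with an irreducible label are contained in the tree. -/
def HasNormalDiagram (P : SymmetricPresentation A G) (rules : Set (List A × List A))
    (w : List A) : Prop :=
  ∃ (Δ : P.VanKampenDiagram w) (T : Δ.toTwoComplex.Stacking Δ.base), IsNormalStacking rules T ∧
    (∀ d ∈ Δ.bdry, T.pos d) ∧ (Δ.bdry = [] → IsEmpty Δ.D) ∧
    ∀ x, x <+: Δ.bdry → IrreducibleWord rules (x.map Δ.label) → ∃ u, T.path u = x

/-- There is a diagram for `x y z` with a normal stacking, in which the boundary path labelled `x` is
contained in the tree, the edges of the part labelled `y` have prefixes of `x` as their words, and the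
part labelled `z` is positively oriented. -/
def HasPartialDiagram (P : SymmetricPresentation A G) (rules : Set (List A × List A))
    (x y z : List A) : Prop :=
  ∃ (w : List A) (Δ : P.VanKampenDiagram w) (T : Δ.toTwoComplex.Stacking Δ.base)
    (X Y Z : List Δ.D) (u : Δ.V), IsNormalStacking rules T ∧ Δ.bdry = X ++ (Y ++ Z) ∧
    X.map Δ.label = x ∧ Y.map Δ.label = y ∧ Z.map Δ.label = z ∧ T.path u = X ∧
    (∀ d ∈ Y, T.edgeWord Δ.label d <+: x) ∧ (∀ d ∈ Z, T.pos d) ∧ (Δ.bdry = [] → IsEmpty Δ.D)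

/-- The boundary goes out along the new tree edge and returns at once. The edge has the word `x a`,
which is the new first part, so it may join the second part. -/
theorem HasPartialDiagram.spur {x y z : List A} (h : HasPartialDiagram P rules x y z) {a : A}
    (ha : IrreducibleWord rules (x ++ [a])) :
    HasPartialDiagram P rules (x ++ [a]) (P.inv a :: y) z := by
  obtain ⟨w, Δ, T, X, Y, Z, u, hT, hb, rfl, rfl, rfl, hu, hY, hZ, hne⟩ := h
  have hx : Δ.IsPath Δ.base X u := hu ▸ T.isPath_path u
  have hq : Δ.IsPath u (Y ++ Z) Δ.base := by
    obtain ⟨m, h1, h2⟩ := OneComplex.isPath_append.1 (hb ▸ Δ.bdry_closed)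
    rwa [← h1.unique hx]
  have hw : T.word Δ.label u ++ [a] = X.map Δ.label ++ [a] := by
    rw [TwoComplex.Stacking.word, hu]
  refine ⟨_, Δ.spur hb hx hq a hne, spurStacking hb hx hq a hne T,
    X.map Sum.inl ++ [Sum.inr true], Sum.inr false :: Y.map Sum.inl, Z.map Sum.inl, none,
    hT.spur hb hx hq a hne (hw ▸ ha), ?_, ?_, ?_, ?_, ?_, ?_, ?_, ?_⟩
  · have : X.map Sum.inl ++ (Sum.inr true :: Sum.inr false :: (Y ++ Z).map Sum.inl) =
        (X.map Sum.inl ++ [Sum.inr true]) ++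
          ((Sum.inr false :: Y.map Sum.inl) ++ Z.map Sum.inl : List (Δ.D ⊕ Bool)) := by simp
    exact this
  · exact List.map_append.trans (congrArg (· ++ [a]) List.map_map)
  · exact congrArg (P.inv a :: ·) List.map_map
  · exact List.map_map
  · exact congrArg (fun l => l.map Sum.inl ++ [Sum.inr true]) hu
  · intro d hd
    rcases List.mem_cons.1 hd with rfl | hd
    · exact (edgeWord_spur_inr hb hx hq a hne (T := T) false).symm ▸ hw ▸ List.prefix_rfl
    · obtain ⟨d, hd', rfl⟩ := List.mem_map.1 hd
      exact (edgeWord_spur_inl hb hx hq a hne (T := T) d).symm ▸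
        (hY d hd').trans (List.prefix_append _ _)
  · intro d hd
    obtain ⟨d, hd', rfl⟩ := List.mem_map.1 hd
    exact hZ d hd'
  · intro h
    exact ((List.append_ne_nil_of_right_ne_nil _ (List.cons_ne_nil _ _)) h).elim

theorem HasPartialDiagram.spurs {p z : List A} (h : HasPartialDiagram P rules p [] z) (u : List A)
    (hu : IrreducibleWord rules (p ++ u)) :
    HasPartialDiagram P rules (p ++ u) (P.wordInv u) z := by
  induction u using List.reverseRecOn with
  | nil => rwa [List.append_nil]
  | append_singleton u a ih =>
    rw [← List.append_assoc] at hu ⊢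
    have := (ih (hu.of_prefix (List.prefix_append _ _))).spur hu
    simpa [SymmetricAlphabet.wordInv] using this

/-- The chord labelled `a` cuts off the boundary part `y v`. In the application `x = p u` and `y =
u⁻¹`, so `x y` ends at the same group element as `p`, and `x a` rewrites to `p v`. -/
theorem HasPartialDiagram.chord {x y v q : List A} (h : HasPartialDiagram P rules x y (v ++ q))
    {a : A} (ha : a :: P.wordInv (y ++ v) ∈ P.relators) (hxa : ¬ IrreducibleWord rules (x ++ [a]))
    (hnf : ∀ s t, P.eval s = P.eval t → IrreducibleWord rules t →
      ReflTransGen (RewriteStep rules) s t)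
    {p : List A} (hp : ReflTransGen (RewriteStep rules) (x ++ [a]) (p ++ v))
    (hpe : P.eval p = P.eval x * P.eval y) : HasNormalDiagram P rules (x ++ a :: q) := by
  obtain ⟨w, Δ, T, X, Y, Z, u, hT, hb, rfl, rfl, hz, hu, hY, hZ, hne⟩ := h
  obtain ⟨V, Q, rfl, rfl, rfl⟩ := List.map_eq_append_iff.1 hz
  rw [← List.append_assoc Y] at hb
  have hx : Δ.IsPath Δ.base X u := hu ▸ T.isPath_path u
  obtain ⟨m, h1, h2⟩ := OneComplex.isPath_append.1 (hb ▸ Δ.bdry_closed)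
  obtain rfl : m = u := h1.unique hx
  obtain ⟨v, hYV, hQ⟩ := OneComplex.isPath_append.1 h2
  have hw : T.word Δ.label m = X.map Δ.label := by rw [TwoComplex.Stacking.word, hu]
  rw [← List.map_append] at ha
  refine ⟨Δ.chord hb hx hYV hQ a ha hne, chordStacking hb hx hYV hQ a ha hne T,
    hT.chord hb hx hYV hQ a ha hne ?_, ?_, ?_, ?_⟩
  · intro c hc
    rw [hw]
    -- Edges of `y` have prefixes of `x` as words. For an edge of `v`, rewrite `x a` to `p v`, and
    -- then the part of `p v` before the edge to the normal form of the source of the edge; the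
    -- letters of `v` after the edge are the remainder.
    rcases List.mem_append.1 hc with hc | hc
    · exact mem_reachablePrefixes_of_prefix ((hY c hc).trans (List.prefix_append _ _))
    · obtain ⟨V₁, V₂, rfl⟩ := List.append_of_mem hc
      rw [T.edgeWord_of_pos Δ.label (hZ c (List.mem_append_left _ hc))]
      rw [← List.append_assoc] at hYV
      obtain ⟨m', hm1, hm2⟩ := OneComplex.isPath_append.1 hYV
      obtain rfl : Δ.src c = m' := hm2.1
      have e : P.eval (p ++ V₁.map Δ.label) = P.eval (T.word Δ.label (Δ.src c)) := by
        rw [hT.eval_path hm1, P.eval_append, hpe, hw, List.map_append, P.eval_append, mul_assoc]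
      refine ⟨V₂.map Δ.label, hp.trans ?_⟩
      have := rewrite_context (hnf _ _ e (hT.irreducible _)) [] (Δ.label c :: V₂.map Δ.label)
      simpa using this
  · intro d hd
    rcases List.mem_append.1 hd with hd | hd
    · obtain ⟨d, hd', rfl⟩ := List.mem_map.1 hd
      exact T.pos_of_mem_path (v := m) d (hu.symm ▸ hd')
    · rcases List.mem_cons.1 hd with rfl | hd
      · exact rfl
      · obtain ⟨d, hd', rfl⟩ := List.mem_map.1 hd
        exact hZ d (List.mem_append_right _ hd')
  · intro h
    exact ((List.append_ne_nil_of_right_ne_nil _ (List.cons_ne_nil _ _)) h).elim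
  · intro x hxb hxi
    change List (Δ.D ⊕ Bool) at x
    have hxb' : x <+: X.map Sum.inl ++ (Sum.inr true :: Q.map Sum.inl) := hxb
    have hxi' : IrreducibleWord rules
      (x.map (Sum.elim Δ.label fun t => bif t then a else P.inv a)) := hxi
    -- A boundary path beyond `X` begins with the path labelled by the reducible word of `hxa`, so
    -- the irreducible ones stay within the tree path `X`.
    by_cases hlen : x.length ≤ X.length
    · have h1 : x <+: X.map Sum.inl :=
        List.prefix_of_prefix_length_le hxb' (List.prefix_append _ _) (by simpa using hlen)
      have h2 : x = (X.take x.length).map Sum.inl := by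
        rw [List.map_take]
        exact List.prefix_iff_eq_take.1 h1
      obtain ⟨u', hu'⟩ := T.exists_path_eq_of_prefix (v := m) (x := X.take x.length)
        (by rw [hu]; exact List.take_prefix _ _)
      exact ⟨u', (congrArg (List.map Sum.inl) hu').trans h2.symm⟩
    · have h1 : X.map Sum.inl ++ [Sum.inr true] <+: x := by
        refine List.prefix_of_prefix_length_le (l₃ := X.map Sum.inl ++ (Sum.inr true :: Q.map Sum.inl))
          ⟨Q.map Sum.inl, by simp⟩ hxb' ?_
        simp only [List.length_append, List.length_map, List.length_singleton]
        omega
      refine (hxa (hxi'.of_prefix ?_)).elim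
      have := h1.map (Sum.elim Δ.label fun t => bif t then a else P.inv a)
      simpa [Function.comp_def] using this

/-- An irreducible initial part of the boundary runs in the tree, so spurs added at its end prolong
tree paths. -/
theorem HasNormalDiagram.hasPartialDiagram {p z : List A}
    (h : HasNormalDiagram P rules (p ++ z)) (hp : IrreducibleWord rules p) :
    HasPartialDiagram P rules p [] z := by
  obtain ⟨Δ, T, hT, hpos, hne, hpre⟩ := h
  obtain ⟨X, Z, hb, hX, hZ⟩ := List.map_eq_append_iff.1 Δ.label_bdry
  obtain ⟨u, hu⟩ := hpre X (hb ▸ List.prefix_append _ _) (hX.symm ▸ hp)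
  exact ⟨_, Δ, T, X, [], Z, u, hT, by rw [hb, List.nil_append], hX, rfl, hZ, hu, by simp,
    fun d hd => hpos d (hb ▸ List.mem_append_right _ hd), hne⟩

theorem hasNormalDiagram_nil (P : SymmetricPresentation A G) (h : IrreducibleWord rules []) :
    HasNormalDiagram P rules [] :=
  ⟨VanKampenDiagram.trivial P,
    { path := fun _ => []
      pos := Empty.elim
      rank := Empty.elim
      path_base := rfl
      path_cases := fun _ => Or.inl rfl
      pos_rev := Empty.rec
      rank_rev := Empty.rec
      pos_cases := Empty.rec
      head_pos := Empty.rec },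
    ⟨fun _ => h, Empty.rec, Empty.rec⟩, fun _ h => (List.not_mem_nil h).elim,
    fun _ => inferInstanceAs (IsEmpty Empty), fun _ hx _ => ⟨(), (List.prefix_nil.1 hx).symm⟩⟩

end SymmetricPresentation

/-- Diagrams built from the rewritings of irreducible prefixes. -/
theorem IsFiniteCRS.hasNormalDiagram {A : Type*} {G : Type*} [Group G] {S : SymmetricAlphabet A G}
    {R : Finset (List A × List A)} (h : IsFiniteCRS S R) (w : List A) (hw : S.eval w = 1) :
    h.presentation.HasNormalDiagram (R : Set (List A × List A)) w := by
  induction w using h.terminates.induction with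
  | _ w ih =>
    by_cases hwi : IrreducibleWord (R : Set (List A × List A)) w
    · have h0 : IrreducibleWord (R : Set (List A × List A)) [] := by
        rintro y ⟨p, q, u, v, hr, hx, -⟩
        simp only [List.nil_eq, List.append_eq_nil_iff] at hx
        exact h.nil_notMem v (hx.1.2 ▸ hr)
      -- The empty word is the normal form of the identity, since no rule has an empty left side.
      obtain rfl : w = [] := (h.normalForm 1).unique ⟨hw, hwi⟩ ⟨rfl, h0⟩
      exact SymmetricPresentation.hasNormalDiagram_nil _ h0
    · obtain ⟨p, u, a, v, q, hr, rfl, hpu⟩ := exists_reducible_prefix h.nil_notMem w hwi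
      have hs : RewriteStep (R : Set (List A × List A)) (p ++ u ++ a :: q) (p ++ (v ++ q)) :=
        ⟨p, q, u ++ [a], v, hr, by simp, by simp⟩
      have hs' : RewriteStep (R : Set (List A × List A)) (p ++ u ++ [a]) (p ++ v) :=
        ⟨p, [], u ++ [a], v, hr, by simp, by simp⟩
      have h1 := ih _ (.single hs) ((h.eval_eq (.single hs)).symm.trans hw)
      have h2 := (h1.hasPartialDiagram (hpu.of_prefix (List.prefix_append _ _))).spurs u hpu
      refine h2.chord (p := p) ?_ (fun hi => hi _ hs')
        (fun s t hst ht => h.rewrites_to hst ht) (.single hs') ?_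
      · change _ ∈ S.ruleRelators R
        refine ⟨(u ++ [a], v), hr, Or.inl ?_⟩
        -- The face reads `a v⁻¹ u`, a rotation of `u a v⁻¹`.
        have e : a :: S.wordInv (S.wordInv u ++ v) = ([a] ++ S.wordInv v) ++ u := by
          have : S.wordInv (S.wordInv u ++ v) = S.wordInv v ++ S.wordInv (S.wordInv u) := by
            simp only [SymmetricAlphabet.wordInv, List.map_append, List.reverse_append]
          rw [this, S.wordInv_wordInv]
          simp
        have e' : u ++ [a] ++ S.wordInv v = u ++ ([a] ++ S.wordInv v) := List.append_assoc _ _ _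
        change (u ++ [a] ++ S.wordInv v) ~r a :: S.wordInv (S.wordInv u ++ v)
        rw [e, e']
        exact List.isRotated_append
      · change S.eval p = S.eval (p ++ u) * S.eval (S.wordInv u)
        rw [S.eval_wordInv, S.eval_append, mul_inv_cancel_right]

/-! ## Coarse distances -/

namespace TwoComplex

variable {Y Z : TwoComplex} {β : Type*}

theorem space_cases (x : Y.Space) : (∃ v, x = Y.pt (.vert v)) ∨
    (∃ d t, t ≠ 0 ∧ t ≠ 1 ∧ x = Y.pt (.edge d t)) ∨ ∃ c t s, s ≠ 0 ∧ x = Y.pt (.face c t s) := by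
  have hedge : ∀ d t, (∃ v, Y.pt (.edge d t) = Y.pt (.vert v)) ∨
      (∃ d' t', t' ≠ 0 ∧ t' ≠ 1 ∧ Y.pt (.edge d t) = Y.pt (.edge d' t')) := by
    intro d t
    by_cases h0 : t = 0
    · exact Or.inl ⟨Y.src d, by rw [h0]; exact Quot.sound (Glue.edge_src d)⟩
    · by_cases h1 : t = 1
      · refine Or.inl ⟨Y.tgt d, ?_⟩
        rw [← edgePt_one, h1, ← edgePt_coe, Set.Icc.coe_one]
      · exact Or.inr ⟨d, t, h0, h1, rfl⟩
  induction x using Quot.ind with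
  | mk x =>
    cases x with
    | vert v => exact Or.inl ⟨v, rfl⟩
    | edge d t => exact (hedge d t).imp_right Or.inl
    | face c t s =>
      by_cases h : s = 0
      · have e : Y.pt (.face c t s) = Y.pt (.edge c.dart t) := by
          rw [h]; exact Quot.sound (Glue.face_bd c t)
        change (∃ v, Y.pt (.face c t s) = _) ∨ (∃ d t', t' ≠ 0 ∧ t' ≠ 1 ∧ Y.pt (.face c t s) = _) ∨ _
        rw [e]
        exact (hedge c.dart t).imp_right Or.inl
      · exact Or.inr (Or.inr ⟨c, t, s, h, rfl⟩)

section cellFun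

variable (fV : Y.V → β) (fD : Y.D → β) (fF : Y.F → β) (hD : ∀ d, fD (Y.rev d) = fD d)

theorem cellFun_edge (d : Y.D) {t : I} (h0 : t ≠ 0) (h1 : t ≠ 1) :
    cellFun fV fD fF hD (Y.pt (.edge d t)) = fD d :=
  (if_neg h0).trans (if_neg h1)

theorem cellFun_face (c : Y.Side) (t : I) {s : I} (h : s ≠ 0) :
    cellFun fV fD fF hD (Y.pt (.face c t s)) = fF c.1.1 :=
  if_neg h

end cellFun

/-- The coarse distance of an edge, given the distances of the vertices. -/
noncomputable def edgeCoarse (δ : Y.V → ℕ) (d : Y.D) : ℝ :=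
  min (δ (Y.src d) : ℝ) (δ (Y.tgt d)) + 1 / 2

/-- The coarse distance of a 2-cell, given the distances of the vertices. -/
noncomputable def faceCoarse (δ : Y.V → ℕ) (f : Y.F) : ℝ :=
  (⨆ k : Fin (Y.bd f).length, edgeCoarse δ ((Y.bd f)[k])) - 1 / 4

theorem edgeCoarse_rev (δ : Y.V → ℕ) (d : Y.D) : edgeCoarse δ (Y.rev d) = edgeCoarse δ d := by
  rw [edgeCoarse, edgeCoarse, OneComplex.tgt_rev, min_comm, OneComplex.tgt]

/-- The coarse distance of points, given the distances of the vertices. -/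
noncomputable def coarse (δ : Y.V → ℕ) : Y.Space → ℝ :=
  cellFun (fun v => (δ v : ℝ)) (edgeCoarse δ) (faceCoarse δ) (edgeCoarse_rev δ)

theorem coarseDist_eq_coarse (y : Y.V) (x : Y.Space) :
    Y.coarseDist y x = coarse (Y.pathDist y) x := by
  induction x using Quot.ind with
  | mk x => cases x <;> rfl

theorem edgeCoarse_le_faceCoarse (δ : Y.V → ℕ) {f : Y.F} {d : Y.D} (h : d ∈ Y.bd f) :
    edgeCoarse δ d ≤ faceCoarse δ f + 1 / 4 := by
  obtain ⟨k, hk, rfl⟩ := List.mem_iff_getElem.1 h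
  rw [faceCoarse, sub_add_cancel]
  exact le_ciSup (f := fun k : Fin (Y.bd f).length => edgeCoarse δ ((Y.bd f)[k]))
    (Set.finite_range _).bddAbove ⟨k, hk⟩

theorem exists_faceCoarse_eq (δ : Y.V → ℕ) (f : Y.F) :
    ∃ d ∈ Y.bd f, faceCoarse δ f = edgeCoarse δ d - 1 / 4 := by
  have : Nonempty (Fin (Y.bd f).length) := ⟨⟨0, List.length_pos_of_ne_nil (Y.bd_ne_nil f)⟩⟩
  obtain ⟨k, hk⟩ := exists_eq_ciSup_of_finite
    (f := fun k : Fin (Y.bd f).length => edgeCoarse δ ((Y.bd f)[k]))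
  exact ⟨(Y.bd f)[k], List.getElem_mem _, by rw [faceCoarse, ← hk]⟩

/-! ### Coarse distances under cellular maps -/

namespace Hom

variable (φ : Hom Y Z)

theorem tgt (d : Y.D) : Z.tgt (φ.onD d) = φ.onV (Y.tgt d) := by
  rw [OneComplex.tgt, ← φ.rev, φ.src, OneComplex.tgt]

theorem edgeCoarseDist (z : Z.V) (d : Y.D) : Z.edgeCoarseDist z (φ.onD d) =
    edgeCoarse (fun v => Z.pathDist z (φ.onV v)) d := by
  rw [TwoComplex.edgeCoarseDist, edgeCoarse, φ.src, φ.tgt]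

theorem faceCoarseDist (z : Z.V) (f : Y.F) : Z.faceCoarseDist z (φ.onF f) =
    faceCoarse (fun v => Z.pathDist z (φ.onV v)) f := by
  have key : ∀ l : List Z.D, l = (Y.bd f).map φ.onD →
      (⨆ k : Fin l.length, Z.edgeCoarseDist z l[k]) = ⨆ k : Fin (Y.bd f).length,
        edgeCoarse (fun v => Z.pathDist z (φ.onV v)) ((Y.bd f)[k]) := by
    rintro l rfl
    refine Equiv.iSup_congr (finCongr (List.length_map _)) fun k => ?_
    rw [← φ.edgeCoarseDist]
    simp
  exact congrArg (· - 1 / 4) (key _ (φ.bd f))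

/-- Coarse distances depend only on the distances of vertices, so those of image points can be
computed in the source complex from pulled-back vertex distances. -/
theorem coarseDist (z : Z.V) (x : Y.Space) : Z.coarseDist z (φ.onSpace x) =
    coarse (fun v => Z.pathDist z (φ.onV v)) x := by
  have hedge : ∀ d t, Z.closedEdgeCoarseDist z (φ.onD d) t = closedEdgeFun
      (fun v => (Z.pathDist z (φ.onV v) : ℝ)) (edgeCoarse fun v => Z.pathDist z (φ.onV v)) d t := by
    intro d t
    rw [closedEdgeCoarseDist, closedEdgeFun, φ.edgeCoarseDist, φ.src, φ.tgt]
  induction x using Quot.ind with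
  | mk x =>
    cases x with
    | vert v => rfl
    | edge d t => exact hedge d t
    | face c t s =>
      change (if s = 0 then Z.closedEdgeCoarseDist z (φ.onSide c).dart t
        else Z.faceCoarseDist z (φ.onF c.1.1)) = if s = 0 then _ else faceCoarse _ c.1.1
      rw [φ.dart_onSide, hedge, φ.faceCoarseDist]

theorem isPath {u v : Y.V} {p : List Y.D} (h : Y.IsPath u p v) :
    Z.IsPath (φ.onV u) (p.map φ.onD) (φ.onV v) := by
  induction p generalizing u with
  | nil => exact congrArg φ.onV h
  | cons d p ih =>
    refine ⟨(φ.src d).trans (congrArg φ.onV h.1), ?_⟩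
    rw [φ.tgt]
    exact ih h.2

end Hom

theorem IsOneCombing.mono {Z Z' : Set Y.Space} {y : Y.V} {ψ : Z × I → Y.Space}
    (h : Y.IsOneCombing Z y ψ) (hZ : Z' ⊆ Z) :
    Y.IsOneCombing Z' y fun q => ψ (Set.inclusion hZ q.1, q.2) where
  continuous := h.continuous.comp
    (((continuous_inclusion hZ).comp continuous_fst).prodMk continuous_snd)
  start _ := h.start _
  finish _ := h.finish _
  base _ hp t := h.base _ hp t
  skeleton _ hp t := h.skeleton _ hp t

end TwoComplex

/-! ## Tameness -/

namespace SymmetricPresentation.VanKampenDiagram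

open TwoComplex Relation

variable {A : Type*} {G : Type*} [Group G] {P : SymmetricPresentation A G} {w : List A}
  {Δ : P.VanKampenDiagram w} {rules : Set (List A × List A)}
  {T : Δ.toTwoComplex.Stacking Δ.base}

theorem boundary_subset_skeleton1 (Δ : P.VanKampenDiagram w) :
    Δ.boundary ⊆ Δ.toTwoComplex.skeleton1 := by
  rintro x (hx | ⟨d, -, t, rfl⟩)
  · exact Or.inl ⟨Δ.base, hx.symm⟩
  · exact Or.inr ⟨(d, t), rfl⟩

theorem word_base : T.word Δ.label Δ.base = [] := by
  rw [Stacking.word, T.path_base, List.map_nil]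

theorem exists_edgeWord_eq (d : Δ.D) : ∃ d', (d' = d ∨ d' = Δ.rev d) ∧
    T.edgeWord Δ.label d = T.word Δ.label (Δ.src d') ++ [Δ.label d'] := by
  by_cases h : T.pos d
  · exact ⟨d, Or.inl rfl, T.edgeWord_of_pos _ h⟩
  · refine ⟨Δ.rev d, Or.inr rfl, ?_⟩
    rw [← T.edgeWord_rev]
    exact T.edgeWord_of_pos _ ((T.pos_rev d).2 h)

/-- Rewriting reaches every irreducible word that represents the same element. -/
def Normalizing (P : SymmetricPresentation A G) (rules : Set (List A × List A)) : Prop :=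
  ∀ s t, P.eval s = P.eval t → IrreducibleWord rules t → ReflTransGen (RewriteStep rules) s t

namespace IsNormalStacking

variable (hT : IsNormalStacking rules T) (hnf : Normalizing P rules)

include hT hnf

/-- The word of an edge reaches the normal forms of both ends: that of the positive source is a
prefix, and the whole word represents the positive target, so it rewrites to the normal form there.
A face is weighted like its first edge, and `reach` places the weights of the other edges below it.
-/
theorem isWeight : T.IsWeight (fun v => reachablePrefixes rules (T.word Δ.label v))
    (fun d => reachablePrefixes rules (T.edgeWord Δ.label d))
    (fun f => reachablePrefixes rules (T.edgeWord Δ.label ((Δ.bd f).head (Δ.bd_ne_nil f)))) where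
  rev d := by rw [T.edgeWord_rev]
  src_le d := by
    refine reachablePrefixes_subset ?_
    by_cases h : T.pos d
    · rw [T.edgeWord_of_pos _ h]
      exact mem_reachablePrefixes_of_prefix (List.prefix_append _ _)
    · rw [← T.edgeWord_rev, T.edgeWord_of_pos _ ((T.pos_rev d).2 h)]
      refine ⟨[], ?_⟩
      rw [List.append_nil]
      refine hnf _ _ ?_ (hT.irreducible _)
      have e := hT.eval (Δ.rev d)
      rw [OneComplex.tgt_rev] at e
      rw [e, P.eval_append, P.eval_cons, P.eval_nil, mul_one]
  tree_le d hpos hd := by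
    refine reachablePrefixes_subset ?_
    rw [T.edgeWord_of_pos _ hpos]
    have e : T.word Δ.label (Δ.tgt d) = T.word Δ.label (Δ.src d) ++ [Δ.label d] := by
      rw [Stacking.word, hd, List.map_append]
      rfl
    rw [e]
    exact mem_reachablePrefixes_of_prefix List.prefix_rfl
  top_le f d l hf := by
    simp only [hf, List.head_cons]
    exact le_rfl
  le_face f d hd := by
    obtain ⟨e, l, hf⟩ := List.exists_cons_of_ne_nil (Δ.bd_ne_nil f)
    refine reachablePrefixes_subset ?_
    simp only [hf, List.head_cons]
    rw [hf] at hd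
    rcases List.mem_cons.1 hd with rfl | hd
    · exact mem_reachablePrefixes_of_prefix List.prefix_rfl
    · exact hT.reach f e l hf d hd

/-- The normal form of a vertex is at least as long as its distance. For an edge, take the normal
form of an endpoint, which is short by at most `1/2`; for a face, use the boundary edge that
realizes its coarse distance. -/
theorem exists_coarse_le {δ : Δ.V → ℕ} (hδ : ∀ v, δ v ≤ (T.path v).length)
    (x : Δ.toTwoComplex.Space) :
    ∃ z ∈ (hT.isWeight hnf).fn x, coarse δ x ≤ (z.length : ℝ) + 1 := by
  have hw := hT.isWeight hnf
  have hedge : ∀ d : Δ.D, ∃ z ∈ reachablePrefixes rules (T.edgeWord Δ.label d),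
      edgeCoarse δ d ≤ (z.length : ℝ) + 1 := by
    intro d
    refine ⟨T.word Δ.label (Δ.src d),
      hw.src_le d (mem_reachablePrefixes_of_prefix List.prefix_rfl), ?_⟩
    have h1 : (δ (Δ.src d) : ℝ) ≤ (T.word Δ.label (Δ.src d)).length := by
      rw [Stacking.word, List.length_map]
      exact_mod_cast hδ _
    have h2 := min_le_left (δ (Δ.src d) : ℝ) (δ (Δ.tgt d))
    rw [edgeCoarse]
    linarith
  rcases space_cases x with ⟨v, rfl⟩ | ⟨d, t, h0, h1, rfl⟩ | ⟨c, t, s, h, rfl⟩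
  · refine ⟨T.word Δ.label v, mem_reachablePrefixes_of_prefix List.prefix_rfl, ?_⟩
    change (δ v : ℝ) ≤ _
    rw [Stacking.word, List.length_map]
    have : (δ v : ℝ) ≤ (T.path v).length := by exact_mod_cast hδ v
    linarith
  · rw [Stacking.IsWeight.fn, cellFun_edge _ _ _ _ d h0 h1, coarse, cellFun_edge _ _ _ _ d h0 h1]
    exact hedge d
  · rw [Stacking.IsWeight.fn, cellFun_face _ _ _ _ c t h, coarse, cellFun_face _ _ _ _ c t h]
    obtain ⟨d, hd, e⟩ := exists_faceCoarse_eq δ c.1.1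
    obtain ⟨z, hz, hzl⟩ := hedge d
    exact ⟨z, hw.le_face _ d hd hz, by linarith⟩

/-- A shortest word for a vertex rewrites to its normal form, so a short word reaches the word of
each cell. The summand 2 allows for one letter along an edge and possibly one letter back. -/
theorem exists_length_le {δ : Δ.V → ℕ}
    (hδ : ∀ v, ∃ s : List A, s.length = δ v ∧ P.eval s = P.eval (T.word Δ.label v))
    (x : Δ.toTwoComplex.Space) :
    ∃ s : List A, s.length ≤ ⌈coarse δ x⌉₊ + 2 ∧
      (hT.isWeight hnf).fn x ⊆ reachablePrefixes rules s := by
  have hw := hT.isWeight hnf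
  have hedge : ∀ d : Δ.D, ∃ s : List A, (s.length : ℝ) ≤ edgeCoarse δ d + 3 / 2 ∧
      reachablePrefixes rules (T.edgeWord Δ.label d) ⊆ reachablePrefixes rules s := by
    have key : ∀ d : Δ.D, ∃ s : List A, (s.length : ℝ) ≤ edgeCoarse δ d + 3 / 2 ∧
        ReflTransGen (RewriteStep rules) s (T.word Δ.label (Δ.src d) ++ [Δ.label d]) := by
      intro d
      rcases le_total (δ (Δ.src d) : ℝ) (δ (Δ.tgt d)) with hle | hle
      · obtain ⟨s, hs, he⟩ := hδ (Δ.src d)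
        refine ⟨s ++ [Δ.label d], ?_, ?_⟩
        · rw [edgeCoarse, min_eq_left hle, List.length_append, hs, List.length_singleton]
          push_cast
          linarith
        · simpa using rewrite_context (hnf _ _ he (hT.irreducible _)) [] [Δ.label d]
      · obtain ⟨s, hs, he⟩ := hδ (Δ.tgt d)
        -- If the target is nearer, go back along the edge first. Everything except the last letter
        -- represents the source and is rewritten to its normal form; the last letter remains.
        refine ⟨(s ++ [P.inv (Δ.label d)]) ++ [Δ.label d], ?_, ?_⟩
        · rw [edgeCoarse, min_eq_right hle, List.length_append, List.length_append, hs,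
            List.length_singleton, List.length_singleton]
          push_cast
          linarith
        · have e : P.eval (s ++ [P.inv (Δ.label d)]) = P.eval (T.word Δ.label (Δ.src d)) := by
            rw [P.eval_append, he, hT.eval, P.eval_cons, P.eval_nil, P.rep_inv, mul_one,
              mul_inv_cancel_right]
          simpa using rewrite_context (hnf _ _ e (hT.irreducible _)) [] [Δ.label d]
    intro d
    obtain ⟨d', hd', e⟩ := exists_edgeWord_eq (T := T) d
    obtain ⟨s, hs, hr⟩ := key d'
    refine ⟨s, ?_, ?_⟩
    · rcases hd' with rfl | rfl
      · exact hs
      · rwa [edgeCoarse_rev] at hs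
    · rw [e]
      exact reachablePrefixes_subset ⟨[], by rwa [List.append_nil]⟩
  have hnat : ∀ (n : ℕ) (r : ℝ), (n : ℝ) ≤ r + 2 → n ≤ ⌈r⌉₊ + 2 := by
    intro n r h
    have h1 := Nat.le_ceil r
    have h2 : (n : ℝ) ≤ ((⌈r⌉₊ + 2 : ℕ) : ℝ) := by push_cast; linarith
    exact_mod_cast h2
  rcases space_cases x with ⟨v, rfl⟩ | ⟨d, t, h0, h1, rfl⟩ | ⟨c, t, s, h, rfl⟩
  · obtain ⟨s, hs, he⟩ := hδ v
    refine ⟨s, hnat _ _ ?_, reachablePrefixes_subset ⟨[], ?_⟩⟩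
    · change (s.length : ℝ) ≤ (δ v : ℝ) + 2
      rw [hs]
      linarith
    · rw [List.append_nil]
      exact hnf _ _ he (hT.irreducible _)
  · rw [Stacking.IsWeight.fn, cellFun_edge _ _ _ _ d h0 h1, coarse, cellFun_edge _ _ _ _ d h0 h1]
    obtain ⟨s, hs, hr⟩ := hedge d
    exact ⟨s, hnat _ _ (by linarith), hr⟩
  · rw [Stacking.IsWeight.fn, cellFun_face _ _ _ _ c t h, coarse, cellFun_face _ _ _ _ c t h]
    -- The first edge exceeds the face by at most `1/4` in coarse distance, and `3/2 + 1/4 ≤ 2`.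
    obtain ⟨s, hs, hr⟩ := hedge ((Δ.bd c.1.1).head (Δ.bd_ne_nil _))
    have := edgeCoarse_le_faceCoarse δ (List.head_mem (Δ.bd_ne_nil c.1.1))
    exact ⟨s, hnat _ _ (by linarith), hr⟩

-- The tree path bounds the distance from above, and the label of a shortest path is the required
-- word.
omit hnf in
theorem intrinsic_dist (v : Δ.V) : Δ.pathDist Δ.base v ≤ (T.path v).length ∧
    ∃ s : List A, s.length = Δ.pathDist Δ.base v ∧ P.eval s = P.eval (T.word Δ.label v) := by
  have hmem : (T.path v).length ∈ {n | ∃ p, Δ.IsPath Δ.base p v ∧ p.length = n} :=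
    ⟨_, T.isPath_path v, rfl⟩
  refine ⟨Nat.sInf_le hmem, ?_⟩
  obtain ⟨p, hp, hl⟩ := Nat.sInf_mem ⟨_, hmem⟩
  refine ⟨p.map Δ.label, by rw [List.length_map]; exact hl, ?_⟩
  rw [hT.eval_path hp, word_base, P.eval_nil, one_mul]

end IsNormalStacking

end VanKampenDiagram

/-! ### Distances in the Cayley complex -/

theorem eval_of_isPath_cayleyGraph {A : Type*} {G : Type*} [Group G]
    (P : SymmetricPresentation A G) {u v : G} {p : List (G × A)}
    (h : P.cayleyGraph.IsPath u p v) : v = u * P.eval (p.map Prod.snd) := by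
  induction p generalizing u with
  | nil => exact (Eq.symm h).trans (mul_one u).symm
  | cons d p ih =>
    obtain ⟨rfl, h⟩ := h
    refine (ih h).trans ?_
    rw [List.map_cons, P.eval_cons]
    exact mul_assoc (d.1 : G) (P.rep d.2) _

namespace VanKampenDiagram

open TwoComplex

variable {A : Type*} {G : Type*} [Group G] {P : SymmetricPresentation A G} {w : List A}
  {Δ : P.VanKampenDiagram w} {rules : Set (List A × List A)}
  {T : Δ.toTwoComplex.Stacking Δ.base}

/-- The map to the Cayley complex. -/
def IsNormalStacking.cayleyMap (hT : IsNormalStacking rules T) :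
    TwoComplex.Hom Δ.toTwoComplex P.cayleyComplex where
  onV v := P.eval (T.word Δ.label v)
  onD d := (P.eval (T.word Δ.label (Δ.src d)), Δ.label d)
  onF f := ⟨(Δ.bd f).map fun d => (P.eval (T.word Δ.label (Δ.src d)), Δ.label d), by
    rw [List.map_map]; exact Δ.label_bd f, by
    obtain ⟨u, hu⟩ := Δ.bd_closed f
    refine ⟨P.eval (T.word Δ.label u), ?_⟩
    have key : ∀ (p : List Δ.D) (a b : Δ.V), Δ.IsPath a p b → P.cayleyGraph.IsPath
        (P.eval (T.word Δ.label a))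
        (p.map fun d => (P.eval (T.word Δ.label (Δ.src d)), Δ.label d))
        (P.eval (T.word Δ.label b)) := by
      intro p
      induction p with
      | nil => rintro a b rfl; exact rfl
      | cons d p ih =>
        rintro a b ⟨rfl, h⟩
        refine ⟨rfl, ?_⟩
        have e := ih _ _ h
        rw [hT.eval] at e
        exact e
    exact key _ _ _ hu⟩
  src _ := rfl
  rev d := Prod.ext (hT.eval d) (Δ.label_rev d)
  bd _ := rfl

theorem IsNormalStacking.isCayleyMap (hT : IsNormalStacking rules T) :
    Δ.IsCayleyMap hT.cayleyMap where
  base := by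
    change P.eval (T.word Δ.label Δ.base) = 1
    rw [word_base, P.eval_nil]
  label _ := rfl

theorem IsNormalStacking.extrinsic_dist (hT : IsNormalStacking rules T) (v : Δ.V) :
    P.cayleyComplex.pathDist (1 : G) (hT.cayleyMap.onV v) ≤ (T.path v).length ∧
    ∃ s : List A, s.length = P.cayleyComplex.pathDist (1 : G) (hT.cayleyMap.onV v) ∧
      P.eval s = P.eval (T.word Δ.label v) := by
  have hmem : (T.path v).length ∈
      {n | ∃ p, P.cayleyComplex.IsPath (1 : G) p (hT.cayleyMap.onV v) ∧ p.length = n} := by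
    have := hT.cayleyMap.isPath (T.isPath_path v)
    rw [hT.isCayleyMap.base] at this
    exact ⟨_, this, List.length_map _⟩
  refine ⟨Nat.sInf_le hmem, ?_⟩
  obtain ⟨p, hp, hl⟩ := Nat.sInf_mem ⟨_, hmem⟩
  refine ⟨List.map Prod.snd (show List (G × A) from p), (List.length_map _).trans hl, ?_⟩
  exact ((eval_of_isPath_cayleyGraph P hp).trans (one_mul _)).symm

end VanKampenDiagram

end SymmetricPresentation

theorem IsFiniteCRS.length_le_stringGrowth {A : Type*} {G : Type*} [Group G]
    {S : SymmetricAlphabet A G} {R : Finset (List A × List A)} (h : IsFiniteCRS S R) {n : ℕ}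
    {s z : List A} (hs : s.length ≤ n)
    (hz : z ∈ reachablePrefixes (R : Set (List A × List A)) s) : z.length ≤ stringGrowth R n := by
  obtain ⟨r, hr⟩ := hz
  have := (h.stringGrowth_isGreatest n).2 ⟨s, z ++ r, hs, hr, rfl⟩
  rw [List.length_append] at this
  omega

theorem IsFiniteCRS.stringGrowth_mono {A : Type*} {G : Type*} [Group G]
    {S : SymmetricAlphabet A G} {R : Finset (List A × List A)} (h : IsFiniteCRS S R) :
    Monotone (stringGrowth R) := by
  intro m n hmn
  obtain ⟨s, z, hs, hz, hl⟩ := (h.stringGrowth_isGreatest m).1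
  exact (h.stringGrowth_isGreatest n).2 ⟨s, z, hs.trans hmn, hz, hl⟩

open SymmetricPresentation SymmetricPresentation.VanKampenDiagram in
theorem mainTheorem7 {A : Type*} {G : Type*} [Group G] (S : SymmetricAlphabet A G)
    (R : Finset (List A × List A)) (h : IsFiniteCRS S R) :
    h.presentation.IsIntrinsicTameFilling
      (fun n : ℝ => (stringGrowth R (⌈n⌉₊ + maxRuleLength R + 2) : ℝ) + 1) ∧
    h.presentation.IsExtrinsicTameFilling
      (fun n : ℝ => (stringGrowth R (⌈n⌉₊ + maxRuleLength R + 2) : ℝ) + 1) := by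
  set f : ℝ → ℝ := fun n : ℝ => (stringGrowth R (⌈n⌉₊ + maxRuleLength R + 2) : ℝ) + 1 with hf
  have hmaps : Set.MapsTo f quarterNat quarterNat := fun n _ =>
    -- The values are natural numbers, hence quarter-integers with numerator divisible by 4.
    ⟨4 * (stringGrowth R (⌈n⌉₊ + maxRuleLength R + 2) + 1), by simp only [hf]; push_cast; ring⟩
  have hmono : MonotoneOn f quarterNat := fun a _ b _ hab => by
    have h1 : stringGrowth R (⌈a⌉₊ + maxRuleLength R + 2) ≤
        stringGrowth R (⌈b⌉₊ + maxRuleLength R + 2) :=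
      h.stringGrowth_mono (by have := Nat.ceil_mono hab; omega)
    have h2 : (stringGrowth R (⌈a⌉₊ + maxRuleLength R + 2) : ℝ) ≤
        stringGrowth R (⌈b⌉₊ + maxRuleLength R + 2) := by exact_mod_cast h1
    simp only [hf]
    linarith
  have hnf : Normalizing h.presentation (R : Set (List A × List A)) :=
    fun s t hst ht => h.rewrites_to hst ht
  have key : ∀ w : List A, h.presentation.eval w = 1 →
      ∃ (Δ : h.presentation.VanKampenDiagram w)
        (ψ : Δ.boundary × I → Δ.toTwoComplex.Space),
        Δ.toTwoComplex.IsOneCombing Δ.boundary Δ.base ψ ∧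
        Δ.toTwoComplex.IsTame Δ.base f ψ ∧
        ∃ π : TwoComplex.Hom Δ.toTwoComplex h.presentation.cayleyComplex, Δ.IsCayleyMap π ∧
          h.presentation.cayleyComplex.IsTame (1 : G) f (π.onSpace ∘ ψ) := by
    intro w hw
    obtain ⟨Δ, T, hT, -⟩ := h.hasNormalDiagram w hw
    obtain ⟨ψ, hψ, hψm⟩ := (hT.isWeight hnf).exists_isOneCombing
    -- Here `δ` stands for either metric, in the diagram or pulled back from the Cayley complex.
    have tame : ∀ δ : Δ.V → ℕ, (∀ v, δ v ≤ (T.path v).length ∧ ∃ s : List A, s.length = δ v ∧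
        h.presentation.eval s = h.presentation.eval (T.word Δ.label v)) →
        ∀ (p : Δ.toTwoComplex.skeleton1) (s t : I), s < t →
          TwoComplex.coarse δ (ψ (p, s)) ≤ f (TwoComplex.coarse δ (ψ (p, t))) := by
      intro δ hδ p s t hst
      obtain ⟨z, hz, hzl⟩ := hT.exists_coarse_le hnf (fun v => (hδ v).1) (ψ (p, s))
      obtain ⟨x, hx, hr⟩ := hT.exists_length_le hnf (fun v => (hδ v).2) (ψ (p, t))
      have h1 : z.length ≤ stringGrowth R
          (⌈TwoComplex.coarse δ (ψ (p, t))⌉₊ + maxRuleLength R + 2) :=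
        -- A word in the earlier weight lies in the later one, so it is a reachable prefix of a word
        -- of length at most the rounded-up later distance plus 2, which is within the argument of
        -- `stringGrowth`.
        h.length_le_stringGrowth (by omega) (hr (hψm p s t hst.le hz))
      have h2 : (z.length : ℝ) ≤ stringGrowth R
          (⌈TwoComplex.coarse δ (ψ (p, t))⌉₊ + maxRuleLength R + 2) := by exact_mod_cast h1
      simp only [hf]
      linarith
    refine ⟨Δ, _, hψ.mono Δ.boundary_subset_skeleton1, fun p s t hst => ?_, hT.cayleyMap,
      hT.isCayleyMap, fun p s t hst => ?_⟩
    · rw [TwoComplex.coarseDist_eq_coarse, TwoComplex.coarseDist_eq_coarse]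
      exact tame _ hT.intrinsic_dist _ s t hst
    · have e := hT.cayleyMap.coarseDist (1 : G)
      refine (e _).trans_le ((tame _ hT.extrinsic_dist _ s t hst).trans_eq ?_)
      exact congrArg f (e _).symm
  refine ⟨⟨hmaps, hmono, fun w hw => ?_⟩, hmaps, hmono, fun w hw => ?_⟩
  · obtain ⟨Δ, ψ, h1, h2, -⟩ := key w hw
    exact ⟨Δ, ψ, h1, h2⟩
  · obtain ⟨Δ, ψ, h1, -, h2⟩ := key w hw
    exact ⟨Δ, ψ, h1, h2⟩
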